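/- Let $k\ge 1$, $n=2k$, let $a<0$ and $c\neq 0$ be real, and let $l_0,\dots,l_{k-1}\in\mathbb C$. Consider the DNLSII (Chen–Lee–Liu) equation $$\mathrm i q_t+q_{xx}+\mathrm i|q|^2q_x=0,\qquad (x,t)\in\mathbb R^2, \tag{1}$$ and its periodic seed solution $q=c\,e^{\mathrm i\rho}$, $\rho=ax+bt$, $b=-a^2-c^2a$. Put $\lambda_0=\sqrt{-a/2}+\tfrac{\mathrm i c}{2}$. For $\lambda\in\mathbb C\setminus\{0\}$ and $s$ with $s^2=4a^2+16a\lambda^2-4c^2a+16\lambda^4+8\lambda^2c^2+c^4$ put $$\theta=-\tfrac{s}{4}x+\tfrac{(2a+c^2-4\lambda^2)s}{8}t,\qquad \psi_{11}(\lambda)=\frac{2\mathrm i a+4\mathrm i\lambda^2-\mathrm i c^2+\mathrm i s}{4\lambda}\,e^{\mathrm i(\rho/2+\theta)},\qquad \psi_{12}(\lambda)=c\,e^{\mathrm i(-\rho/2+\theta)} .$$ Let $s(\epsilon)$ be any branch, analytic near $\epsilon=0$, of the square root $s$ at $\lambda=\lambda_0+\epsilon^2$; at $-\lambda^*$ the conjugate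 value $s^*$ is used. For $\lambda=\lambda_0+\epsilon^2$ let $$f=C_1\psi_{11}(\lambda)+C_2\,\psi_{12}(-\lambda^*)^*,\qquad g=C_1\psi_{12}(\lambda)+C_2\,\psi_{11}(-\lambda^*)^*,\qquad C_{1}=e^{\mathrm i s\sum_{m=0}^{k-1}\epsilon^{2m}l_m},\quad C_2=e^{-\mathrm i s\sum_{m=0}^{k-1}\epsilon^{2m}l_m}.$$ For $\epsilon_1,\dots,\epsilon_k$ near $0$ let $\lambda_{2j-1}=\lambda_0+\epsilon_j^2$ with $(f_{2j-1},g_{2j-1})=(f,g)|_{\epsilon=\epsilon_j}$, and $\lambda_{2j}=-\lambda_{2j-1}^*$ with $(f_{2j},g_{2j})=(g_{2j-1}^*,f_{2j-1}^*)$. Let $W_n,\widehat{W_n},M_n$ be the $n\times n$ matrices whose $i$-th rows are $$(\lambda_i^{n-1}f_i,\ \lambda_i^{n-2}g_i,\ \lambda_i^{n-3}f_i,\dots,\lambda_i f_i,\ g_i),\quad (\lambda_i^{n-1}g_i,\ \lambda_i^{n-2}f_i,\ \lambda_i^{n-3}g_i,\dots,\lambda_i g_i,\ f_i),\quad (\lambda_i^{n}f_i,\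 \lambda_i^{n-2}f_i,\ \lambda_i^{n-3}g_i,\dots,\lambda_i g_i,\ f_i).$$ The $k$-th order rogue wave with parameters $a,c,l_0,\dots,l_{k-1}$ is the solution of (1) that is, at every $(x,t)$, the limit of the $n$-th order Darboux potential $\frac{|\widehat{W_n}|}{|W_n|}q-2\mathrm i\frac{|M_n|}{|W_n|}$ (with $|W_n|\ne0$ near the limit) as $\epsilon_1,\dots,\epsilon_k\to0$ with all $\epsilon_j\neq0$ and $\epsilon_1^2,\dots,\epsilon_k^2$ pairwise distinct. Let $W_n',\widehat{W_n}',M_n'$ be obtained from $W_n,\widehat{W_n},M_n$ by setting all $\epsilon_j$ equal to one real variable $\epsilon$ and replacing every entry of the $i$-th row by its $n_i$-th derivative in $\epsilon$ at $\epsilon=0$, where $n_i=i$ if $i$ is odd and $n_i=i-1$ if $i$ is even. Then $|W_n'|\neq0$ for all $(x,t)\in\mathbb R^2$, and for every choice of the parameters $a,c,l_0,\dots,l_{k-1}$ the $k$-th order rogue wave of the DNLSII equation is $$q^{[n]}=\frac{|\widehat{W_n}'|}{|W_n'|}\,q-2\mathrm i\,\frac{|M_n'|}{|W_n'|}.$$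 -/

import Mathlib

open Filter Topology

noncomputable section

namespace DNLSII

/-- `q` is a classical solution on the whole `(x,t)`-plane of the DNLSII (Chen-Lee-Liu) equation
`i q_t + q_xx + i |q|^2 q_x = 0`. -/
def IsSolution (q : ℝ → ℝ → ℂ) : Prop :=
  ContDiff ℝ 2 (Function.uncurry q) ∧
    ∀ x t : ℝ,
      Complex.I * deriv (fun t' => q x t') t + iteratedDeriv 2 (fun x' => q x' t) x
        + Complex.I * ((‖q x t‖ ^ 2 : ℝ) : ℂ) * deriv (fun x' => q x' t) x = 0

/-! ### Determinants of the `n`-fold Darboux transformation -/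

section Darboux

variable {n : ℕ}

/-- The Vandermonde-type matrix `W_n`, whose `i`-th row is
`(λ_i^(n-1) f_i, λ_i^(n-2) g_i, λ_i^(n-3) f_i, …)`. -/
def matW (lam f g : Fin n → ℂ) : Matrix (Fin n) (Fin n) ℂ :=
  Matrix.of fun i j => lam i ^ (n - 1 - (j : ℕ)) * (if Even (j : ℕ) then f i else g i)

/-- The matrix `Ŵ_n`, whose `i`-th row is
`(λ_i^(n-1) g_i, λ_i^(n-2) f_i, λ_i^(n-3) g_i, …)`. -/
def matWhat (lam f g : Fin n → ℂ) : Matrix (Fin n) (Fin n) ℂ :=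
  Matrix.of fun i j => lam i ^ (n - 1 - (j : ℕ)) * (if Even (j : ℕ) then g i else f i)

/-- The matrix `M_n` (for even `n`), whose `i`-th row is
`(λ_i^n f_i, λ_i^(n-2) f_i, λ_i^(n-3) g_i, …, λ_i g_i, f_i)`. -/
def matM (lam f g : Fin n → ℂ) : Matrix (Fin n) (Fin n) ℂ :=
  Matrix.of fun i j =>
    if (j : ℕ) = 0 then lam i ^ n * f i
    else lam i ^ (n - 1 - (j : ℕ)) * (if Even (j : ℕ) then g i else f i)

/-- The `n`-th order potential (for even `n`)
`(|Ŵ_n| / |W_n|) q - 2 i |M_n| / |W_n|`, where `q` is the value of the seed. -/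
def potential (q : ℂ) (W What M : Matrix (Fin n) (Fin n) ℂ) : ℂ :=
  What.det / W.det * q - 2 * Complex.I * (M.det / W.det)

end Darboux

/-! ### The periodic seed and its eigenfunctions -/

/-- The phase `ρ = a x + b t`, with `b = -a^2 - c^2 a`. -/
def rho (a c x t : ℝ) : ℝ := a * x + (-a ^ 2 - c ^ 2 * a) * t

/-- The periodic seed solution `q = c exp(i ρ)`. -/
def seed (a c x t : ℝ) : ℂ := c * Complex.exp (Complex.I * (rho a c x t : ℂ))

/-- The critical eigenvalue `λ_0 = √(-a/2) + i c / 2`. -/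
def lam0 (a c : ℝ) : ℂ := (Real.sqrt (-a / 2) : ℂ) + Complex.I * (c : ℂ) / 2

/-- The radicand `s^2` as a function of the eigenvalue. -/
def radicand (a c : ℝ) (lam : ℂ) : ℂ :=
  4 * (a : ℂ) ^ 2 + 16 * a * lam ^ 2 - 4 * (c : ℂ) ^ 2 * a + 16 * lam ^ 4
    + 8 * lam ^ 2 * (c : ℂ) ^ 2 + (c : ℂ) ^ 4

/-- The exponent `-(s/4) x + ((2 a + c^2 - 4 λ^2) s / 8) t`. -/
def theta (a c : ℝ) (lam s : ℂ) (x t : ℝ) : ℂ :=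
  -(s / 4) * x + (2 * a + (c : ℂ) ^ 2 - 4 * lam ^ 2) * s / 8 * t

/-- First component of the eigenfunction `Ψ_1`; `s` is the chosen square root of the radicand. -/
def psi11 (a c : ℝ) (lam s : ℂ) (x t : ℝ) : ℂ :=
  (2 * Complex.I * a + 4 * Complex.I * lam ^ 2 - Complex.I * (c : ℂ) ^ 2 + Complex.I * s)
      / (4 * lam)
    * Complex.exp (Complex.I * ((rho a c x t : ℂ) / 2 + theta a c lam s x t))

/-- Second component of the eigenfunction `Ψ_1`. -/
def psi12 (a c : ℝ) (lam s : ℂ) (x t : ℝ) : ℂ :=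
  c * Complex.exp (Complex.I * (-((rho a c x t : ℂ) / 2) + theta a c lam s x t))

/-- The eigenvalue `λ_0 + ε^2`. -/
def lamEps (a c : ℝ) (ε : ℂ) : ℂ := lam0 a c + ε ^ 2

/-- `s` is a branch, analytic near `ε = 0`, of the square root of the radicand at the eigenvalue
`λ_0 + ε^2`. -/
def IsBranch (a c : ℝ) (s : ℂ → ℂ) : Prop :=
  AnalyticAt ℂ s 0 ∧ ∀ᶠ ε in 𝓝 (0 : ℂ), s ε ^ 2 = radicand a c (lamEps a c ε)

/-- Such a branch exists. -/
theorem exists_isBranch {a c : ℝ} (ha : a < 0) (hc : c ≠ 0) : ∃ s : ℂ → ℂ, IsBranch a c s := by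
  set r : ℝ := Real.sqrt (-a / 2) with hr
  have hr0 : 0 < r := Real.sqrt_pos.mpr (by linarith)
  have hr2 : r ^ 2 = -a / 2 := Real.sq_sqrt (by linarith)
  have hA : (a : ℂ) = -2 * (r : ℂ) ^ 2 := by
    have : a = -2 * r ^ 2 := by linarith
    exact_mod_cast this
  let P : ℂ → ℂ := fun ε =>
    (2 * lam0 a c + ε ^ 2) * (Complex.I * c + ε ^ 2) * (2 * (r : ℂ) + ε ^ 2)
  have hP0 : P 0 ∈ Complex.slitPlane := by
    refine Or.inr ?_
    have : (P 0).im = 4 * r ^ 2 * c := by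
      simp [P, lam0, ← hr]
      ring
    rw [this]
    positivity
  refine ⟨fun ε => 4 * ε * P ε ^ (1 / 2 : ℂ), ?_, Eventually.of_forall fun ε => ?_⟩
  · have hP : AnalyticAt ℂ P 0 := by
      simp only [P]
      fun_prop
    exact (analyticAt_const.mul analyticAt_id).mul (hP.cpow analyticAt_const hP0)
  · have h2 : (P ε ^ (1 / 2 : ℂ)) ^ 2 = P ε := by
      rw [← Complex.cpow_nat_mul]
      norm_num
    have hI3 : Complex.I ^ 3 = -Complex.I := by rw [pow_succ, Complex.I_sq]; ring
    have hI4 : Complex.I ^ 4 = 1 := Complex.I_pow_four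
    rw [mul_pow, h2]
    simp only [P, radicand, lamEps, lam0, ← hr, hA]
    ring_nf
    simp only [Complex.I_sq, hI3, hI4]
    ring

section Eigenfunctions

variable {k : ℕ}

/-- The superposition coefficient `C_1 = exp(i s ∑_{m<k} l_m ε^(2m))`. -/
def C1 (l : Fin k → ℂ) (s : ℂ → ℂ) (ε : ℂ) : ℂ :=
  Complex.exp (Complex.I * s ε * ∑ m : Fin k, ε ^ (2 * (m : ℕ)) * l m)

/-- The superposition coefficient `C_2 = exp(-i s ∑_{m<k} l_m ε^(2m))`. -/
def C2 (l : Fin k → ℂ) (s : ℂ → ℂ) (ε : ℂ) : ℂ :=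
  Complex.exp (-Complex.I * s ε * ∑ m : Fin k, ε ^ (2 * (m : ℕ)) * l m)

/-- First component `C_1 ψ_11(λ) + C_2 (ψ_12(-λ^*))^*` of the superposed eigenfunction at
`λ = λ_0 + ε^2`. The square root at `-λ^*` is the complex conjugate of the one at `λ`. -/
def eigF (a c : ℝ) (l : Fin k → ℂ) (s : ℂ → ℂ) (x t : ℝ) (ε : ℂ) : ℂ :=
  C1 l s ε * psi11 a c (lamEps a c ε) (s ε) x t
    + C2 l s ε * star (psi12 a c (-star (lamEps a c ε)) (star (s ε)) x t)

/-- Second component `C_1 ψ_12(λ) + C_2 (ψ_11(-λ^*))^*` of the superposed eigenfunction. -/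
def eigG (a c : ℝ) (l : Fin k → ℂ) (s : ℂ → ℂ) (x t : ℝ) (ε : ℂ) : ℂ :=
  C1 l s ε * psi12 a c (lamEps a c ε) (s ε) x t
    + C2 l s ε * star (psi11 a c (-star (lamEps a c ε)) (star (s ε)) x t)

/-- The `0`-based position `i` of the `2k` eigenvalues belongs to the pair number `i / 2`. -/
def pair (i : Fin (2 * k)) : Fin k := ⟨(i : ℕ) / 2, by omega⟩

/-! The `2k` eigenvalues and eigenfunctions, in pairs: the first member of the `j`-th pair has the
eigenvalue `λ = λ_0 + ε_j^2` and the eigenfunction `(f, g)`, the second one `-λ^*` and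
`(g^*, f^*)`. -/

def lamSeq (a c : ℝ) (ε : Fin k → ℂ) (i : Fin (2 * k)) : ℂ :=
  if Even (i : ℕ) then lamEps a c (ε (pair i)) else -star (lamEps a c (ε (pair i)))

def fSeq (a c : ℝ) (l : Fin k → ℂ) (s : ℂ → ℂ) (x t : ℝ) (ε : Fin k → ℂ) (i : Fin (2 * k)) : ℂ :=
  if Even (i : ℕ) then eigF a c l s x t (ε (pair i)) else star (eigG a c l s x t (ε (pair i)))

def gSeq (a c : ℝ) (l : Fin k → ℂ) (s : ℂ → ℂ) (x t : ℝ) (ε : Fin k → ℂ) (i : Fin (2 * k)) : ℂ :=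
  if Even (i : ℕ) then eigG a c l s x t (ε (pair i)) else star (eigF a c l s x t (ε (pair i)))

/-- `W_{2k}` for the eigenvalues `λ_0 + ε_j^2` and their partners. -/
def WAt (a c : ℝ) (l : Fin k → ℂ) (s : ℂ → ℂ) (x t : ℝ) (ε : Fin k → ℂ) :
    Matrix (Fin (2 * k)) (Fin (2 * k)) ℂ :=
  matW (lamSeq a c ε) (fSeq a c l s x t ε) (gSeq a c l s x t ε)

/-- `Ŵ_{2k}` for the eigenvalues `λ_0 + ε_j^2` and their partners. -/
def WhatAt (a c : ℝ) (l : Fin k → ℂ) (s : ℂ → ℂ) (x t : ℝ) (ε : Fin k → ℂ) :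
    Matrix (Fin (2 * k)) (Fin (2 * k)) ℂ :=
  matWhat (lamSeq a c ε) (fSeq a c l s x t ε) (gSeq a c l s x t ε)

/-- `M_{2k}` for the eigenvalues `λ_0 + ε_j^2` and their partners. -/
def MAt (a c : ℝ) (l : Fin k → ℂ) (s : ℂ → ℂ) (x t : ℝ) (ε : Fin k → ℂ) :
    Matrix (Fin (2 * k)) (Fin (2 * k)) ℂ :=
  matM (lamSeq a c ε) (fSeq a c l s x t ε) (gSeq a c l s x t ε)

/-- The `2k`-th order potential `q^[2k]` generated from the periodic seed by the eigenvalues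
`λ_0 + ε_j^2` and their partners. -/
def qAt (a c : ℝ) (l : Fin k → ℂ) (s : ℂ → ℂ) (ε : Fin k → ℂ) (x t : ℝ) : ℂ :=
  potential (seed a c x t) (WAt a c l s x t ε) (WhatAt a c l s x t ε) (MAt a c l s x t ε)

/-- The filter of the degeneration: all `ε_j` tend to `0`, with the eigenvalues `λ_0 + ε_j^2`
pairwise distinct and different from `λ_0`. -/
def degeneration (k : ℕ) : Filter (Fin k → ℂ) :=
  𝓝[{ε | (∀ j, ε j ≠ 0) ∧ Function.Injective fun j => ε j ^ 2}] 0

/-- `Q` is the `k`-th order rogue wave with the parameters `a, c, l_0, …, l_{k-1}`: a solution of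
the DNLSII equation that is the limit of the potentials `q^[2k]` as the (distinct) eigenvalues all
degenerate to the critical one. -/
def IsRogueWave (a c : ℝ) (l : Fin k → ℂ) (s : ℂ → ℂ) (Q : ℝ → ℝ → ℂ) : Prop :=
  IsSolution Q ∧
    ∀ x t : ℝ,
      (∀ᶠ ε in degeneration k, (WAt a c l s x t ε).det ≠ 0) ∧
      Tendsto (fun ε => qAt a c l s ε x t) (degeneration k) (𝓝 (Q x t))

/-- For the `1`-based row number `i`: `n_i = i` if `i` is odd, `n_i = i - 1` if `i` is even. -/
def order (i : ℕ) : ℕ := if Odd i then i else i - 1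

/-- The primed matrix `A'`: the entries of row `i` are replaced by their `n_i`-th derivatives with
respect to a real `ε` at `ε = 0`, all eigenvalue parameters `ε_j` being equal to `ε`. -/
def primed (A : (Fin k → ℂ) → Matrix (Fin (2 * k)) (Fin (2 * k)) ℂ) :
    Matrix (Fin (2 * k)) (Fin (2 * k)) ℂ :=
  Matrix.of fun i j =>
    iteratedDeriv (order ((i : ℕ) + 1)) (fun ε : ℝ => A (fun _ => (ε : ℂ)) i j) 0

end Eigenfunctions

end DNLSII

end

/-! ### Coefficientwise derivation and conjugation on polynomials, and the zero-curvature identity.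
-/

section
open Polynomial

/-! The Darboux transformation is treated as an interpolation problem, and it is dressed directly at
the degenerate eigenvalue, so the solution property is never passed through a limit. In the
variables (f, λg) the Lax pair at the seed has coefficients polynomial in z = λ². The transformation
is a matrix T with rows (E, O) and (-zO*, E*), where E is monic of degree k, O has degree less than
k, and * conjugates coefficients. Both rows must annihilate the eigenfunctions to the prescribed
order. The second row encodes the partner eigenvalue -λ*. By Cramer's rule, the top coefficient of O
and the value E(0) are quotients of the determinants of M, Ŵ and W.

Confluence. At λ_0 the square root s has a simple zero, hence is odd in ε, and the amplitude A of
ψ_11 satisfies A(ε)A(-ε) = c² and A(0) = -c. Consequently every matrix entry (before conjugation)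
satisfies φ(-ε) = κ(ε)φ(ε) with the same κ = c/A tending to -1 (`DNLSII.IsBranch.eigF_neg`,
`DNLSII.IsBranch.eigG_neg`). So φ(ε) = 2ε/(1-κ) · H(ε²), where the Taylor coefficients of H are the
odd ones of φ. Newton interpolation at the nodes ε_j² factors each of the three matrices as a common
triangular matrix times a matrix of divided differences (`exists_pairMat_eq_nodeMat_mul`). The
common factor cancels in the quotients, and divided differences converge to Taylor coefficients
(`tendsto_newton`). This gives the limit and explains why only odd derivatives appear.

Nonvanishing. A kernel vector of Ŵ gives polynomials P, Q of degree less than k such that H = PP* +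
zQQ* is divisible by (z - λ_0²)^k and by its conjugate, while deg H < 2k. Hence H = 0, and
positivity on the positive real axis gives P = Q = 0 (`eq_zero_of_seriesKills`). Up to sign, det W
is the conjugate of det Ŵ.

Solution. The same uniqueness, over the ring of smooth functions on the plane, shows that T
intertwines the seed Lax pair with one of the same shape (`LaxKernel.dressed_x`,
`LaxKernel.dressed_t`). Zero curvature is inherited because det T is monic. The unimodular gauge
factor det Ŵ / det W, a constant divided by E(0), turns the dressed field into a solution of the
DNLSII equation (`LaxKernel.isSolution`, `LaxKernel.isSolution_of_taylorMat`). -/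

/-- The coefficientwise extension of a derivation to polynomials. -/
noncomputable def polyDeriv {S : Type*} [CommRing S] (d : Derivation ℤ S S) : Derivation ℤ S[X] S[X] :=
  (PolynomialModule.equivPolynomialSelf (R := S)).toLinearMap.compDer d.mapCoeffs

section
variable {S : Type*} [CommRing S] (d : Derivation ℤ S S)

theorem coeff_polyDeriv (p : S[X]) (n : ℕ) : (polyDeriv d p).coeff n = d (p.coeff n) := rfl

theorem polyDeriv_C (a : S) : polyDeriv d (C a) = C (d a) := by
  ext n
  rw [coeff_polyDeriv, coeff_C, coeff_C]
  split_ifs <;> simp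

theorem polyDeriv_X : polyDeriv d (X : S[X]) = 0 := by
  ext n
  rw [coeff_polyDeriv, coeff_X]
  split_ifs <;> simp

end

/-- With T = (A B; C D), the hypotheses say T_x = MT - TU and T_t = NT - TV. Equality of mixed
derivatives and flatness of (U, V) give R·T = 0 for the curvature R of (M, N). The first row of R·T,
multiplied by a column of the adjugate of T, isolates the (1,2) entry of R times det T. -/
theorem zero_curvature {R : Type*} [CommRing R] (dx dt : R → R)
    (xadd : ∀ a b, dx (a + b) = dx a + dx b) (xsub : ∀ a b, dx (a - b) = dx a - dx b)
    (xmul : ∀ a b, dx (a * b) = a * dx b + b * dx a)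
    (tadd : ∀ a b, dt (a + b) = dt a + dt b) (tsub : ∀ a b, dt (a - b) = dt a - dt b)
    (tmul : ∀ a b, dt (a * b) = a * dt b + b * dt a)
    (hc : ∀ a, dt (dx a) = dx (dt a))
    {A B C D U11 U12 U21 U22 V11 V12 V21 V22 M11 M12 M21 M22 N11 N12 N21 N22 : R}
    (hAx : dx A = M11 * A + M12 * C - A * U11 - B * U21)
    (hBx : dx B = M11 * B + M12 * D - A * U12 - B * U22)
    (hCx : dx C = M21 * A + M22 * C - C * U11 - D * U21)
    (hDx : dx D = M21 * B + M22 * D - C * U12 - D * U22)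
    (hAt : dt A = N11 * A + N12 * C - A * V11 - B * V21)
    (hBt : dt B = N11 * B + N12 * D - A * V12 - B * V22)
    (hCt : dt C = N21 * A + N22 * C - C * V11 - D * V21)
    (hDt : dt D = N21 * B + N22 * D - C * V12 - D * V22)
    (h11 : dt U11 - dx V11 + (U11 * V11 + U12 * V21) - (V11 * U11 + V12 * U21) = 0)
    (h12 : dt U12 - dx V12 + (U11 * V12 + U12 * V22) - (V11 * U12 + V12 * U22) = 0)
    (h21 : dt U21 - dx V21 + (U21 * V11 + U22 * V21) - (V21 * U11 + V22 * U21) = 0)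
    (h22 : dt U22 - dx V22 + (U21 * V12 + U22 * V22) - (V21 * U12 + V22 * U22) = 0) :
    (dt M12 - dx N12 + (M11 * N12 + M12 * N22) - (N11 * M12 + N12 * M22)) * (A * D - B * C) = 0 := by
  have eA := hc A
  have eB := hc B
  rw [hAx, hAt] at eA
  rw [hBx, hBt] at eB
  simp only [xadd, xsub, xmul, tadd, tsub, tmul, hAx, hBx, hCx, hDx, hAt, hBt, hCt,
    hDt] at eA eB
  linear_combination A * eB - B * eA + (A * B) * h22 + (A * A) * h12 - (B * A) * h11 - (B * B) * h21

section
variable {S : Type*} [CommRing S] [StarRing S]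

/-- Conjugation of the coefficients of a polynomial. -/
noncomputable def polyStar : S[X] →+* S[X] := mapRingHom (starRingEnd S)

theorem coeff_polyStar (p : S[X]) (n : ℕ) : (polyStar p).coeff n = star (p.coeff n) := by
  simp [polyStar, starRingEnd_apply]

theorem polyStar_C (a : S) : polyStar (C a) = C (star a) := by simp [polyStar, starRingEnd_apply]

theorem polyStar_X : polyStar (X : S[X]) = X := by simp [polyStar]

theorem polyStar_polyStar (p : S[X]) : polyStar (polyStar p) = p := by
  ext; simp [coeff_polyStar]

theorem polyStar_polyDeriv (d : Derivation ℤ S S) (hd : ∀ a, d (star a) = star (d a)) (p : S[X]) :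
    polyStar (polyDeriv d p) = polyDeriv d (polyStar p) := by
  ext; simp [coeff_polyStar, coeff_polyDeriv, hd]

end

end

/-! ### The abstract Darboux dressing. -/

section
open Polynomial

set_option linter.unusedSimpArgs false

/-- An abstract kernel condition on pairs of polynomials in `z = λ ^ 2`, compatible with the Lax
pair of the DNLSII equation at the periodic seed `q` with wave number `a` and amplitude `2 h`. -/
structure LaxKernel {S : Type*} [CommRing S] [StarRing S] (dx dt : Derivation ℤ S S)
    (J a h q : S) (k : ℕ) (Kills : S[X] → S[X] → Prop) : Prop where
  J_sq : J * J = -1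
  star_J : star J = -J
  dx_J : dx J = 0
  dt_J : dt J = 0
  star_a : star a = a
  dx_a : dx a = 0
  dt_a : dt a = 0
  star_h : star h = h
  dx_h : dx h = 0
  dt_h : dt h = 0
  q_star : q * star q = 4 * h ^ 2
  dx_q : dx q = J * a * q
  dt_q : dt q = -(J * (a ^ 2 + 4 * h ^ 2 * a)) * q
  comm : ∀ f, dt (dx f) = dx (dt f)
  dx_star : ∀ f, dx (star f) = star (dx f)
  dt_star : ∀ f, dt (star f) = star (dt f)
  add : ∀ P Q P' Q', Kills P Q → Kills P' Q' → Kills (P + P') (Q + Q')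
  mul : ∀ R P Q, Kills P Q → Kills (R * P) (R * Q)
  -- The row (P, Q) is paired with the column ψ = (f, λg), where ψ_x = Uψ. Differentiating (P, Q)ψ
  -- produces the row (P, Q)_x + (P, Q)U. `lax_t` is the same for ψ_t = Vψ.
  lax_x : ∀ P Q, Kills P Q →
    Kills (polyDeriv dx P + P * (-C J * X + C (J * h ^ 2)) + Q * (-(X * C (star q))))
      (polyDeriv dx Q + P * C q + Q * (C J * X - C (J * h ^ 2)))
  lax_t : ∀ P Q, Kills P Q →
    Kills (polyDeriv dt P
        + P * (-C (2 * J) * X ^ 2 + C (4 * J * h ^ 2) * X - C (J * (2 * h ^ 4 + 2 * a * h ^ 2)))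
        + Q * (-(X * (2 * X - C (a + 2 * h ^ 2)) * C (star q))))
      (polyDeriv dt Q + P * ((2 * X - C (a + 2 * h ^ 2)) * C q)
        + Q * (C (2 * J) * X ^ 2 - C (4 * J * h ^ 2) * X + C (J * (2 * h ^ 4 + 2 * a * h ^ 2))))
  -- The second condition is annihilation of (g*, f*) at -λ*, conjugated and multiplied by λ.
  uniq : ∀ P Q, (∀ m, k ≤ m → P.coeff m = 0) → (∀ m, k ≤ m → Q.coeff m = 0) → Kills P Q →
    Kills (-(X * polyStar Q)) (polyStar P) → P = 0 ∧ Q = 0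

namespace LaxKernel

variable {S : Type*} [CommRing S] [StarRing S] {dx dt : Derivation ℤ S S}
  {J a h q : S} {k : ℕ} {Kills : S[X] → S[X] → Prop}

theorem sub_kills (L : LaxKernel dx dt J a h q k Kills) {P Q P' Q' : S[X]} (h1 : Kills P Q)
    (h2 : Kills P' Q') : Kills (P - P') (Q - Q') := by
  have := L.add _ _ _ _ h1 (L.mul (-1) _ _ h2)
  simpa [sub_eq_add_neg] using this

theorem sub_comb (L : LaxKernel dx dt J a h q k Kills) {P Q P1 Q1 P2 Q2 : S[X]} (h0 : Kills P Q)
    (h1 : Kills P1 Q1) (h2 : Kills P2 Q2) (R1 R2 : S[X]) :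
    Kills (P - (R1 * P1 + R2 * P2)) (Q - (R1 * Q1 + R2 * Q2)) :=
  L.sub_kills h0 (L.add _ _ _ _ (L.mul R1 _ _ h1) (L.mul R2 _ _ h2))

/-- The dressed spatial equation. -/
theorem dressed_x (L : LaxKernel dx dt J a h q (k + 1) Kills) {E O : S[X]}
    (hE : E.coeff (k + 1) = 1) (hE' : ∀ m, k + 1 < m → E.coeff m = 0)
    (hO : ∀ m, k + 1 ≤ m → O.coeff m = 0) (h1 : Kills E O)
    (h2 : Kills (-(X * polyStar O)) (polyStar E)) {b u α : S} (hb : O.coeff k = b)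
    (hu : u = q + 2 * J * b) (hα : α = J * h ^ 2 - b * star q + u * star b) :
    polyDeriv dx E + E * (-C J * X + C (J * h ^ 2)) + O * (-(X * C (star q)))
      = (-C J * X + C α) * E + C u * (-(X * polyStar O)) ∧
    polyDeriv dx O + E * C q + O * (C J * X - C (J * h ^ 2))
      = (-C J * X + C α) * O + C u * polyStar E := by
  have hαs : star α = -α := by
    have hqq := L.q_star
    rw [hα, hu]
    simp only [star_add, star_sub, star_mul', star_pow, star_star, L.star_J, L.star_h, star_ofNat]
    linear_combination 0 * hqq
  -- The argument is the residual of the first row of T_x + TU = U'T. The values of `u` and `α` are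
  -- those that cancel its coefficients of degree at least k + 1, so uniqueness forces the residual
  -- to vanish.
  have key := L.uniq _ _ ?_ ?_ (L.sub_comb (L.lax_x _ _ h1) h1 h2 (-C J * X + C α) (C u)) ?_
  · exact ⟨sub_eq_zero.mp key.1, sub_eq_zero.mp key.2⟩
  · intro m hm
    obtain ⟨m, rfl⟩ : ∃ m', m = m' + 1 := ⟨m - 1, by omega⟩
    have e : polyDeriv dx E + E * (-C J * X + C (J * h ^ 2)) + O * (-(X * C (star q)))
        - ((-C J * X + C α) * E + C u * (-(X * polyStar O)))
        = polyDeriv dx E + C (J * h ^ 2 - α) * E - X * (C (star q) * O)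
          + X * (C u * polyStar O) := by
      rw [C_sub]; ring
    rw [e]
    simp only [coeff_add, coeff_sub, coeff_X_mul, coeff_C_mul, coeff_polyStar, coeff_polyDeriv]
    rcases (Nat.le_of_succ_le_succ hm).eq_or_lt with rfl | hlt
    · rw [hE, hb, hα]
      simp only [Derivation.map_one_eq_zero]
      ring
    · rw [hE' _ (by omega), hO _ (by omega)]
      simp
  · intro m hm
    have e : polyDeriv dx O + E * C q + O * (C J * X - C (J * h ^ 2))
        - ((-C J * X + C α) * O + C u * polyStar E)
        = polyDeriv dx O + C q * E + X * (C (2 * J) * O) - C (J * h ^ 2 + α) * O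
          - C u * polyStar E := by
      simp only [C_add, C_mul, C_ofNat]; ring
    rw [e]
    obtain ⟨m, rfl⟩ : ∃ m', m = m' + 1 := ⟨m - 1, by omega⟩
    simp only [coeff_add, coeff_sub, coeff_X_mul, coeff_C_mul, coeff_polyStar, coeff_polyDeriv]
    rcases (Nat.le_of_succ_le_succ hm).eq_or_lt with rfl | hlt
    · rw [hE, hb, hO _ le_rfl, hu]
      simp
    · rw [hE' _ (by omega), hO _ (by omega), hO m (by omega)]
      simp
  -- The conjugate partner of the residual is the residual of the second row of T; here `star α =
  -- -α` enters.
  · have := L.sub_comb (L.lax_x _ _ h2) h1 h2 (-C (star u) * X) (C J * X - C α)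
    convert this using 1
    · simp only [map_sub, map_add, map_mul, map_neg, polyStar_X, polyStar_C, polyStar_polyStar,
        polyStar_polyDeriv dx L.dx_star, Derivation.leibniz, polyDeriv_X, L.star_J, hαs, star_neg,
        star_star, star_mul', star_pow, L.star_h, smul_eq_mul, C_neg]
      ring
    · simp only [map_sub, map_add, map_mul, map_neg, polyStar_X, polyStar_C, polyStar_polyStar,
        polyStar_polyDeriv dx L.dx_star, Derivation.leibniz, polyDeriv_X, L.star_J, hαs, star_neg,
        star_star, star_mul', star_pow, L.star_h, smul_eq_mul, C_neg]
      ring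

/-- The dressed temporal equation. -/
theorem dressed_t (L : LaxKernel dx dt J a h q (k + 1) Kills) {E O : S[X]}
    (hE : E.coeff (k + 1) = 1) (hE' : ∀ m, k + 1 < m → E.coeff m = 0)
    (hO : ∀ m, k + 1 ≤ m → O.coeff m = 0) (h1 : Kills E O)
    (h2 : Kills (-(X * polyStar O)) (polyStar E)) {b u α β δ : S} (hb : O.coeff k = b)
    (hu : u = q + 2 * J * b) (hα : α = J * h ^ 2 - b * star q + u * star b)
    (hβ : β = -2 * dx b - (a + 2 * h ^ 2) * q - 4 * J * h ^ 2 * b)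
    (hδ : δ = -(J * (2 * h ^ 4 + 2 * a * h ^ 2))
      + J * (-(star q * dx b) - u * dx (star b) + (J * h ^ 2 + α) * (star q * b - u * star b))
      + (a + 2 * h ^ 2) * b * star q + β * star b) :
    star δ = -δ ∧
    polyDeriv dt E
        + E * (-C (2 * J) * X ^ 2 + C (4 * J * h ^ 2) * X - C (J * (2 * h ^ 4 + 2 * a * h ^ 2)))
        + O * (-(X * (2 * X - C (a + 2 * h ^ 2)) * C (star q)))
      = (-C (2 * J) * X ^ 2 + C (2 * α + 2 * J * h ^ 2) * X + C δ) * E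
        + (2 * C u * X + C β) * (-(X * polyStar O)) ∧
    polyDeriv dt O + E * ((2 * X - C (a + 2 * h ^ 2)) * C q)
        + O * (C (2 * J) * X ^ 2 - C (4 * J * h ^ 2) * X + C (J * (2 * h ^ 4 + 2 * a * h ^ 2)))
      = (-C (2 * J) * X ^ 2 + C (2 * α + 2 * J * h ^ 2) * X + C δ) * O
        + (2 * C u * X + C β) * polyStar E := by
  have hJ := L.J_sq
  have hqq := L.q_star
  have hαs : star α = -α := by
    rw [hα, hu]
    simp only [star_add, star_sub, star_mul', star_pow, star_star, L.star_J, L.star_h, star_ofNat]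
    ring
  have hus : star u = star q - 2 * J * star b := by
    rw [hu]
    simp only [star_add, star_mul', L.star_J, star_ofNat]
    ring
  have hβs : star β = -2 * dx (star b) - (a + 2 * h ^ 2) * star q + 4 * J * h ^ 2 * star b := by
    rw [hβ]
    simp only [star_sub, star_add, star_mul', star_neg, star_pow, L.star_J, L.star_h, L.star_a,
      L.dx_star, star_ofNat]
    ring
  have hδs : star δ = -δ := by
    rw [hδ]
    simp only [star_sub, star_add, star_mul', star_neg, star_pow, L.star_J, L.star_h, L.star_a,
      ← L.dx_star, star_ofNat, star_star, hαs, hus, hβs]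
    rw [hα, hβ, hu]
    grind
  refine ⟨hδs, ?_⟩
  obtain ⟨x1, x2⟩ := L.dressed_x hE hE' hO h1 h2 hb hu hα
  -- The temporal residual involves the subleading coefficients of E and O, about which the spatial
  -- equation at degree k gives information. Writing `(X * O).coeff k` for the coefficient of O at k
  -- - 1 gives the right value 0 when k = 0.
  have y1 : dx (E.coeff k) + (J * h ^ 2 - α) * E.coeff k - star q * (X * O).coeff k
      + u * star ((X * O).coeff k) = 0 := by
    have e : polyDeriv dx E + C (J * h ^ 2 - α) * E - C (star q) * (X * O)
          + C u * (X * polyStar O) = 0 := by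
      simp only [C_sub, C_mul] at x1 ⊢
      linear_combination x1
    have e' : X * polyStar O = polyStar (X * O) := by rw [map_mul, polyStar_X]
    rw [e'] at e
    have := congrArg (coeff · k) e
    simpa only [coeff_add, coeff_sub, coeff_C_mul, coeff_polyStar, coeff_polyDeriv, coeff_zero, hb]
      using this
  have y2 : dx b + q * E.coeff k + 2 * J * (X * O).coeff k - (J * h ^ 2 + α) * b
      - u * star (E.coeff k) = 0 := by
    have e : polyDeriv dx O + C q * E + C (2 * J) * (X * O) - C (J * h ^ 2 + α) * O
          - C u * polyStar E = 0 := by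
      simp only [C_add, C_mul, C_ofNat] at x2 ⊢
      linear_combination x2
    have := congrArg (coeff · k) e
    simpa only [coeff_add, coeff_sub, coeff_C_mul, coeff_polyStar, coeff_polyDeriv, coeff_zero, hb]
      using this
  have y2s : dx (star b) + star q * star (E.coeff k) - 2 * J * star ((X * O).coeff k)
      - (- (J * h ^ 2) - α) * star b - star u * E.coeff k = 0 := by
    have := congrArg star y2
    simp only [star_sub, star_add, star_mul', star_neg, star_pow, L.star_J, L.star_h, L.star_a,
      ← L.dx_star, star_ofNat, star_star, hαs, star_zero] at this
    linear_combination this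
  have key := L.uniq _ _ ?_ ?_ (L.sub_comb (L.lax_t _ _ h1) h1 h2
    (-C (2 * J) * X ^ 2 + C (2 * α + 2 * J * h ^ 2) * X + C δ) (2 * C u * X + C β)) ?_
  · exact ⟨sub_eq_zero.mp key.1, sub_eq_zero.mp key.2⟩
  · intro m hm
    obtain ⟨m, rfl⟩ : ∃ m', m = m' + 1 := ⟨m - 1, by omega⟩
    have e : polyDeriv dt E
        + E * (-C (2 * J) * X ^ 2 + C (4 * J * h ^ 2) * X - C (J * (2 * h ^ 4 + 2 * a * h ^ 2)))
        + O * (-(X * (2 * X - C (a + 2 * h ^ 2)) * C (star q)))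
        - ((-C (2 * J) * X ^ 2 + C (2 * α + 2 * J * h ^ 2) * X + C δ) * E
        + (2 * C u * X + C β) * (-(X * polyStar O)))
        = polyDeriv dt E + X * (C (2 * J * h ^ 2 - 2 * α) * E)
          - C (J * (2 * h ^ 4 + 2 * a * h ^ 2) + δ) * E - X * (C (2 * star q) * (X * O))
          + X * (C ((a + 2 * h ^ 2) * star q) * O) + X * (C (2 * u) * polyStar (X * O))
          + X * (C β * polyStar O) := by
      simp only [C_add, C_sub, C_mul, C_ofNat, map_mul, polyStar_X]; ring
    rw [e]
    simp only [coeff_add, coeff_sub, coeff_X_mul, coeff_C_mul, coeff_polyStar, coeff_polyDeriv]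
    rcases (Nat.le_of_succ_le_succ hm).eq_or_lt with rfl | hlt
    · rw [hE, hb, Derivation.map_one_eq_zero]
      have e1 : u * star u - q * star q = -(J * (2 * α - 2 * J * h ^ 2)) := by
        rw [hus, hα, hu]
        ring
      -- The subleading coefficients are eliminated through the spatial equation and its conjugate.
      -- The formula for `δ` in the hypotheses is what remains after this elimination.
      linear_combination -hδ + J * star q * y2 + J * u * y2s + J * E.coeff k * e1
        + ((2 * J * h ^ 2 - 2 * α) * E.coeff k - 2 * star q * (X * O).coeff k
          + 2 * u * star ((X * O).coeff k)) * hJ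
    · obtain ⟨m, rfl⟩ : ∃ m', m = m' + 1 := ⟨m - 1, by omega⟩
      rw [coeff_X_mul, hE' _ (by omega), hO (m + 1) (by omega)]
      rcases (Nat.le_of_lt_succ hlt).eq_or_lt with rfl | hlt
      · rw [hE, hb, hα, hu]
        simp only [map_zero, star_zero]
        ring
      · rw [hE' _ (by omega), hO _ (by omega)]
        simp
  · intro m hm
    obtain ⟨m, rfl⟩ : ∃ m', m = m' + 1 := ⟨m - 1, by omega⟩
    have e : polyDeriv dt O + E * ((2 * X - C (a + 2 * h ^ 2)) * C q)
        + O * (C (2 * J) * X ^ 2 - C (4 * J * h ^ 2) * X + C (J * (2 * h ^ 4 + 2 * a * h ^ 2)))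
        - ((-C (2 * J) * X ^ 2 + C (2 * α + 2 * J * h ^ 2) * X + C δ) * O
        + (2 * C u * X + C β) * polyStar E)
        = polyDeriv dt O + X * (C (2 * q) * E) - C ((a + 2 * h ^ 2) * q) * E
          + X * (C (4 * J) * (X * O)) - X * (C (6 * J * h ^ 2 + 2 * α) * O)
          + C (J * (2 * h ^ 4 + 2 * a * h ^ 2) - δ) * O - X * (C (2 * u) * polyStar E)
          - C β * polyStar E := by
      simp only [C_add, C_sub, C_mul, C_ofNat, map_mul, polyStar_X]; ring
    rw [e]
    simp only [coeff_add, coeff_sub, coeff_X_mul, coeff_C_mul, coeff_polyStar, coeff_polyDeriv]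
    rcases (Nat.le_of_succ_le_succ hm).eq_or_lt with rfl | hlt
    · rw [hE, hb, hO _ le_rfl]
      simp only [map_zero, star_one]
      linear_combination 2 * y2 - hβ
    · obtain ⟨m, rfl⟩ : ∃ m', m = m' + 1 := ⟨m - 1, by omega⟩
      rw [coeff_X_mul, hE' (m + 1 + 1) (by omega), hO (m + 1) (by omega), hO (m + 1 + 1) (by omega)]
      rcases (Nat.le_of_lt_succ hlt).eq_or_lt with rfl | hlt
      · rw [hE, hb, hu]
        simp only [map_zero, star_zero, star_one]
        ring
      · rw [hE' _ (by omega), hO _ (by omega)]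
        simp
  · have := L.sub_comb (L.lax_t _ _ h2) h1 h2 (-(X * (2 * C (star u) * X + C (star β))))
      (C (2 * J) * X ^ 2 - C (2 * α + 2 * J * h ^ 2) * X - C δ)
    convert this using 1
    · simp only [map_sub, map_add, map_mul, map_neg, map_pow, map_ofNat, polyStar_X, polyStar_C, polyStar_polyStar,
        polyStar_polyDeriv dt L.dt_star, Derivation.leibniz, polyDeriv_X, L.star_J, hαs, hδs, star_neg,
        star_star, star_mul', star_pow, star_add, star_ofNat, L.star_h, L.star_a, smul_eq_mul, C_neg, C_mul, C_add]
      ring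
    · simp only [map_sub, map_add, map_mul, map_neg, map_pow, map_ofNat, polyStar_X, polyStar_C, polyStar_polyStar,
        polyStar_polyDeriv dt L.dt_star, Derivation.leibniz, polyDeriv_X, L.star_J, hαs, hδs, star_neg,
        star_star, star_mul', star_pow, star_add, star_ofNat, L.star_h, L.star_a, smul_eq_mul, C_neg, C_mul, C_add]
      ring

/-- The Darboux transformation produces a solution of the DNLSII equation. -/
theorem isSolution (L : LaxKernel dx dt J a h q (k + 1) Kills) {E O : S[X]}
    (hE : E.coeff (k + 1) = 1) (hE' : ∀ m, k + 1 < m → E.coeff m = 0)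
    (hO : ∀ m, k + 1 ≤ m → O.coeff m = 0) (h1 : Kills E O)
    (h2 : Kills (-(X * polyStar O)) (polyStar E)) {w κ : S} (hw : E.coeff 0 * w = κ)
    (hκ : IsUnit κ) (hκx : dx κ = 0) (hκt : dt κ = 0) (hws : w * star w = 1) {Q : S}
    (hQ : Q = w * (q + 2 * J * O.coeff k)) :
    J * dt Q + dx (dx Q) + J * (Q * star Q) * dx Q = 0 := by
  obtain ⟨b, hb⟩ : ∃ b, O.coeff k = b := ⟨_, rfl⟩
  obtain ⟨u, hu⟩ : ∃ u, u = q + 2 * J * b := ⟨_, rfl⟩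
  obtain ⟨α, hα⟩ : ∃ α, α = J * h ^ 2 - b * star q + u * star b := ⟨_, rfl⟩
  obtain ⟨β, hβ⟩ : ∃ β, β = -2 * dx b - (a + 2 * h ^ 2) * q - 4 * J * h ^ 2 * b := ⟨_, rfl⟩
  obtain ⟨δ, hδ⟩ : ∃ δ, δ = -(J * (2 * h ^ 4 + 2 * a * h ^ 2))
      + J * (-(star q * dx b) - u * dx (star b) + (J * h ^ 2 + α) * (star q * b - u * star b))
      + (a + 2 * h ^ 2) * b * star q + β * star b := ⟨_, rfl⟩
  obtain ⟨x1, x2⟩ := L.dressed_x hE hE' hO h1 h2 hb hu hα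
  obtain ⟨hδs, t1, t2⟩ := L.dressed_t hE hE' hO h1 h2 hb hu hα hβ hδ
  have hJ := L.J_sq
  have hqq := L.q_star
  have hαs : star α = -α := by
    rw [hα, hu]
    simp only [star_add, star_sub, star_mul', star_pow, star_star, L.star_J, L.star_h, star_ofNat]
    ring
  have d2x : dx (2 : S) = 0 := by simpa using Derivation.map_natCast dx 2
  have d2t : dt (2 : S) = 0 := by simpa using Derivation.map_natCast dt 2
  have d4x : dx (4 : S) = 0 := by simpa using Derivation.map_natCast dx 4
  have d4t : dt (4 : S) = 0 := by simpa using Derivation.map_natCast dt 4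
  have x1s := congrArg polyStar x1
  have x2s := congrArg polyStar x2
  have t1s := congrArg polyStar t1
  have t2s := congrArg polyStar t2
  simp only [map_sub, map_add, map_mul, map_neg, map_pow, map_ofNat, polyStar_X, polyStar_C,
    polyStar_polyStar, polyStar_polyDeriv dx L.dx_star, polyStar_polyDeriv dt L.dt_star, L.star_J,
    hαs, hδs, star_neg, star_star, star_mul', star_pow, star_add, star_ofNat, L.star_h, L.star_a,
    C_neg, C_mul, C_add] at x1s x2s t1s t2s
  -- This is the (1,2) entry of the dressed zero-curvature equation at z = 0.
  have zc : dt u - dx β + 2 * α * β - 2 * δ * u = 0 := by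
    have d2X : polyDeriv dx (2 : S[X]) = 0 := by
      simpa using Derivation.map_natCast (polyDeriv dx) 2
    have d4X : polyDeriv dx (4 : S[X]) = 0 := by
      simpa using Derivation.map_natCast (polyDeriv dx) 4
    have d2T : polyDeriv dt (2 : S[X]) = 0 := by
      simpa using Derivation.map_natCast (polyDeriv dt) 2
    have := zero_curvature (polyDeriv dx) (polyDeriv dt) (map_add _) (map_sub _)
      (Derivation.leibniz _) (map_add _) (map_sub _) (Derivation.leibniz _)
      (by intro p; ext n; simp only [coeff_polyDeriv, L.comm])
      (A := E) (B := O) (C := -(X * polyStar O)) (D := polyStar E)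
      (U11 := -C J * X + C (J * h ^ 2)) (U12 := C q) (U21 := -(X * C (star q)))
      (U22 := C J * X - C (J * h ^ 2))
      (V11 := -C (2 * J) * X ^ 2 + C (4 * J * h ^ 2) * X - C (J * (2 * h ^ 4 + 2 * a * h ^ 2)))
      (V12 := (2 * X - C (a + 2 * h ^ 2)) * C q)
      (V21 := -(X * (2 * X - C (a + 2 * h ^ 2)) * C (star q)))
      (V22 := C (2 * J) * X ^ 2 - C (4 * J * h ^ 2) * X + C (J * (2 * h ^ 4 + 2 * a * h ^ 2)))
      (M11 := -C J * X + C α) (M12 := C u) (M21 := -(X * C (star u))) (M22 := C J * X - C α)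
      (N11 := -C (2 * J) * X ^ 2 + C (2 * α + 2 * J * h ^ 2) * X + C δ)
      (N12 := 2 * C u * X + C β) (N21 := -(X * (2 * C (star u) * X + C (star β))))
      (N22 := C (2 * J) * X ^ 2 - C (2 * α + 2 * J * h ^ 2) * X - C δ)
      ?_ ?_ ?_ ?_ ?_ ?_ ?_ ?_ ?_ ?_ ?_ ?_
    -- The coefficient ring may have zero divisors, so det T = EE* + zOO* is cancelled because it is
    -- monic: EE* has degree 2k + 2 and the other term at most 2k + 1.
    · have hreg : IsLeftRegular (E * polyStar E - O * -(X * polyStar O)) := by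
        rcases subsingleton_or_nontrivial S with hS | hS
        · exact fun _ _ _ => Subsingleton.elim _ _
        have hEd : E.natDegree ≤ k + 1 := natDegree_le_iff_coeff_eq_zero.mpr hE'
        have hEm : E.Monic := monic_of_natDegree_le_of_coeff_eq_one _ hEd hE
        have hOd : O.natDegree ≤ k :=
          natDegree_le_iff_coeff_eq_zero.mpr fun m hm => hO m (by omega)
        have hEs : (polyStar E).Monic := hEm.map _
        have hEn : E.natDegree = k + 1 :=
          le_antisymm hEd (le_natDegree_of_ne_zero (by rw [hE]; exact one_ne_zero))
        have hEEn : (E * polyStar E).natDegree = 2 * k + 2 := by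
          rw [hEm.natDegree_mul hEs, polyStar, coe_mapRingHom, hEm.natDegree_map, hEn]
          ring
        have hOs : (polyStar O).natDegree ≤ k := natDegree_map_le.trans hOd
        have : (E * polyStar E - O * -(X * polyStar O)).Monic := by
          refine (hEm.mul hEs).sub_of_left (degree_lt_degree ?_)
          rw [hEEn, mul_neg, natDegree_neg]
          refine natDegree_mul_le.trans_lt ?_
          have h1 := natDegree_mul_le (p := X) (q := polyStar O)
          have h2 := natDegree_X_le (R := S)
          omega
        exact this.isRegular.left
      have h0 : polyDeriv dt (C u) - polyDeriv dx (2 * C u * X + C β)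
          + ((-C J * X + C α) * (2 * C u * X + C β)
            + C u * (C (2 * J) * X ^ 2 - C (2 * α + 2 * J * h ^ 2) * X - C δ))
          - ((-C (2 * J) * X ^ 2 + C (2 * α + 2 * J * h ^ 2) * X + C δ) * C u
            + (2 * C u * X + C β) * (C J * X - C α)) = 0 :=
        hreg (by simp only [mul_zero]; rw [mul_comm]; exact this)
      have h1 := congrArg (eval 0) h0
      simp only [map_add, Derivation.leibniz, polyDeriv_C, polyDeriv_X, d2X, smul_eq_mul, eval_add,
        eval_sub, eval_mul, eval_neg, eval_C, eval_X, eval_pow, eval_zero, eval_ofNat] at h1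
      linear_combination h1
    · linear_combination x1
    · linear_combination x2
    · simp only [map_neg, Derivation.leibniz, polyDeriv_X, smul_eq_mul, C_mul, C_pow]
      linear_combination (-X) * x2s
    · simp only [map_neg, Derivation.leibniz, polyDeriv_X, smul_eq_mul, C_mul, C_pow]
      linear_combination x1s
    · linear_combination t1
    · linear_combination t2
    · simp only [map_neg, Derivation.leibniz, polyDeriv_X, smul_eq_mul, C_mul, C_pow, C_add, C_ofNat]
      linear_combination (-X) * t2s
    · simp only [map_neg, Derivation.leibniz, polyDeriv_X, smul_eq_mul, C_mul, C_pow, C_add, C_ofNat]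
      linear_combination t1s
    all_goals
      simp only [map_add, map_sub, map_neg, Derivation.leibniz, Derivation.leibniz_pow, polyDeriv_C,
        polyDeriv_X, d2X, d4X, d2T, d2x, d2t, d4x, d4t, L.dx_J, L.dt_J, L.dx_a, L.dt_a, L.dx_h, L.dt_h,
        L.dx_q, L.dt_q, L.dx_star, L.dt_star, star_mul', star_neg, star_add, star_pow, star_ofNat,
        L.star_J, L.star_a, L.star_h, smul_eq_mul, C_mul, C_add, C_sub, C_neg, C_ofNat, C_pow,
        smul_zero, mul_zero, zero_mul, add_zero, zero_add, sub_zero, C_0, neg_zero]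
    all_goals ring
  have he : IsUnit (E.coeff 0) := isUnit_of_mul_isUnit_left (hw ▸ hκ)
  -- At z = 0 the terms containing O drop out, and the first row of the dressed equation becomes a
  -- scalar equation for E(0). Since E(0)·w is constant, w satisfies the opposite one.
  have gx : dx w = -(α - J * h ^ 2) * w := by
    have h1 := congrArg (eval 0) x1
    simp only [eval_add, eval_sub, eval_mul, eval_neg, eval_C, eval_X, ← coeff_zero_eq_eval_zero,
      coeff_polyDeriv] at h1
    have h2 := congrArg dx hw
    rw [Derivation.leibniz, hκx, smul_eq_mul, smul_eq_mul] at h2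
    refine he.mul_left_cancel ?_
    linear_combination h2 - w * h1
  have gt : dt w = -(δ + J * (2 * h ^ 4 + 2 * a * h ^ 2)) * w := by
    have h1 := congrArg (eval 0) t1
    simp only [eval_add, eval_sub, eval_mul, eval_neg, eval_C, eval_X, eval_pow, eval_ofNat,
      ← coeff_zero_eq_eval_zero, coeff_polyDeriv] at h1
    have h2 := congrArg dt hw
    rw [Derivation.leibniz, hκt, smul_eq_mul, smul_eq_mul] at h2
    refine he.mul_left_cancel ?_
    linear_combination h2 - w * h1
  have hQQ : Q * star Q = u * star u := by
    rw [hQ, hb, ← hu, star_mul']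
    linear_combination (u * star u) * hws
  have hQx : dx Q = w * (dx u - (α - J * h ^ 2) * u) := by
    rw [hQ, hb, ← hu, Derivation.leibniz, smul_eq_mul, smul_eq_mul, gx]
    ring
  have hQt : dt Q = w * (dt u - (δ + J * (2 * h ^ 4 + 2 * a * h ^ 2)) * u) := by
    rw [hQ, hb, ← hu, Derivation.leibniz, smul_eq_mul, smul_eq_mul, gt]
    ring
  have hQxx : dx (dx Q) = w * (dx (dx u) - dx α * u - 2 * (α - J * h ^ 2) * dx u
      + (α - J * h ^ 2) ^ 2 * u) := by
    rw [hQx]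
    simp only [map_sub, Derivation.leibniz, Derivation.leibniz_pow, smul_eq_mul, gx, L.dx_J,
      L.dx_h, smul_zero, mul_zero, add_zero, sub_zero]
    ring
  rw [hQxx, hQQ, hQx, hQt]
  have hux : dx u = J * a * q + 2 * J * dx b := by
    rw [hu]
    simp only [map_add, Derivation.leibniz, smul_eq_mul, d2x, L.dx_J, L.dx_q]
    ring
  have huxx : dx (dx u) = J * a * (J * a * q) + 2 * J * dx (dx b) := by
    rw [hux]
    simp only [map_add, Derivation.leibniz, smul_eq_mul, d2x, L.dx_J, L.dx_q, L.dx_a]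
    ring
  have hαx : dx α = -(dx b * star q) - b * star (J * a * q) + dx u * star b + u * dx (star b) := by
    rw [hα]
    simp only [map_add, map_sub, Derivation.leibniz, Derivation.leibniz_pow, smul_eq_mul, L.dx_J,
      L.dx_star, L.dx_q, L.dx_h, smul_zero, mul_zero]
    ring
  have hβx : dx β = -2 * dx (dx b) - (a + 2 * h ^ 2) * (J * a * q) - 4 * J * h ^ 2 * dx b := by
    rw [hβ]
    simp only [map_add, map_sub, map_neg, Derivation.leibniz, Derivation.leibniz_pow, smul_eq_mul,
      L.dx_J, L.dx_a, L.dx_q, L.dx_h, d2x, d4x, smul_zero, mul_zero]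
    ring
  have hut : dt u = dx β - 2 * α * β + 2 * δ * u := by linear_combination zc
  simp only [star_mul', L.star_J, L.star_a] at hαx
  have hus : star u = star q - 2 * J * star b := by
    rw [hu]
    simp only [star_add, star_mul', L.star_J, star_ofNat]
    ring
  suffices H : J * (dt u - (δ + J * (2 * h ^ 4 + 2 * a * h ^ 2)) * u)
      + (dx (dx u) - dx α * u - 2 * (α - J * h ^ 2) * dx u + (α - J * h ^ 2) ^ 2 * u)
      + J * (u * star u) * (dx u - (α - J * h ^ 2) * u) = 0 by
    linear_combination w * H
  rw [hut, hβx, huxx, hαx, hux, hus]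
  -- With the derivatives and conjugates as independent symbols, what remains is a polynomial
  -- identity modulo J² = -1 and qq* = 4h².
  generalize dx (dx b) = bxx at *
  generalize dx (star b) = sbx at *
  generalize dx b = bx at *
  generalize star b = sb at *
  generalize star q = r at *
  clear * - hJ hqq hα hβ hδ hu
  rw [hδ, hβ, hα, hu]
  clear hδ hβ hα hu
  grind

end LaxKernel

end

/-! ### Annihilation of a truncated power series, and uniqueness over ℂ. -/

section
open Polynomial

/-- Substitution of `z = (l + μ) ^ 2` into a polynomial, as a power series in `μ`. -/
noncomputable def evSq {S : Type*} [CommRing S] (l : S) : S[X] →+* PowerSeries S :=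
  eval₂RingHom PowerSeries.C ((PowerSeries.C l + PowerSeries.X) ^ 2)

/-- The combination `P(z) F + Q(z) G` vanishes to order `k` at `μ = 0`. -/
def SeriesKills {S : Type*} [CommRing S] (l : S) (k : ℕ) (F G : PowerSeries S) (P Q : S[X]) : Prop :=
  PowerSeries.X ^ k ∣ evSq l P * F + evSq l Q * G

theorem evSq_C {S : Type*} [CommRing S] (l a : S) : evSq l (C a) = PowerSeries.C a := by simp [evSq]

theorem evSq_X {S : Type*} [CommRing S] (l : S) :
    evSq l X = (PowerSeries.C l + PowerSeries.X) ^ 2 := by simp [evSq]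

/-- Since (l + μ)² - l² = μ(2l + μ) and 2l + μ is a unit, μ is a local parameter for z at l². The
order in μ is therefore the root multiplicity of H at l². -/
theorem pow_dvd_of_X_pow_dvd_evSq {l : ℂ} (hl : l ≠ 0) {k : ℕ} {H : ℂ[X]}
    (h : PowerSeries.X ^ k ∣ evSq l H) : (X - C (l ^ 2)) ^ k ∣ H := by
  by_cases hH : H = 0
  · simp [hH]
  obtain ⟨q, hq, hq'⟩ := exists_eq_pow_rootMultiplicity_mul_and_not_dvd H hH (l ^ 2)
  set m := rootMultiplicity (l ^ 2) H
  have hu1 : IsUnit (evSq l q) := by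
    rw [PowerSeries.isUnit_iff_constantCoeff, isUnit_iff_ne_zero]
    rw [dvd_iff_isRoot, IsRoot.def] at hq'
    have : PowerSeries.constantCoeff (evSq l q) = q.eval (l ^ 2) := by
      simp only [evSq, coe_eval₂RingHom, hom_eval₂]
      simp [eval₂_eq_eval_map]
    rwa [this]
  have hlin : evSq l (X - C (l ^ 2))
      = PowerSeries.X * (PowerSeries.C (2 * l) + PowerSeries.X) := by
    rw [map_sub, evSq_X, evSq_C]
    simp only [map_pow, map_mul, map_ofNat]
    ring
  have hu2 : IsUnit (PowerSeries.C (2 * l) + PowerSeries.X) := by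
    rw [PowerSeries.isUnit_iff_constantCoeff, isUnit_iff_ne_zero]
    simpa using hl
  rw [hq, map_mul, map_pow, hlin, mul_pow, mul_assoc,
    ((hu2.pow m).mul hu1).dvd_mul_right] at h
  have hkm : k ≤ m := (pow_dvd_pow_iff PowerSeries.X_ne_zero PowerSeries.X_prime.not_isUnit).mp h
  rw [hq]
  exact (pow_dvd_pow _ hkm).mul_right _

/-- The two conditions form a linear system for (F, G) with determinant H = PP* + zQQ*. As F or G is
a unit, H vanishes to order k at l². It equals its own conjugate, and l² is not real, so it also
vanishes to order k at the conjugate point. This is 2k roots against degree at most 2k - 1, so H =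
0. At real x > 0 this reads |P|² + x|Q|² = 0. -/
theorem eq_zero_of_seriesKills {l : ℂ} (hre : l.re ≠ 0) (him : l.im ≠ 0) {k : ℕ}
    {F G : PowerSeries ℂ}
    (hFG : PowerSeries.constantCoeff F ≠ 0 ∨ PowerSeries.constantCoeff G ≠ 0) {P Q : ℂ[X]}
    (hP : ∀ m, k ≤ m → P.coeff m = 0) (hQ : ∀ m, k ≤ m → Q.coeff m = 0)
    (h1 : SeriesKills l k F G P Q) (h2 : SeriesKills l k F G (-(X * polyStar Q)) (polyStar P)) :
    P = 0 ∧ Q = 0 := by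
  have hl : l ≠ 0 := by rintro rfl; simp at hre
  set H : ℂ[X] := P * polyStar P + X * Q * polyStar Q with hHdef
  have hHF : PowerSeries.X ^ k ∣ evSq l H * F := by
    have := (h1.mul_left (evSq l (polyStar P))).sub (h2.mul_left (evSq l Q))
    convert this using 1
    simp only [hHdef, map_add, map_mul, map_neg]
    ring
  have hHG : PowerSeries.X ^ k ∣ evSq l H * G := by
    have := (h1.mul_left (evSq l (X * polyStar Q))).add (h2.mul_left (evSq l P))
    convert this using 1
    simp only [hHdef, map_add, map_mul, map_neg]
    ring
  have hH : PowerSeries.X ^ k ∣ evSq l H := by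
    rcases hFG with h | h
    · have hu : IsUnit F := by
        rwa [PowerSeries.isUnit_iff_constantCoeff, isUnit_iff_ne_zero]
      rwa [hu.dvd_mul_right] at hHF
    · have hu : IsUnit G := by
        rwa [PowerSeries.isUnit_iff_constantCoeff, isUnit_iff_ne_zero]
      rwa [hu.dvd_mul_right] at hHG
  have hd1 := pow_dvd_of_X_pow_dvd_evSq hl hH
  have hHs : polyStar H = H := by
    simp only [hHdef, map_add, map_mul, polyStar_polyStar, polyStar_X]
    ring
  have hd2 : (X - C (star (l ^ 2))) ^ k ∣ H := by
    have := map_dvd polyStar hd1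
    rwa [hHs, map_pow, map_sub, polyStar_X, polyStar_C] at this
  have hne : l ^ 2 ≠ star (l ^ 2) := by
    intro h
    have h3 : (l ^ 2).im = 0 := Complex.conj_eq_iff_im.mp h.symm
    rw [pow_two, Complex.mul_im] at h3
    have : l.re * l.im = 0 := by linarith
    exact (mul_ne_zero hre him) this
  have hcop : IsCoprime ((X - C (l ^ 2)) ^ k) ((X - C (star (l ^ 2))) ^ k) :=
    ((isCoprime_X_sub_C_of_isUnit_sub (sub_ne_zero.mpr hne).isUnit)).pow
  have hd := hcop.mul_dvd hd1 hd2
  have hH0 : H = 0 := by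
    by_contra hne0
    have hdeg := natDegree_le_of_dvd hd hne0
    rw [Monic.natDegree_mul ((monic_X_sub_C _).pow _) ((monic_X_sub_C _).pow _),
      natDegree_pow, natDegree_pow, natDegree_X_sub_C, natDegree_X_sub_C] at hdeg
    have hPs : ∀ m, k ≤ m → (polyStar P).coeff m = 0 := fun m hm => by
      rw [coeff_polyStar, hP m hm, star_zero]
    have hQs : ∀ m, k ≤ m → (polyStar Q).coeff m = 0 := fun m hm => by
      rw [coeff_polyStar, hQ m hm, star_zero]
    rcases Nat.eq_zero_or_pos k with rfl | hk
    · exact hne0 (by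
        have : P = 0 := by ext m; simpa using hP m (Nat.zero_le _)
        have : Q = 0 := by ext m; simpa using hQ m (Nat.zero_le _)
        simp [*])
    · have nd : ∀ R : ℂ[X], (∀ m, k ≤ m → R.coeff m = 0) → R.natDegree ≤ k - 1 := fun R hR =>
        natDegree_le_iff_coeff_eq_zero.mpr fun m hm => hR m (by omega)
      have e1 : (P * polyStar P).natDegree ≤ 2 * k - 1 := by
        have := natDegree_mul_le (p := P) (q := polyStar P)
        have := nd P hP
        have := nd _ hPs
        omega
      have e2 : (X * Q * polyStar Q).natDegree ≤ 2 * k - 1 := by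
        have := natDegree_mul_le (p := X * Q) (q := polyStar Q)
        have := natDegree_mul_le (p := X) (q := Q)
        have := natDegree_X_le (R := ℂ)
        have := nd Q hQ
        have := nd _ hQs
        omega
      have := natDegree_add_le_of_degree_le e1 e2
      rw [← hHdef] at this
      omega
  have heval : ∀ (R : ℂ[X]) (x : ℝ), (polyStar R).eval (x : ℂ) = star (R.eval (x : ℂ)) := by
    intro R x
    have := hom_eval₂ R (RingHom.id ℂ) (starRingEnd ℂ) (x : ℂ)
    rw [polyStar, coe_mapRingHom, eval_map]
    simpa [eval₂_id, eval₂_eq_eval_map] using this.symm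
  have hzero : ∀ x : ℝ, 0 < x → P.eval (x : ℂ) = 0 ∧ Q.eval (x : ℂ) = 0 := by
    intro x hx
    have h0 : H.eval (x : ℂ) = 0 := by rw [hH0, eval_zero]
    rw [hHdef] at h0
    simp only [eval_add, eval_mul, eval_X, heval, mul_assoc] at h0
    have h1 : ((Complex.normSq (P.eval (x : ℂ)) + x * Complex.normSq (Q.eval (x : ℂ)) : ℝ) : ℂ) = 0 := by
      push_cast
      rw [← Complex.mul_conj, ← Complex.mul_conj]
      exact h0
    have h2 := Complex.ofReal_eq_zero.mp h1
    have h3 := Complex.normSq_nonneg (P.eval (x : ℂ))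
    have h4 := mul_nonneg hx.le (Complex.normSq_nonneg (Q.eval (x : ℂ)))
    have h5 : x * Complex.normSq (Q.eval (x : ℂ)) = 0 := by linarith
    exact ⟨Complex.normSq_eq_zero.mp (by linarith),
      Complex.normSq_eq_zero.mp ((mul_eq_zero.mp h5).resolve_left hx.ne')⟩
  have hinf : (((↑) : ℝ → ℂ) '' Set.Ioi 0).Infinite :=
    (Set.Ioi_infinite 0).image Complex.ofReal_injective.injOn
  constructor
  · refine eq_zero_of_infinite_isRoot _ (hinf.mono ?_)
    rintro _ ⟨x, hx, rfl⟩
    exact (hzero x hx).1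
  · refine eq_zero_of_infinite_isRoot _ (hinf.mono ?_)
    rintro _ ⟨x, hx, rfl⟩
    exact (hzero x hx).2

end

/-! ### The differential star ring of smooth functions on the plane. -/

section
open scoped ContDiff

/-- The star algebra of smooth complex functions on the plane. -/
def smoothStarSubalgebra : StarSubalgebra ℂ (ℝ × ℝ → ℂ) where
  carrier := {f | ContDiff ℝ ∞ f}
  mul_mem' {f g} hf hg := (show ContDiff ℝ ∞ f from hf).mul (show ContDiff ℝ ∞ g from hg)
  one_mem' := show ContDiff ℝ ∞ fun _ : ℝ × ℝ => (1 : ℂ) from contDiff_const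
  add_mem' {f g} hf hg := (show ContDiff ℝ ∞ f from hf).add (show ContDiff ℝ ∞ g from hg)
  zero_mem' := show ContDiff ℝ ∞ fun _ : ℝ × ℝ => (0 : ℂ) from contDiff_const
  algebraMap_mem' c := show ContDiff ℝ ∞ fun _ : ℝ × ℝ => c from contDiff_const
  star_mem' {f} hf := Complex.conjCLE.contDiff.comp (show ContDiff ℝ ∞ f from hf)

/-- The smooth complex functions on the plane. -/
abbrev SmoothFun : Type := smoothStarSubalgebra

namespace SmoothFun

theorem contDiff (f : SmoothFun) : ContDiff ℝ ∞ (f : ℝ × ℝ → ℂ) := f.2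

theorem differentiable (f : SmoothFun) : Differentiable ℝ (f : ℝ × ℝ → ℂ) :=
  f.contDiff.differentiable (by simp)

/-- The derivative in a fixed direction. -/
noncomputable def dir (v : ℝ × ℝ) : Derivation ℤ SmoothFun SmoothFun :=
  Derivation.mk'
    (AddMonoidHom.toIntLinearMap
      (AddMonoidHom.mk' (fun f : SmoothFun => (⟨fun p => fderiv ℝ (f : ℝ × ℝ → ℂ) p v,
          (f.contDiff.fderiv_right (m := ∞) (by simp)).clm_apply contDiff_const⟩ : SmoothFun))
        (fun f g => by
          ext p
          change fderiv ℝ ((f : ℝ × ℝ → ℂ) + (g : ℝ × ℝ → ℂ)) p v = _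
          rw [fderiv_add (f.differentiable p) (g.differentiable p)]
          rfl)))
    (fun f g => by
      ext p
      change fderiv ℝ ((f : ℝ × ℝ → ℂ) * (g : ℝ × ℝ → ℂ)) p v = _
      rw [fderiv_mul (f.differentiable p) (g.differentiable p)]
      rfl)

theorem dir_apply (v : ℝ × ℝ) (f : SmoothFun) (p : ℝ × ℝ) :
    (dir v f : ℝ × ℝ → ℂ) p = fderiv ℝ (f : ℝ × ℝ → ℂ) p v := rfl

theorem dir_comm (v w : ℝ × ℝ) (f : SmoothFun) : dir v (dir w f) = dir w (dir v f) := by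
  ext p
  have hd : DifferentiableAt ℝ (fderiv ℝ (f : ℝ × ℝ → ℂ)) p :=
    (f.contDiff.fderiv_right (m := ∞) (by simp)).differentiable (by simp) p
  have hsymm : IsSymmSndFDerivAt ℝ (f : ℝ × ℝ → ℂ) p :=
    (f.contDiff.contDiffAt).isSymmSndFDerivAt (by
      rw [minSmoothness_of_isRCLikeNormedField]
      exact WithTop.coe_le_coe.mpr (le_top : (2 : ℕ∞) ≤ ⊤))
  have key : ∀ v w : ℝ × ℝ, (dir v (dir w f) : ℝ × ℝ → ℂ) p
      = fderiv ℝ (fderiv ℝ (f : ℝ × ℝ → ℂ)) p v w := by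
    intro v w
    rw [dir_apply]
    change fderiv ℝ (fun p => fderiv ℝ (f : ℝ × ℝ → ℂ) p w) p v = _
    rw [fderiv_clm_apply hd (differentiableAt_const w)]
    simp
  rw [key, key, hsymm.eq]

theorem dir_star (v : ℝ × ℝ) (f : SmoothFun) : dir v (star f) = star (dir v f) := by
  ext p
  rw [dir_apply]
  change fderiv ℝ (fun p => star ((f : ℝ × ℝ → ℂ) p)) p v = star (fderiv ℝ (f : ℝ × ℝ → ℂ) p v)
  rw [fderiv_star]
  rfl

theorem dir_algebraMap (v : ℝ × ℝ) (c : ℂ) : dir v (algebraMap ℂ SmoothFun c) = 0 := by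
  ext p
  rw [dir_apply]
  change fderiv ℝ (fun _ => c) p v = 0
  simp

/-- Evaluation at a point. -/
def eval (p : ℝ × ℝ) : SmoothFun →+* ℂ where
  toFun f := (f : ℝ × ℝ → ℂ) p
  map_one' := rfl
  map_mul' _ _ := rfl
  map_zero' := rfl
  map_add' _ _ := rfl

theorem eval_star (p : ℝ × ℝ) (f : SmoothFun) : eval p (star f) = star (eval p f) := rfl

theorem eval_algebraMap (p : ℝ × ℝ) (c : ℂ) : eval p (algebraMap ℂ SmoothFun c) = c := rfl

theorem ext_eval {f g : SmoothFun} (h : ∀ p, eval p f = eval p g) : f = g :=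
  Subtype.ext (funext h)

theorem isUnit_of_eval_ne_zero {f : SmoothFun} (h : ∀ p, eval p f ≠ 0) : IsUnit f :=
  IsUnit.of_mul_eq_one ⟨fun p => ((f : ℝ × ℝ → ℂ) p)⁻¹, f.contDiff.inv h⟩
    (ext_eval fun p => mul_inv_cancel₀ (h p))

end SmoothFun

end

/-! ### Derivations on power series, and the kernel condition over smooth functions. -/

section
open Polynomial

section
variable {S : Type*} [CommRing S] (d : Derivation ℤ S S)

/-- The coefficientwise extension of a derivation to power series. -/
noncomputable def seriesDeriv (f : PowerSeries S) : PowerSeries S :=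
  PowerSeries.mk fun n => d (PowerSeries.coeff n f)

theorem coeff_seriesDeriv (f : PowerSeries S) (n : ℕ) :
    PowerSeries.coeff n (seriesDeriv d f) = d (PowerSeries.coeff n f) := by
  simp [seriesDeriv]

theorem seriesDeriv_add (f g : PowerSeries S) :
    seriesDeriv d (f + g) = seriesDeriv d f + seriesDeriv d g := by
  ext; simp [coeff_seriesDeriv]

theorem seriesDeriv_mul (f g : PowerSeries S) :
    seriesDeriv d (f * g) = f * seriesDeriv d g + g * seriesDeriv d f := by
  ext n
  rw [mul_comm g]
  simp only [coeff_seriesDeriv, PowerSeries.coeff_mul, map_add, map_sum, Derivation.leibniz,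
    smul_eq_mul, ← Finset.sum_add_distrib]
  exact Finset.sum_congr rfl fun _ _ => by ring

theorem seriesDeriv_C (a : S) : seriesDeriv d (PowerSeries.C a) = PowerSeries.C (d a) := by
  ext n
  simp only [coeff_seriesDeriv, PowerSeries.coeff_C]
  split_ifs <;> simp

theorem seriesDeriv_X : seriesDeriv d (PowerSeries.X : PowerSeries S) = 0 := by
  ext n
  simp only [coeff_seriesDeriv, PowerSeries.coeff_X]
  split_ifs <;> simp

/-- The substituted z = (l + μ)² is a constant of the derivation, so only the coefficients of P are
differentiated. -/
theorem seriesDeriv_evSq {l : S} (hl : d l = 0) (P : S[X]) :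
    seriesDeriv d (evSq l P) = evSq l (polyDeriv d P) := by
  induction P using Polynomial.induction_on' with
  | add P Q hP hQ => rw [map_add, seriesDeriv_add, hP, hQ, map_add, map_add]
  | monomial n a =>
    have hz : seriesDeriv d (evSq l X) = 0 := by
      rw [evSq_X, pow_two, seriesDeriv_mul, seriesDeriv_add, seriesDeriv_C, hl, seriesDeriv_X]
      simp
    have hzn : ∀ n, seriesDeriv d (evSq l X ^ n) = 0 := by
      intro n
      induction n with
      | zero => rw [pow_zero, ← map_one PowerSeries.C, seriesDeriv_C]; simp
      | succ n ih => rw [pow_succ, seriesDeriv_mul, hz, ih]; simp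
    have : polyDeriv d (monomial n a) = monomial n (d a) := by
      ext m
      rw [coeff_polyDeriv, coeff_monomial, coeff_monomial]
      split_ifs <;> simp
    rw [this, ← C_mul_X_pow_eq_monomial, ← C_mul_X_pow_eq_monomial, map_mul, map_mul, map_pow,
      evSq_C, evSq_C, seriesDeriv_mul, seriesDeriv_C, hzn]
    ring

theorem X_pow_dvd_seriesDeriv {k : ℕ} {f : PowerSeries S} (h : PowerSeries.X ^ k ∣ f) :
    PowerSeries.X ^ k ∣ seriesDeriv d f := by
  rw [PowerSeries.X_pow_dvd_iff] at h ⊢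
  intro m hm
  rw [coeff_seriesDeriv, h m hm, map_zero]

/-- Kernel conditions are preserved by the dressed derivations. -/
theorem SeriesKills.dressed {l : S} (hl : d l = 0) {k : ℕ} {F G : PowerSeries S}
    {U11 U12 U21 U22 : S[X]} (hF : seriesDeriv d F = evSq l U11 * F + evSq l U12 * G)
    (hG : seriesDeriv d G = evSq l U21 * F + evSq l U22 * G) {P Q : S[X]}
    (h : SeriesKills l k F G P Q) :
    SeriesKills l k F G (polyDeriv d P + P * U11 + Q * U21) (polyDeriv d Q + P * U12 + Q * U22) := by
  have := X_pow_dvd_seriesDeriv d h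
  rw [seriesDeriv_add, seriesDeriv_mul, seriesDeriv_mul, seriesDeriv_evSq d hl,
    seriesDeriv_evSq d hl, hF, hG] at this
  unfold SeriesKills
  convert this using 1
  simp only [map_add, map_mul]
  ring

end

theorem map_evSq {S T : Type*} [CommRing S] [CommRing T] (φ : S →+* T) (l : S) (P : S[X]) :
    PowerSeries.map φ (evSq l P) = evSq (φ l) (P.map φ) := by
  simp only [evSq, coe_eval₂RingHom, hom_eval₂, eval₂_map]
  congr 1
  · ext; simp
  · simp

theorem SeriesKills.map {S T : Type*} [CommRing S] [CommRing T] (φ : S →+* T) {l : S} {k : ℕ}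
    {F G : PowerSeries S} {P Q : S[X]} (h : SeriesKills l k F G P Q) :
    SeriesKills (φ l) k (PowerSeries.map φ F) (PowerSeries.map φ G) (P.map φ) (Q.map φ) := by
  have := map_dvd (PowerSeries.map φ) h
  simpa only [SeriesKills, map_pow, PowerSeries.map_X, map_add, map_mul, map_evSq] using this

namespace SmoothFun

/-- Constant functions. -/
noncomputable abbrev cst (c : ℂ) : SmoothFun := algebraMap ℂ SmoothFun c

theorem map_eval_polyStar (p : ℝ × ℝ) (P : SmoothFun[X]) :
    (polyStar P).map (eval p) = polyStar (P.map (eval p)) := by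
  ext m
  rw [coeff_map, coeff_polyStar, coeff_polyStar, coeff_map, eval_star]

theorem star_cst_ofReal (c : ℝ) : star (cst c) = cst c :=
  ext_eval fun p => by rw [eval_star, eval_algebraMap]; simp

/-- Evaluation at each point is a ring homomorphism commuting with conjugation, so the complex case
applies pointwise. -/
theorem eq_zero_of_seriesKills {l : ℂ} (hre : l.re ≠ 0) (him : l.im ≠ 0) {k : ℕ}
    {F G : PowerSeries SmoothFun}
    (hFG : ∀ p, eval p (PowerSeries.constantCoeff F) ≠ 0 ∨ eval p (PowerSeries.constantCoeff G) ≠ 0)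
    {P Q : SmoothFun[X]}
    (hP : ∀ m, k ≤ m → P.coeff m = 0) (hQ : ∀ m, k ≤ m → Q.coeff m = 0)
    (h1 : SeriesKills (cst l) k F G P Q)
    (h2 : SeriesKills (cst l) k F G (-(X * polyStar Q)) (polyStar P)) :
    P = 0 ∧ Q = 0 := by
  have key : ∀ p, P.map (eval p) = 0 ∧ Q.map (eval p) = 0 := by
    intro p
    refine _root_.eq_zero_of_seriesKills hre him (F := PowerSeries.map (eval p) F)
      (G := PowerSeries.map (eval p) G) (hFG p)
      (fun m hm => by rw [coeff_map, hP m hm, map_zero])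
      (fun m hm => by rw [coeff_map, hQ m hm, map_zero]) (h1.map (eval p)) ?_
    have := h2.map (eval p)
    rwa [Polynomial.map_neg, Polynomial.map_mul, map_X, map_eval_polyStar, map_eval_polyStar] at this
  constructor
  · ext1 m
    refine ext_eval fun p => ?_
    have := congrArg (coeff · m) (key p).1
    simpa using this
  · ext1 m
    refine ext_eval fun p => ?_
    have := congrArg (coeff · m) (key p).2
    simpa using this

/-- Once the truncated series satisfy the Lax system, the abstract dressing applies: the Leibniz
rule gives `lax_x` and `lax_t`, and positivity gives `uniq`. -/
theorem laxKernel {dx dt : Derivation ℤ SmoothFun SmoothFun} (hdx : dx = dir (1, 0))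
    (hdt : dt = dir (0, 1)) {J a h : SmoothFun} (hJ : J = cst Complex.I) {a' h' : ℝ}
    (ha : a = cst a') (hh : h = cst h') {q : SmoothFun} (hq : q * star q = 4 * h ^ 2)
    (hqx : dx q = J * a * q) (hqt : dt q = -(J * (a ^ 2 + 4 * h ^ 2 * a)) * q)
    {l : ℂ} (hre : l.re ≠ 0) (him : l.im ≠ 0) {k : ℕ} {F G : PowerSeries SmoothFun}
    (hFG : ∀ p, eval p (PowerSeries.constantCoeff F) ≠ 0 ∨ eval p (PowerSeries.constantCoeff G) ≠ 0)
    (hFx : seriesDeriv dx F = evSq (cst l) (-C J * X + C (J * h ^ 2)) * F + evSq (cst l) (C q) * G)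
    (hGx : seriesDeriv dx G = evSq (cst l) (-(X * C (star q))) * F
      + evSq (cst l) (C J * X - C (J * h ^ 2)) * G)
    (hFt : seriesDeriv dt F = evSq (cst l) (-C (2 * J) * X ^ 2 + C (4 * J * h ^ 2) * X
        - C (J * (2 * h ^ 4 + 2 * a * h ^ 2))) * F
      + evSq (cst l) ((2 * X - C (a + 2 * h ^ 2)) * C q) * G)
    (hGt : seriesDeriv dt G = evSq (cst l) (-(X * (2 * X - C (a + 2 * h ^ 2)) * C (star q))) * F
      + evSq (cst l) (C (2 * J) * X ^ 2 - C (4 * J * h ^ 2) * X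
        + C (J * (2 * h ^ 4 + 2 * a * h ^ 2))) * G) :
    LaxKernel dx dt J a h q k (SeriesKills (cst l) k F G) where
  J_sq := by rw [hJ, ← map_mul, Complex.I_mul_I]; simp
  star_J := ext_eval fun p => by
    rw [hJ, eval_star, eval_algebraMap, map_neg, eval_algebraMap]; simp
  dx_J := by rw [hJ, hdx, dir_algebraMap]
  dt_J := by rw [hJ, hdt, dir_algebraMap]
  star_a := by rw [ha, star_cst_ofReal]
  dx_a := by rw [ha, hdx, dir_algebraMap]
  dt_a := by rw [ha, hdt, dir_algebraMap]
  star_h := by rw [hh, star_cst_ofReal]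
  dx_h := by rw [hh, hdx, dir_algebraMap]
  dt_h := by rw [hh, hdt, dir_algebraMap]
  q_star := hq
  dx_q := hqx
  dt_q := hqt
  comm f := by rw [hdx, hdt, dir_comm]
  dx_star f := by rw [hdx, dir_star]
  dt_star f := by rw [hdt, dir_star]
  add P Q P' Q' h1 h2 := by
    have := dvd_add h1 h2
    unfold SeriesKills
    convert this using 1
    simp only [map_add]
    ring
  mul R P Q h1 := by
    have := h1.mul_left (evSq (cst l) R)
    unfold SeriesKills
    convert this using 1
    simp only [map_mul]
    ring
  lax_x P Q h1 := h1.dressed dx (by rw [hdx, dir_algebraMap]) hFx hGx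
  lax_t P Q h1 := h1.dressed dt (by rw [hdt, dir_algebraMap]) hFt hGt
  uniq P Q hP hQ h1 h2 := eq_zero_of_seriesKills hre him hFG hP hQ h1 h2

end SmoothFun

end

/-! ### Matrices of Taylor coefficients as linear systems for pairs of polynomials. -/

section
open Polynomial

section
variable {S : Type*} [CommRing S] {k : ℕ}

/-- The rows `(λ^(n-1) F, λ^(n-2) G, λ^(n-3) F, …)`. -/
noncomputable def altRow {R : Type*} [CommRing R] (lam F G : R) (j : Fin (2 * k)) : R :=
  lam ^ (2 * k - 1 - (j : ℕ)) * if Even (j : ℕ) then F else G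

/-- The rows `(λ^n F, λ^(n-2) F, λ^(n-3) G, …)`. -/
noncomputable def altRow' {R : Type*} [CommRing R] (lam F G : R) (j : Fin (2 * k)) : R :=
  if (j : ℕ) = 0 then lam ^ (2 * k) * F else altRow lam G F j

/-- The polynomial with coefficients taken from the odd positions of a vector. -/
noncomputable def oddPoly (v : Fin (2 * k) → S) : S[X] :=
  ∑ j : Fin (2 * k), if Even (j : ℕ) then 0 else C (v j) * X ^ ((2 * k - 1 - (j : ℕ)) / 2)

/-- The polynomial with coefficients taken from the even positions of a vector. -/
noncomputable def evenPoly (v : Fin (2 * k) → S) : S[X] :=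
  ∑ j : Fin (2 * k), if Even (j : ℕ) then C (v j) * X ^ ((2 * k - 1 - (j : ℕ)) / 2) else 0

theorem coeff_oddPoly (v : Fin (2 * k) → S) (m : ℕ) (j : Fin (2 * k))
    (hj : (j : ℕ) + 2 * m + 1 = 2 * k) : (oddPoly v).coeff m = v j := by
  rw [oddPoly, finsetSum_coeff, Finset.sum_eq_single j]
  · rw [if_neg (by rw [Nat.not_even_iff_odd]; exact ⟨k - m - 1, by omega⟩), coeff_C_mul_X_pow,
      if_pos (by omega)]
  · intro i _ hi
    split_ifs with h
    · simp
    · rw [coeff_C_mul_X_pow, if_neg]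
      rintro h'
      rw [Nat.not_even_iff_odd] at h
      obtain ⟨r, hr⟩ := h
      have := i.isLt
      exact hi (Fin.ext (by omega))
  · simp

theorem coeff_evenPoly (v : Fin (2 * k) → S) (m : ℕ) (j : Fin (2 * k))
    (hj : (j : ℕ) + 2 * m + 2 = 2 * k) : (evenPoly v).coeff m = v j := by
  rw [evenPoly, finsetSum_coeff, Finset.sum_eq_single j]
  · rw [if_pos ⟨k - m - 1, by omega⟩, coeff_C_mul_X_pow, if_pos (by omega)]
  · intro i _ hi
    split_ifs with h
    · rw [coeff_C_mul_X_pow, if_neg]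
      rintro h'
      obtain ⟨r, hr⟩ := h
      have := i.isLt
      exact hi (Fin.ext (by omega))
    · simp
  · simp

theorem coeff_oddPoly_of_le (v : Fin (2 * k) → S) (m : ℕ) (hm : k ≤ m) :
    (oddPoly v).coeff m = 0 := by
  rw [oddPoly, finsetSum_coeff]
  refine Finset.sum_eq_zero fun j _ => ?_
  split_ifs
  · simp
  · rw [coeff_C_mul_X_pow, if_neg]
    have := j.isLt
    omega

theorem coeff_evenPoly_of_le (v : Fin (2 * k) → S) (m : ℕ) (hm : k ≤ m) :
    (evenPoly v).coeff m = 0 := by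
  rw [evenPoly, finsetSum_coeff]
  refine Finset.sum_eq_zero fun j _ => ?_
  split_ifs
  · rw [coeff_C_mul_X_pow, if_neg]
    have := j.isLt
    omega
  · simp

/-- The exponent 2k - 1 - j has parity opposite to j. Odd positions thus carry even powers of λ
times F, and even positions carry odd powers times G, whose extra λ is absorbed into λG. -/
theorem evSq_oddPoly_add_evenPoly (l : S) (F G : PowerSeries S) (v : Fin (2 * k) → S) :
    evSq l (oddPoly v) * F + evSq l (evenPoly v) * ((PowerSeries.C l + PowerSeries.X) * G)
      = ∑ j, PowerSeries.C (v j) * altRow (PowerSeries.C l + PowerSeries.X) G F j := by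
  rw [oddPoly, evenPoly, map_sum, map_sum, Finset.sum_mul, Finset.sum_mul,
    ← Finset.sum_add_distrib]
  refine Finset.sum_congr rfl fun j _ => ?_
  have hj := j.isLt
  rw [altRow]
  split_ifs with h
  · obtain ⟨r, hr⟩ := h
    have : 2 * k - 1 - (j : ℕ) = 2 * ((2 * k - 1 - (j : ℕ)) / 2) + 1 := by omega
    rw [map_zero, map_mul, map_pow, evSq_C, evSq_X]
    conv_rhs => rw [this, pow_succ, pow_mul]
    ring
  · rw [Nat.not_even_iff_odd] at h
    obtain ⟨r, hr⟩ := h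
    have : 2 * k - 1 - (j : ℕ) = 2 * ((2 * k - 1 - (j : ℕ)) / 2) := by omega
    rw [map_zero, map_mul, map_pow, evSq_C, evSq_X]
    conv_rhs => rw [this, pow_mul]
    ring

end

section
variable {S : Type*} [CommRing S] [StarRing S] {k : ℕ}

/-- The matrix of Taylor coefficients of pairs of rows, the second row of each pair being
conjugated. -/
noncomputable def taylorMat (φ χ : Fin (2 * k) → PowerSeries S) : Matrix (Fin (2 * k)) (Fin (2 * k)) S :=
  Matrix.of fun i j =>
    if Even (i : ℕ) then PowerSeries.coeff ((i : ℕ) / 2) (φ j)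
    else star (PowerSeries.coeff ((i : ℕ) / 2) (χ j))

/-- This translates the conjugated rows into the partner condition. Turning them into combinations
of F and λG with coefficients in z costs one factor λ, which appears on the right. -/
theorem evSq_conj_oddPoly_add_evenPoly (l : S) (F G : PowerSeries S) (v : Fin (2 * k) → S) :
    evSq l (-(X * polyStar (evenPoly v))) * F
        + evSq l (polyStar (oddPoly v)) * ((PowerSeries.C l + PowerSeries.X) * G)
      = (PowerSeries.C l + PowerSeries.X)
        * ∑ j, PowerSeries.C (star (v j)) * altRow (-(PowerSeries.C l + PowerSeries.X)) F G j := by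
  rw [oddPoly, evenPoly, map_sum, map_sum, Finset.mul_sum, ← Finset.sum_neg_distrib, map_sum,
    map_sum, Finset.sum_mul, Finset.sum_mul, ← Finset.sum_add_distrib, Finset.mul_sum]
  refine Finset.sum_congr rfl fun j _ => ?_
  have hj := j.isLt
  rw [altRow]
  split_ifs with h
  · obtain ⟨r, hr⟩ := h
    have : 2 * k - 1 - (j : ℕ) = 2 * ((2 * k - 1 - (j : ℕ)) / 2) + 1 := by omega
    simp only [map_zero, map_mul, map_pow, map_neg, evSq_C, evSq_X, polyStar_C, polyStar_X]
    conv_rhs => rw [this, pow_succ, pow_mul, neg_sq]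
    ring
  · rw [Nat.not_even_iff_odd] at h
    obtain ⟨r, hr⟩ := h
    have : 2 * k - 1 - (j : ℕ) = 2 * ((2 * k - 1 - (j : ℕ)) / 2) := by omega
    simp only [map_zero, map_mul, map_pow, map_neg, evSq_C, evSq_X, polyStar_C, polyStar_X]
    conv_rhs => rw [this, pow_mul, neg_sq]
    ring

theorem taylorMat_mulVec (φ χ : Fin (2 * k) → PowerSeries S) (v : Fin (2 * k) → S)
    (i : Fin (2 * k)) :
    (taylorMat φ χ).mulVec v i = if Even (i : ℕ)
      then PowerSeries.coeff ((i : ℕ) / 2) (∑ j, PowerSeries.C (v j) * φ j)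
      else star (PowerSeries.coeff ((i : ℕ) / 2) (∑ j, PowerSeries.C (star (v j)) * χ j)) := by
  simp only [Matrix.mulVec, dotProduct, taylorMat, Matrix.of_apply]
  split_ifs
  · rw [map_sum]
    exact Finset.sum_congr rfl fun j _ => by rw [PowerSeries.coeff_C_mul, mul_comm]
  · rw [map_sum, star_sum]
    exact Finset.sum_congr rfl fun j _ => by
      rw [PowerSeries.coeff_C_mul, star_mul', star_star, mul_comm]

/-- Vanishing of a combination of the columns expressed as divisibility. -/
theorem X_pow_dvd_of_forall {f g : PowerSeries S}
    (h : ∀ i : Fin (2 * k), (if Even (i : ℕ) then PowerSeries.coeff ((i : ℕ) / 2) f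
      else star (PowerSeries.coeff ((i : ℕ) / 2) g)) = 0) :
    PowerSeries.X ^ k ∣ f ∧ PowerSeries.X ^ k ∣ g := by
  constructor
  · rw [PowerSeries.X_pow_dvd_iff]
    intro m hm
    have := h ⟨2 * m, by omega⟩
    rw [if_pos ⟨m, by simp; ring⟩] at this
    simpa using this
  · rw [PowerSeries.X_pow_dvd_iff]
    intro m hm
    have := h ⟨2 * m + 1, by omega⟩
    rw [if_neg (by simp), star_eq_zero] at this
    rwa [show (2 * m + 1) / 2 = m by omega] at this

end

/-- The matrix `Ŵ` of Taylor coefficients is nonsingular. -/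
theorem det_taylorMat_ne_zero {l : ℂ} (hre : l.re ≠ 0) (him : l.im ≠ 0) {k : ℕ}
    {F G : PowerSeries ℂ}
    (hFG : PowerSeries.constantCoeff F ≠ 0 ∨ PowerSeries.constantCoeff G ≠ 0) :
    (taylorMat (k := k) (altRow (PowerSeries.C l + PowerSeries.X) G F)
      (altRow (-(PowerSeries.C l + PowerSeries.X)) F G)).det ≠ 0 := by
  intro h0
  -- A kernel vector is the coefficient list of a pair of polynomials of degree less than k
  -- satisfying both annihilation conditions.
  obtain ⟨v, hv, hv0⟩ := Matrix.exists_mulVec_eq_zero_iff.mpr h0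
  have hl : l ≠ 0 := by rintro rfl; simp at hre
  obtain ⟨d1, d2⟩ := X_pow_dvd_of_forall (k := k)
    (f := ∑ j, PowerSeries.C (v j) * altRow (PowerSeries.C l + PowerSeries.X) G F j)
    (g := ∑ j, PowerSeries.C (star (v j)) * altRow (-(PowerSeries.C l + PowerSeries.X)) F G j)
    (fun i => by rw [← taylorMat_mulVec, hv0]; rfl)
  obtain ⟨e1, e2⟩ := eq_zero_of_seriesKills hre him (k := k) (F := F)
    (G := (PowerSeries.C l + PowerSeries.X) * G) (P := oddPoly v) (Q := evenPoly v)
    (hFG.imp id fun h => by simpa [hl] using h) (coeff_oddPoly_of_le v) (coeff_evenPoly_of_le v)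
    (by rw [SeriesKills, evSq_oddPoly_add_evenPoly]; exact d1)
    (by rw [SeriesKills, evSq_conj_oddPoly_add_evenPoly]; exact d2.mul_left _)
  apply hv
  ext j
  have hj := j.isLt
  rcases Nat.even_or_odd (j : ℕ) with ⟨r, hr⟩ | ⟨r, hr⟩
  · rw [← coeff_evenPoly v (k - 1 - r) j (by omega), e2]
    rfl
  · rw [← coeff_oddPoly v (k - 1 - r) j (by omega), e1]
    rfl

end

/-! ### Symmetries of the Taylor coefficient determinants. -/

section
open Polynomial

section
variable {S : Type*} [CommRing S] [StarRing S] {k : ℕ}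

theorem taylorMat_map {T : Type*} [CommRing T] [StarRing T] (ϕ : S →+* T)
    (hϕ : ∀ a, ϕ (star a) = star (ϕ a)) (φ χ : Fin (2 * k) → PowerSeries S) :
    (taylorMat φ χ).map ϕ
      = taylorMat (fun j => PowerSeries.map ϕ (φ j)) (fun j => PowerSeries.map ϕ (χ j)) := by
  ext i j
  simp only [taylorMat, Matrix.map_apply, Matrix.of_apply, PowerSeries.coeff_map]
  split_ifs
  · rfl
  · rw [hϕ]

/-- The involution exchanging the two members of each pair. -/
def pairSwap (k : ℕ) : Equiv.Perm (Fin (2 * k)) :=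
  Function.Involutive.toPerm
    (fun i => if h : Even (i : ℕ) then ⟨i + 1, by obtain ⟨r, hr⟩ := h; omega⟩
      else ⟨i - 1, by omega⟩)
    (fun i => by
      ext
      by_cases h : Even (i : ℕ)
      · have : ¬ Even ((i : ℕ) + 1) := by simpa [Nat.even_add_one] using h
        simp [h, this]
      · have h1 : (i : ℕ) ≠ 0 := fun h0 => h (by rw [h0]; exact Even.zero)
        have h2 : Even ((i : ℕ) - 1) := by
          obtain ⟨r, hr⟩ := Nat.not_even_iff_odd.mp h
          exact ⟨r, by omega⟩
        simp only [h, h2, dite_true, dite_false]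
        omega)

theorem pairSwap_of_even {i : Fin (2 * k)} (h : Even (i : ℕ)) : (pairSwap k i : ℕ) = i + 1 := by
  change ((if h : Even (i : ℕ) then ⟨i + 1, _⟩ else ⟨i - 1, _⟩ : Fin (2 * k)) : ℕ) = _
  rw [dif_pos h]

theorem pairSwap_of_not_even {i : Fin (2 * k)} (h : ¬ Even (i : ℕ)) :
    (pairSwap k i : ℕ) = i - 1 := by
  change ((if h : Even (i : ℕ) then ⟨i + 1, _⟩ else ⟨i - 1, _⟩ : Fin (2 * k)) : ℕ) = _
  rw [dif_neg h]

/-- Conjugating W exchanges the two rows of each pair of Ŵ, up to the column signs (-1)^(2k-1-j)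
produced by -λ. The factor σ collects these signs and the sign of the row permutation. -/
theorem star_det_taylorMat (lam F G : PowerSeries S) :
    ∃ σ : S, σ * σ = 1 ∧ star σ = σ ∧
      star (taylorMat (k := k) (altRow lam F G) (altRow (-lam) G F)).det
        = σ * (taylorMat (k := k) (altRow lam G F) (altRow (-lam) F G)).det := by
  set W := taylorMat (k := k) (altRow lam F G) (altRow (-lam) G F)
  set V := taylorMat (k := k) (altRow lam G F) (altRow (-lam) F G)
  have hneg : ∀ (A B : PowerSeries S) (j : Fin (2 * k)) (m : ℕ),
      PowerSeries.coeff m (altRow (-lam) A B j)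
        = (-1) ^ (2 * k - 1 - (j : ℕ)) * PowerSeries.coeff m (altRow lam A B j) := by
    intro A B j m
    rw [altRow, altRow, neg_pow lam, mul_assoc,
      show (-1 : PowerSeries S) ^ (2 * k - 1 - (j : ℕ))
        = PowerSeries.C ((-1) ^ (2 * k - 1 - (j : ℕ))) by simp, PowerSeries.coeff_C_mul]
  have hsgn : ∀ m : ℕ, ((-1 : S) ^ m) * (-1) ^ m = 1 := fun m => by
    rw [← mul_pow]; simp
  have h1 : V.submatrix (pairSwap k) id
      = (W.map star) * Matrix.diagonal fun j : Fin (2 * k) => (-1 : S) ^ (2 * k - 1 - (j : ℕ)) := by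
    ext i j
    rw [Matrix.mul_diagonal, Matrix.submatrix_apply, Matrix.map_apply]
    simp only [V, W, taylorMat, Matrix.of_apply, id]
    by_cases h : Even (i : ℕ)
    · have h' : ¬ Even ((i : ℕ) + 1) := by simpa [Nat.even_add_one] using h
      have h2 : ((i : ℕ) + 1) / 2 = (i : ℕ) / 2 := by obtain ⟨r, hr⟩ := h; omega
      simp only [pairSwap_of_even h, h, h', if_true, if_false, h2, hneg, star_mul', star_pow, star_neg,
        star_one]
      ring
    · have h' : Even ((i : ℕ) - 1) := by
        obtain ⟨r, hr⟩ := Nat.not_even_iff_odd.mp h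
        exact ⟨r, by omega⟩
      have h2 : ((i : ℕ) - 1) / 2 = (i : ℕ) / 2 := by
        obtain ⟨r, hr⟩ := Nat.not_even_iff_odd.mp h; omega
      simp only [pairSwap_of_not_even h, h, h', if_true, if_false, h2, hneg, star_star]
      linear_combination (-PowerSeries.coeff ((i : ℕ) / 2) (altRow lam G F j))
        * hsgn (2 * k - 1 - (j : ℕ))
  have h2 := congrArg Matrix.det h1
  rw [Matrix.det_permute, Matrix.det_mul, Matrix.det_diagonal] at h2
  have h3 : (W.map star).det = star W.det := by
    exact (RingHom.map_det (starRingEnd S) W).symm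
  set p : S := ∏ j : Fin (2 * k), (-1 : S) ^ (2 * k - 1 - (j : ℕ)) with hp
  have hpp : p * p = 1 := by
    rw [hp, ← Finset.prod_mul_distrib]
    exact Finset.prod_eq_one fun j _ => hsgn _
  have hps : star p = p := by
    rw [hp, star_prod]
    exact Finset.prod_congr rfl fun j _ => by simp
  rw [h3] at h2
  obtain ⟨e, he⟩ : ∃ e : ℤˣ, Equiv.Perm.sign (pairSwap k) = e := ⟨_, rfl⟩
  rw [he] at h2
  refine ⟨p * ((e : ℤ) : S), ?_, ?_, ?_⟩
  · rcases Int.units_eq_one_or e with rfl | rfl <;> simp [hpp]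
  · rw [star_mul', hps, star_intCast]
  · linear_combination (-p) * h2 - star W.det * hpp

/-- Multiplication of the rows by `λ` acts by a triangular matrix with constant diagonal. -/
theorem det_taylorMat_mul (l : S) (φ χ : Fin (2 * k) → PowerSeries S) :
    (taylorMat (fun j => (PowerSeries.C l + PowerSeries.X) * φ j)
        (fun j => -(PowerSeries.C l + PowerSeries.X) * χ j)).det
      = (∏ i : Fin (2 * k), if Even (i : ℕ) then l else -star l) * (taylorMat φ χ).det := by
  let T : Matrix (Fin (2 * k)) (Fin (2 * k)) S := Matrix.of fun i j =>
    if j = i then (if Even (i : ℕ) then l else -star l)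
    else if (j : ℕ) + 2 = i then (if Even (i : ℕ) then 1 else -1) else 0
  have hT : T.det = ∏ i : Fin (2 * k), if Even (i : ℕ) then l else -star l := by
    rw [Matrix.det_of_isLowerTriangular T]
    · exact Finset.prod_congr rfl fun i _ => by simp [T]
    · intro i j hij
      have hij : i < j := hij
      have h1 : j ≠ i := hij.ne'
      have h2 : (j : ℕ) + 2 ≠ i := by
        have : (i : ℕ) < j := hij
        omega
      simp [T, h1, h2]
  rw [← hT, ← Matrix.det_mul]
  congr 1
  ext i j
  rw [Matrix.mul_apply]
  have hcoeff : ∀ (f : PowerSeries S) (m : ℕ),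
      PowerSeries.coeff m ((PowerSeries.C l + PowerSeries.X) * f)
        = l * PowerSeries.coeff m f + if m = 0 then 0 else PowerSeries.coeff (m - 1) f := by
    intro f m
    rw [add_mul, map_add, PowerSeries.coeff_C_mul]
    rcases m with _ | m
    · simp
    · simp [PowerSeries.coeff_succ_X_mul]
  -- Multiplication by l + μ adds to row i the row i - 2 (with a sign in the conjugated rows); the
  -- first two rows have no such predecessor.
  by_cases h2 : (i : ℕ) < 2
  · have hi0 : (i : ℕ) / 2 = 0 := by omega
    rw [Finset.sum_eq_single i]
    · simp only [T, taylorMat, Matrix.of_apply, if_true, hi0, neg_mul, map_neg, hcoeff, add_zero,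
        star_neg, star_mul']
      split_ifs <;> ring
    · intro b _ hb
      have : (b : ℕ) + 2 ≠ i := by omega
      simp [T, hb, this]
    · simp
  · let i' : Fin (2 * k) := ⟨i - 2, by omega⟩
    have hne : i ≠ i' := by
      intro h
      have : (i : ℕ) = i - 2 := congrArg Fin.val h
      omega
    rw [← Finset.sum_subset (Finset.subset_univ {i, i'}), Finset.sum_pair hne]
    · have e1 : (i' : ℕ) + 2 = i := by simp only [i']; omega
      have e2 : Even (i' : ℕ) ↔ Even (i : ℕ) := by rw [← e1]; simp [Nat.even_add]
      have e3 : (i : ℕ) / 2 ≠ 0 := by omega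
      have e4 : (i' : ℕ) / 2 = (i : ℕ) / 2 - 1 := by omega
      simp only [T, taylorMat, Matrix.of_apply, if_true, neg_mul, map_neg, hcoeff, if_neg hne.symm,
        e1, e2, e4, if_neg e3, star_neg, star_add, star_mul']
      split_ifs <;> ring
    · intro b _ hb
      simp only [Finset.mem_insert, Finset.mem_singleton, not_or] at hb
      have : (b : ℕ) + 2 ≠ i := by
        intro h
        apply hb.2
        ext
        simp only [i']
        omega
      simp [T, hb.1, this]

end

end

/-! ### Cramer's rule: the Darboux potential in terms of the three determinants. -/

section
open Polynomial

section
variable {S : Type*} [CommRing S] [StarRing S] {k : ℕ}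

/-- M is Ŵ with its first column replaced by the column of λ^n F, which is the shape of a Cramer
numerator. The partner rows contain λ^n rather than (-λ)^n because n is even. -/
theorem taylorMat_altRow' (lam F G : PowerSeries S) :
    taylorMat (k := k + 1) (altRow' lam F G) (altRow' (-lam) G F)
      = (taylorMat (k := k + 1) (altRow lam G F) (altRow (-lam) F G)).updateCol
        (⟨0, by omega⟩ : Fin (2 * (k + 1))) fun i => if Even (i : ℕ)
          then PowerSeries.coeff ((i : ℕ) / 2) (lam ^ (2 * (k + 1)) * F)
          else star (PowerSeries.coeff ((i : ℕ) / 2) (lam ^ (2 * (k + 1)) * G)) := by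
  ext i j
  rw [Matrix.updateCol_apply]
  by_cases hj : j = ⟨0, by omega⟩
  · subst hj
    simp [taylorMat, altRow', pow_mul]
  · have : (j : ℕ) ≠ 0 := fun h => hj (Fin.ext h)
    simp only [taylorMat, altRow', Matrix.of_apply, if_neg hj, if_neg this]

/-- Replacing the last column of Ŵ by the column of λ^n F gives the columns λ^(n-1)G, …, λG, λ^n F.
After a cyclic rotation these are λ times the columns of W. -/
theorem det_taylorMat_updateCol_last (l : S) (F G : PowerSeries S) :
    ∃ e : ℤˣ, ((taylorMat (k := k + 1) (altRow (PowerSeries.C l + PowerSeries.X) G F)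
        (altRow (-(PowerSeries.C l + PowerSeries.X)) F G)).updateCol
        (⟨2 * k + 1, by omega⟩ : Fin (2 * (k + 1))) fun i => if Even (i : ℕ)
          then PowerSeries.coeff ((i : ℕ) / 2) ((PowerSeries.C l + PowerSeries.X) ^ (2 * (k + 1)) * F)
          else star (PowerSeries.coeff ((i : ℕ) / 2)
            ((PowerSeries.C l + PowerSeries.X) ^ (2 * (k + 1)) * G))).det
      = ((e : ℤ) : S) * ((∏ i : Fin (2 * (k + 1)), if Even (i : ℕ) then l else -star l)
        * (taylorMat (k := k + 1) (altRow (PowerSeries.C l + PowerSeries.X) F G)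
          (altRow (-(PowerSeries.C l + PowerSeries.X)) G F)).det) := by
  set lam := PowerSeries.C l + PowerSeries.X
  let r : Equiv.Perm (Fin (2 * (k + 1))) := finRotate (2 * (k + 1))
  refine ⟨Equiv.Perm.sign r, ?_⟩
  rw [← det_taylorMat_mul, ← Matrix.det_permute']
  congr 1
  ext i j
  rw [Matrix.updateCol_apply, Matrix.submatrix_apply]
  by_cases hj : j = ⟨2 * k + 1, by omega⟩
  · have hr : r j = ⟨0, by omega⟩ := by
      rw [hj]; exact finRotate_last' (n := 2 * k + 1)
    rw [if_pos hj, hr]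
    have e1 : 2 * (k + 1) = 2 * (k + 1) - 1 + 1 := by omega
    simp only [taylorMat, altRow, Matrix.of_apply, id, Even.zero, if_true, Nat.sub_zero]
    rw [← mul_assoc, ← mul_assoc, ← pow_succ', ← pow_succ', ← e1, pow_mul (-lam), neg_sq, ← pow_mul]
  · have hlt : (j : ℕ) < 2 * k + 1 := by
      have := j.isLt
      have : (j : ℕ) ≠ 2 * k + 1 := fun h => hj (Fin.ext h)
      omega
    have hr : (r j : ℕ) = j + 1 := by
      have := finRotate_of_lt (n := 2 * k + 1) hlt
      exact congrArg Fin.val this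
    rw [if_neg hj]
    have e1 : 2 * (k + 1) - 1 - (j : ℕ) = 2 * (k + 1) - 1 - (j + 1) + 1 := by omega
    simp only [taylorMat, altRow, Matrix.of_apply, id, hr, Nat.even_add_one, ite_not]
    rw [← mul_assoc, ← mul_assoc, ← pow_succ', ← pow_succ', ← e1]

/-- The Darboux transformed potential, expressed through the Taylor coefficient matrices, solves
the DNLSII equation. -/
theorem LaxKernel.isSolution_of_taylorMat {dx dt : Derivation ℤ S S} {J a h q l : S}
    {F G : PowerSeries S}
    (L : LaxKernel dx dt J a h q (k + 1)
      (SeriesKills l (k + 1) F ((PowerSeries.C l + PowerSeries.X) * G)))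
    (hl : IsUnit l) (hlx : dx l = 0) (hlt : dt l = 0) {W V M : Matrix (Fin (2 * (k + 1))) (Fin (2 * (k + 1))) S}
    (hW : W = taylorMat (altRow (PowerSeries.C l + PowerSeries.X) F G)
      (altRow (-(PowerSeries.C l + PowerSeries.X)) G F))
    (hV : V = taylorMat (altRow (PowerSeries.C l + PowerSeries.X) G F)
      (altRow (-(PowerSeries.C l + PowerSeries.X)) F G))
    (hM : M = taylorMat (altRow' (PowerSeries.C l + PowerSeries.X) F G)
      (altRow' (-(PowerSeries.C l + PowerSeries.X)) G F))
    (hVu : IsUnit V.det) {Q : S} (hQ : Q * W.det = V.det * q - 2 * J * M.det) :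
    J * dt Q + dx (dx Q) + J * (Q * star Q) * dx Q = 0 := by
  obtain ⟨σ, hσ, hσs, hWV⟩ := star_det_taylorMat (k := k + 1) (PowerSeries.C l + PowerSeries.X) F G
  rw [← hW, ← hV] at hWV
  have hσu : IsUnit σ := IsUnit.of_mul_eq_one _ hσ
  have hWu : IsUnit W.det := by
    have : IsUnit (star W.det) := hWV ▸ hσu.mul hVu
    simpa using this.star
  obtain ⟨e, he⟩ := det_taylorMat_updateCol_last (k := k) l F G
  have hM' := taylorMat_altRow' (k := k) (PowerSeries.C l + PowerSeries.X) F G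
  rw [← hV, ← hM] at hM'
  rw [← hV, ← hW] at he
  set m : Fin (2 * (k + 1)) → S := fun i => if Even (i : ℕ)
    then PowerSeries.coeff ((i : ℕ) / 2) ((PowerSeries.C l + PowerSeries.X) ^ (2 * (k + 1)) * F)
    else star (PowerSeries.coeff ((i : ℕ) / 2)
      ((PowerSeries.C l + PowerSeries.X) ^ (2 * (k + 1)) * G)) with hm
  set c : S := ∏ i : Fin (2 * (k + 1)), if Even (i : ℕ) then l else -star l with hc
  obtain ⟨d, hd⟩ := hVu.exists_right_inv
  obtain ⟨w', hw'⟩ := hWu.exists_right_inv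
  have hcu : IsUnit c ∧ dx c = 0 ∧ dt c = 0 := by
    refine Finset.prod_induction _ (fun c => IsUnit c ∧ dx c = 0 ∧ dt c = 0) ?_ ?_ ?_
    · rintro a b ⟨h1, h2, h3⟩ ⟨h4, h5, h6⟩
      refine ⟨h1.mul h4, ?_, ?_⟩ <;> rw [Derivation.leibniz] <;> simp [h2, h3, h5, h6]
    · exact ⟨isUnit_one, by simp, by simp⟩
    · intro i _
      split_ifs
      · exact ⟨hl, hlx, hlt⟩
      · refine ⟨hl.star.neg, ?_, ?_⟩
        · rw [Derivation.map_neg, L.dx_star, hlx]; simp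
        · rw [Derivation.map_neg, L.dt_star, hlt]; simp
  -- The solution of `V v = -m`: the coefficients for which λ^n F plus the combination of the
  -- columns of Ŵ vanishes to the required order. They are the non-leading coefficients of E and the
  -- coefficients of O.
  let v : Fin (2 * (k + 1)) → S := -(d • V.cramer m)
  have hv : V.mulVec v = -m := by
    rw [Matrix.mulVec_neg, Matrix.mulVec_smul, Matrix.mulVec_cramer, smul_smul, mul_comm d, hd,
      one_smul]
  have hv0 : v ⟨0, by omega⟩ * V.det = -M.det := by
    simp only [v, Pi.neg_apply, Pi.smul_apply, smul_eq_mul, Matrix.cramer_apply, ← hM']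
    linear_combination (-M.det) * hd
  have hvl : v ⟨2 * k + 1, by omega⟩ * V.det = -(((e : ℤ) : S) * (c * W.det)) := by
    simp only [v, Pi.neg_apply, Pi.smul_apply, smul_eq_mul, Matrix.cramer_apply, he]
    linear_combination (-(((e : ℤ) : S) * (c * W.det))) * hd
  obtain ⟨d1, d2⟩ := X_pow_dvd_of_forall (k := k + 1)
    (f := (PowerSeries.C l + PowerSeries.X) ^ (2 * (k + 1)) * F
      + ∑ j, PowerSeries.C (v j) * altRow (PowerSeries.C l + PowerSeries.X) G F j)
    (g := (PowerSeries.C l + PowerSeries.X) ^ (2 * (k + 1)) * G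
      + ∑ j, PowerSeries.C (star (v j)) * altRow (-(PowerSeries.C l + PowerSeries.X)) F G j)
    (fun i => by
      have h1 := congrFun hv i
      rw [hV, taylorMat_mulVec] at h1
      simp only [Pi.neg_apply, hm] at h1
      rw [map_add, map_add, star_add]
      split_ifs at h1 ⊢
      · rw [h1]; ring
      · rw [h1]; ring)
  have hE : (X ^ (k + 1) + oddPoly v : S[X]).coeff (k + 1) = 1 := by
    rw [coeff_add, coeff_oddPoly_of_le v _ le_rfl, coeff_X_pow]
    simp
  have hE' : ∀ m, k + 1 < m → (X ^ (k + 1) + oddPoly v : S[X]).coeff m = 0 := by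
    intro m hm
    rw [coeff_add, coeff_oddPoly_of_le v _ hm.le, coeff_X_pow, if_neg (by omega), add_zero]
  have hE0 : (X ^ (k + 1) + oddPoly v : S[X]).coeff 0 = v ⟨2 * k + 1, by omega⟩ := by
    rw [coeff_add, coeff_oddPoly v 0 ⟨2 * k + 1, by omega⟩ (by simp; ring), coeff_X_pow]
    simp
  have hO0 : (evenPoly v).coeff k = v ⟨0, by omega⟩ :=
    coeff_evenPoly v k ⟨0, by omega⟩ (by simp; ring)
  -- The quotient det Ŵ / det W is unimodular because the determinants are conjugate up to σ with σ²
  -- = 1.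
  have hww : V.det * w' * star (V.det * w') = 1 := by
    have h1 : star W.det * star w' = 1 := by rw [← star_mul', hw', star_one]
    have h2 : W.det = σ * star V.det := by
      rw [← star_star W.det, hWV, star_mul', hσs]
    rw [star_mul']
    rw [hWV] at h1
    calc V.det * w' * (star V.det * star w')
        = (W.det * w') * (σ * V.det * star w') + (V.det * w' * star V.det * star w') * (1 - σ * σ) := by
          rw [h2]; ring
      _ = 1 := by rw [hw', h1, hσ]; ring
  have heu : IsUnit ((e : ℤ) : S) := e.isUnit.map (Int.castRingHom S)
  -- E(0) is the last entry of `v`, that is, a constant times det W / det Ŵ. Hence its product with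
  -- the gauge factor is constant.
  refine L.isSolution hE hE' (coeff_evenPoly_of_le v) ?_ ?_ (w := V.det * w')
    (κ := -(((e : ℤ) : S) * c)) ?_ (heu.mul hcu.1).neg ?_ ?_ hww ?_
  · rw [SeriesKills, map_add, map_pow, add_mul, add_assoc, evSq_oddPoly_add_evenPoly, evSq_X,
      ← pow_mul]
    exact d1
  · rw [SeriesKills, map_add polyStar, map_add, map_pow, polyStar_X, map_pow, add_mul,
      add_left_comm, evSq_conj_oddPoly_add_evenPoly, evSq_X, ← pow_mul]
    convert d2.mul_left (PowerSeries.C l + PowerSeries.X) using 1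
    ring
  · rw [hE0]
    linear_combination w' * hvl - ((e : ℤ) : S) * c * hw'
  · rw [Derivation.map_neg, Derivation.leibniz, hcu.2.1, Derivation.map_intCast]; simp
  · rw [Derivation.map_neg, Derivation.leibniz, hcu.2.2, Derivation.map_intCast]; simp
  · rw [hO0]
    linear_combination w' * hQ - Q * hw' - 2 * J * w' * hv0

end

end

/-! ### Convergence of divided differences, and odd analytic functions. -/

section
open Metric

theorem dslope_fun_sub {f g : ℂ → ℂ} {a : ℂ} (hf : DifferentiableAt ℂ f a)
    (hg : DifferentiableAt ℂ g a) (z : ℂ) :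
    dslope (fun w => f w - g w) a z = dslope f a z - dslope g a z := by
  by_cases h : z = a
  · subst h
    simp only [dslope_same]
    exact deriv_fun_sub hf hg
  · simp only [dslope_of_ne _ h, slope_def_field]
    ring

/-- Insert f(w) = f(0) + w·g(w) with g = `dslope f 0` into the difference quotient at a. The formula
exhibits the effect of moving the base point as a term proportional to a. -/
theorem dslope_eq_add_mul_dslope {f : ℂ → ℂ} {a : ℂ} (hf : DifferentiableAt ℂ (dslope f 0) a)
    (z : ℂ) : dslope f a z = dslope f 0 z + a * dslope (dslope f 0) a z := by
  have h0 : f = fun w => f 0 + w * dslope f 0 w := by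
    ext w
    have := sub_smul_dslope f 0 w
    rw [sub_zero, smul_eq_mul] at this
    rw [this]
    ring
  by_cases h : z = a
  · subst h
    rw [dslope_same, dslope_same]
    have hd := ((hasDerivAt_id z).mul hf.hasDerivAt).const_add (f 0)
    conv_lhs => rw [h0]
    refine (hd.deriv).trans ?_
    simp
  · have hne : z - a ≠ 0 := sub_ne_zero.mpr h
    rw [dslope_of_ne _ h, dslope_of_ne _ h, slope_def_field, slope_def_field]
    conv_lhs => rw [h0]
    field_simp
    ring

/-- The Schwarz lemma on the ball of radius R/2 about a, on which f - f(a) is bounded by 2C. -/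
theorem norm_dslope_le {f : ℂ → ℂ} {R C : ℝ} (hf : DifferentiableOn ℂ f (ball 0 R))
    (hC : ∀ z ∈ ball (0 : ℂ) (3 * R / 4), ‖f z‖ ≤ C) {a z : ℂ} (ha : ‖a‖ < R / 4)
    (hz : z ∈ ball (0 : ℂ) (R / 4)) : ‖dslope f a z‖ ≤ 4 * C / R := by
  have hsub : ball a (R / 2) ⊆ ball (0 : ℂ) (3 * R / 4) := by
    refine ball_subset_ball' ?_
    rw [dist_zero_right]
    linarith
  have hR : 0 < R := by
    have := norm_nonneg a
    linarith
  have hz' : z ∈ ball a (R / 2) := by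
    rw [mem_ball_zero_iff] at hz
    rw [mem_ball, dist_eq_norm]
    have := norm_sub_le z a
    linarith
  have := Complex.norm_dslope_le_div_of_mapsTo_ball (R₂ := 2 * C)
    (hf.mono (hsub.trans (ball_subset_ball (by linarith)))) (fun w hw => ?_) hz'
  · refine this.trans (le_of_eq ?_)
    field_simp
    ring
  · rw [mem_closedBall, dist_eq_norm]
    have h1 := hC w (hsub hw)
    have h2 := hC a (hsub (mem_ball_self (by linarith)))
    have := norm_sub_le (f w) (f a)
    linarith

/-- The error splits into the slope of G_i - G₀ at a_i, controlled by uniform convergence, and a_i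
times a bounded slope of `dslope G₀ 0`, from moving the base point to 0. The ball shrinks so that
the Schwarz estimate applies about a_i. -/
theorem tendstoUniformlyOn_dslope {ι : Type*} {l : Filter ι} {G : ι → ℂ → ℂ} {G₀ : ℂ → ℂ} {R : ℝ}
    (hR : 0 < R) (hG : ∀ᶠ i in l, DifferentiableOn ℂ (G i) (ball 0 R))
    (hG₀ : DifferentiableOn ℂ G₀ (ball 0 R)) (h : TendstoUniformlyOn G G₀ l (ball 0 R)) {a : ι → ℂ}
    (ha : Tendsto a l (𝓝 0)) :
    (∀ᶠ i in l, DifferentiableOn ℂ (dslope (G i) (a i)) (ball 0 (R / 4))) ∧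
    DifferentiableOn ℂ (dslope G₀ 0) (ball 0 (R / 4)) ∧
    TendstoUniformlyOn (fun i => dslope (G i) (a i)) (dslope G₀ 0) l (ball 0 (R / 4)) := by
  have hsub : ball (0 : ℂ) (R / 4) ⊆ ball 0 R := ball_subset_ball (by linarith)
  have hK : DifferentiableOn ℂ (dslope G₀ 0) (ball 0 R) :=
    (Complex.differentiableOn_dslope (ball_mem_nhds _ hR)).mpr hG₀
  have hae : ∀ᶠ i in l, ‖a i‖ < R / 4 := by
    have := ha.norm
    rw [norm_zero] at this
    exact this.eventually (gt_mem_nhds (by linarith))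
  refine ⟨?_, hK.mono hsub, ?_⟩
  · filter_upwards [hG, hae] with i hi hai
    refine ((Complex.differentiableOn_dslope (isOpen_ball.mem_nhds ?_)).mpr hi).mono hsub
    rw [mem_ball_zero_iff]
    linarith
  · obtain ⟨C, hC⟩ := (isCompact_closedBall (0 : ℂ) (3 * R / 4)).exists_bound_of_continuousOn
      (hK.continuousOn.mono (closedBall_subset_ball (by linarith)))
    have hC0 : 0 ≤ C := (norm_nonneg _).trans (hC 0 (mem_closedBall_self (by linarith)))
    rw [Metric.tendstoUniformlyOn_iff] at h ⊢
    intro η hη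
    -- The constant makes the first error at most η/4 after the factor 4/R of `norm_dslope_le`; the
    -- second is kept below η/2.
    have h1 := h (η * R / 16) (by positivity)
    have h2 : ∀ᶠ i in l, ‖a i‖ * (4 * C / R) < η / 2 := by
      have h3 : Tendsto (fun i => ‖a i‖ * (4 * C / R)) l (𝓝 0) := by
        simpa using ha.norm.mul_const (4 * C / R)
      exact h3.eventually (gt_mem_nhds (by linarith))
    filter_upwards [hG, hae, h1, h2] with i hi hai h1i h2i z hz
    have hai' : ball (0 : ℂ) R ∈ 𝓝 (a i) := by
      refine isOpen_ball.mem_nhds ?_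
      rw [mem_ball_zero_iff]
      linarith
    have e1 := dslope_fun_sub (hi.differentiableAt hai') (hG₀.differentiableAt hai') z
    have e2 := dslope_eq_add_mul_dslope (hK.differentiableAt hai') z
    have b1 : ‖dslope (fun w => G i w - G₀ w) (a i) z‖ ≤ 4 * (η * R / 16) / R := by
      refine norm_dslope_le (hi.sub hG₀) (fun w hw => ?_) hai hz
      have := h1i w (ball_subset_ball (by linarith) hw)
      rw [dist_comm, dist_eq_norm] at this
      exact this.le
    have b2 : ‖dslope (dslope G₀ 0) (a i) z‖ ≤ 4 * C / R :=
      norm_dslope_le hK (fun w hw => hC w (ball_subset_closedBall hw)) hai hz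
    rw [dist_comm, dist_eq_norm]
    have e3 : dslope (G i) (a i) z - dslope G₀ 0 z
        = dslope (fun w => G i w - G₀ w) (a i) z + a i * dslope (dslope G₀ 0) (a i) z := by
      rw [e1, e2]
      ring
    rw [e3]
    have e4 : 4 * (η * R / 16) / R = η / 4 := by
      field_simp
      ring
    calc _ ≤ ‖dslope (fun w => G i w - G₀ w) (a i) z‖ + ‖a i * dslope (dslope G₀ 0) (a i) z‖ :=
          norm_add_le _ _
      _ ≤ η / 4 + ‖a i‖ * (4 * C / R) := by
          rw [norm_mul]
          exact add_le_add (b1.trans e4.le) (mul_le_mul_of_nonneg_left b2 (norm_nonneg _))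
      _ < η := by linarith

/-- The Newton remainders of a function at a sequence of nodes. -/
noncomputable def newton (f : ℂ → ℂ) (μ : ℕ → ℂ) : ℕ → ℂ → ℂ
  | 0 => f
  | j + 1 => dslope (newton f μ j) (μ j)

/-- Newton's interpolation formula with remainder. -/
theorem newton_expansion (f : ℂ → ℂ) (μ : ℕ → ℂ) (m : ℕ) (z : ℂ) :
    f z = ∑ j ∈ Finset.range m, (∏ i ∈ Finset.range j, (z - μ i)) * newton f μ j (μ j)
      + (∏ i ∈ Finset.range m, (z - μ i)) * newton f μ m z := by
  induction m with
  | zero => simp [newton]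
  | succ m ih =>
    have := sub_smul_dslope (newton f μ m) (μ m) z
    rw [smul_eq_mul] at this
    rw [ih, Finset.sum_range_succ, Finset.prod_range_succ, newton]
    linear_combination (-∏ i ∈ Finset.range m, (z - μ i)) * this

theorem newton_expansion_node (f : ℂ → ℂ) (μ : ℕ → ℂ) {m a : ℕ} (ha : a < m) :
    f (μ a) = ∑ j ∈ Finset.range m,
      (∏ i ∈ Finset.range j, (μ a - μ i)) * newton f μ j (μ j) := by
  have h := newton_expansion f μ m (μ a)
  rwa [Finset.prod_eq_zero (Finset.mem_range.mpr ha) (sub_self _), zero_mul, add_zero] at h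

/-- Divided differences converge to Taylor coefficients as the nodes coalesce. -/
theorem tendsto_newton {ι : Type*} {l : Filter ι} {f : ℂ → ℂ} (hf : AnalyticAt ℂ f 0)
    {μ : ι → ℕ → ℂ} (hμ : ∀ j, Tendsto (fun i => μ i j) l (𝓝 0)) (j : ℕ) :
    Tendsto (fun i => newton f (μ i) j (μ i j)) l (𝓝 (iteratedDeriv j f 0 / j.factorial)) := by
  -- The induction carries uniform convergence of the whole remainder to the iterated slope at 0,
  -- since the next divided difference uses its values at a moving node.
  have key : ∃ R > 0, (∀ᶠ i in l, DifferentiableOn ℂ (newton f (μ i) j) (ball 0 R)) ∧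
      DifferentiableOn ℂ ((Function.swap dslope 0)^[j] f) (ball 0 R) ∧
      TendstoUniformlyOn (fun i => newton f (μ i) j) ((Function.swap dslope 0)^[j] f) l
        (ball 0 R) := by
    induction j with
    | zero =>
      obtain ⟨R, hR, hd⟩ := Metric.eventually_nhds_iff_ball.mp hf.eventually_analyticAt
      refine ⟨R, hR, Eventually.of_forall fun i => ?_, ?_, ?_⟩
      · exact fun z hz => (hd z hz).differentiableAt.differentiableWithinAt
      · exact fun z hz => (hd z hz).differentiableAt.differentiableWithinAt
      · rw [Metric.tendstoUniformlyOn_iff]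
        intro η hη
        refine Eventually.of_forall fun i z _ => ?_
        simpa [newton] using hη
    | succ j ih =>
      obtain ⟨R, hR, h1, h2, h3⟩ := ih
      refine ⟨R / 4, by positivity, ?_⟩
      rw [Function.iterate_succ_apply']
      exact tendstoUniformlyOn_dslope hR h1 h2 h3 (hμ j)
  obtain ⟨R, hR, -, h2, h3⟩ := key
  have hval : ((Function.swap dslope 0)^[j] f) 0 = iteratedDeriv j f 0 / j.factorial := by
    have hp := hf.hasFPowerSeriesAt.has_fpower_series_iterate_dslope_fslope j
    rw [← hp.coeff_zero 1, ← FormalMultilinearSeries.coeff,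
      FormalMultilinearSeries.coeff_iterate_fslope, FormalMultilinearSeries.coeff_ofScalars,
      zero_add]
  rw [← hval]
  have hc : ContinuousAt ((Function.swap dslope 0)^[j] f) 0 :=
    (h2.differentiableAt (ball_mem_nhds _ hR)).continuousAt
  have h4 := hc.tendsto.comp (hμ j)
  rw [Metric.tendsto_nhds] at h4 ⊢
  rw [Metric.tendstoUniformlyOn_iff] at h3
  intro η hη
  filter_upwards [h4 (η / 2) (by linarith), h3 (η / 2) (by linarith),
    (hμ j).eventually (ball_mem_nhds 0 hR)] with i h5 h6 h7
  have h8 := h6 _ h7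
  rw [dist_comm] at h8
  have := dist_triangle (newton f (μ i) j (μ i j)) ((Function.swap dslope 0)^[j] f (μ i j))
    ((Function.swap dslope 0)^[j] f 0)
  simp only [Function.comp_apply] at h5
  linarith

/-- An odd analytic function is `ε H(ε ^ 2)`. -/
theorem exists_eq_mul_sq {φ : ℂ → ℂ} (hφ : AnalyticAt ℂ φ 0)
    (hodd : ∀ᶠ ε in 𝓝 (0 : ℂ), φ (-ε) = -φ ε) :
    ∃ H : ℂ → ℂ, AnalyticAt ℂ H 0 ∧ (∀ᶠ ε in 𝓝 (0 : ℂ), φ ε = ε * H (ε ^ 2)) ∧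
      ∀ m, iteratedDeriv m H 0 / m.factorial
        = iteratedDeriv (2 * m + 1) φ 0 / (2 * m + 1).factorial := by
  set c : ℕ → ℂ := fun n => iteratedDeriv n φ 0 / n.factorial with hc
  have heven : ∀ m, c (2 * m) = 0 := by
    intro m
    have h1 := Filter.EventuallyEq.iteratedDeriv_eq (2 * m) hodd
    rw [iteratedDeriv_comp_neg] at h1
    have h2 : iteratedDeriv (2 * m) (fun ε => -φ ε) 0 = -iteratedDeriv (2 * m) φ 0 :=
      iteratedDeriv_fun_neg _ _ _
    rw [h2, neg_zero, pow_mul] at h1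
    simp only [neg_one_sq, one_pow, one_smul] at h1
    have h3 : iteratedDeriv (2 * m) φ 0 = 0 := by linear_combination h1 / 2
    simp [hc, h3]
  have hp := hφ.hasFPowerSeriesAt
  obtain ⟨r, hr⟩ := hp
  set q := FormalMultilinearSeries.ofScalars ℂ (fun m => c (2 * m + 1)) with hq
  obtain ⟨ρ, hρ0, hρ⟩ : ∃ ρ : NNReal, 0 < ρ ∧ (ρ : ENNReal) < r := by
    obtain ⟨ρ, h1, h2⟩ := ENNReal.lt_iff_exists_nnreal_btwn.mp hr.r_pos
    exact ⟨ρ, by exact_mod_cast h1, h2⟩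
  obtain ⟨C, hC0, hC⟩ := FormalMultilinearSeries.norm_mul_pow_le_of_lt_radius _
    (hρ.trans_le hr.r_le)
  -- The bound C on ‖c(2m+1)‖ρ^(2m+1) bounds ‖c(2m+1)‖(ρ²)^m by C/ρ, so the series in ε² converges
  -- wherever |ε| < ρ.
  have hqr : ((ρ ^ 2 : NNReal) : ENNReal) ≤ q.radius := by
    refine q.le_radius_of_bound (C / ρ) fun m => ?_
    have := hC (2 * m + 1)
    rw [FormalMultilinearSeries.ofScalars_norm] at this ⊢
    rw [le_div_iff₀ (by exact_mod_cast hρ0)]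
    calc _ = ‖c (2 * m + 1)‖ * (ρ : ℝ) ^ (2 * m + 1) := by push_cast; ring
      _ ≤ C := this
  have hq0 : 0 < q.radius := lt_of_lt_of_le (by exact_mod_cast pow_pos hρ0 2) hqr
  have hH := q.hasFPowerSeriesOnBall hq0
  refine ⟨q.sum, hH.analyticAt, ?_, ?_⟩
  · have hb : ball (0 : ℂ) ρ ∈ 𝓝 (0 : ℂ) := ball_mem_nhds _ (by exact_mod_cast hρ0)
    filter_upwards [hb] with ε hε
    rw [mem_ball_zero_iff] at hε
    have hε' : ‖ε‖₊ < ρ := by exact_mod_cast hε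
    have s1 := hr.hasSum (y := ε) (by
      rw [Metric.mem_eball, edist_zero_right]
      refine lt_trans ?_ hρ
      exact_mod_cast hε')
    have s2 := hH.hasSum (y := ε ^ 2) (by
      rw [Metric.mem_eball, edist_zero_right]
      refine lt_of_lt_of_le ?_ hqr
      rw [enorm_pow]
      have : ‖ε‖₊ ^ 2 < ρ ^ 2 := pow_lt_pow_left₀ hε' zero_le two_ne_zero
      rw [enorm_eq_nnnorm, ← ENNReal.coe_pow]
      exact ENNReal.coe_lt_coe.mpr this)
    simp only [FormalMultilinearSeries.ofScalars_apply_eq, hq, zero_add, smul_eq_mul] at s1 s2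
    have s3 := s2.mul_left ε
    have hinj : Function.Injective fun m : ℕ => 2 * m + 1 := fun a b h => by
      simp only at h; omega
    have s4 := (hinj.hasSum_iff (f := fun n => c n * ε ^ n) (a := φ ε) (by
      intro n hn
      have : Even n := by
        by_contra h
        rw [Nat.not_even_iff_odd] at h
        obtain ⟨m, hm⟩ := h
        exact hn ⟨m, hm.symm⟩
      obtain ⟨m, rfl⟩ := this
      rw [← two_mul, heven, zero_mul])).mpr s1
    have e : (fun n => c n * ε ^ n) ∘ (fun m : ℕ => 2 * m + 1)
        = fun m => ε * (c (2 * m + 1) * (ε ^ 2) ^ m) := by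
      funext m
      rw [Function.comp_apply]
      ring
    rw [e] at s4
    exact s4.unique s3
  · intro m
    have h1 := hH.hasFPowerSeriesAt.has_fpower_series_iterate_dslope_fslope m
    have h2 := (hH.analyticAt.hasFPowerSeriesAt).has_fpower_series_iterate_dslope_fslope m
    have h3 := (h1.coeff_zero 1).trans (h2.coeff_zero 1).symm
    rw [← FormalMultilinearSeries.coeff, ← FormalMultilinearSeries.coeff,
      FormalMultilinearSeries.coeff_iterate_fslope, FormalMultilinearSeries.coeff_iterate_fslope,
      FormalMultilinearSeries.coeff_ofScalars, FormalMultilinearSeries.coeff_ofScalars, zero_add] at h3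
    exact h3.symm

end

/-! ### Factorisation of the paired matrices through a common triangular matrix. -/

section

section
variable {k : ℕ}

/-- Matrices whose rows come in pairs, evaluated at the parameters `ε_j`, the second row of each
pair being conjugated. -/
noncomputable def pairMat (φ χ : Fin (2 * k) → ℂ → ℂ) (ε : Fin k → ℂ) : Matrix (Fin (2 * k)) (Fin (2 * k)) ℂ :=
  Matrix.of fun i j =>
    if Even (i : ℕ) then φ j (ε (DNLSII.pair i)) else star (χ j (ε (DNLSII.pair i)))

/-- The odd Taylor coefficients of the rows of `pairMat`. -/
noncomputable def oddCoeffMat (φ χ : Fin (2 * k) → ℂ → ℂ) : Matrix (Fin (2 * k)) (Fin (2 * k)) ℂ :=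
  Matrix.of fun i j =>
    if Even (i : ℕ)
    then iteratedDeriv (2 * ((i : ℕ) / 2) + 1) (φ j) 0 / (2 * ((i : ℕ) / 2) + 1).factorial
    else star (iteratedDeriv (2 * ((i : ℕ) / 2) + 1) (χ j) 0 / (2 * ((i : ℕ) / 2) + 1).factorial)

/-- The squares of the parameters as a sequence of nodes. -/
noncomputable def nodes (ε : Fin k → ℂ) (m : ℕ) : ℂ := if h : m < k then ε ⟨m, h⟩ ^ 2 else 0

theorem nodes_pair (ε : Fin k → ℂ) (i : Fin (2 * k)) :
    nodes ε ((i : ℕ) / 2) = ε (DNLSII.pair i) ^ 2 := by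
  rw [nodes, dif_pos (by omega)]
  rfl

/-- The coefficients of the Newton expansion at the nodes. -/
noncomputable def nodeCoeff (κ : ℂ → ℂ) (ε : Fin k → ℂ) (i : Fin (2 * k)) (b : ℕ) : ℂ :=
  2 * ε (DNLSII.pair i) / (1 - κ (ε (DNLSII.pair i)))
    * ∏ m ∈ Finset.range b, (nodes ε ((i : ℕ) / 2) - nodes ε m)

/-- The triangular matrix of Newton coefficients. -/
noncomputable def nodeMat (κ : ℂ → ℂ) (ε : Fin k → ℂ) : Matrix (Fin (2 * k)) (Fin (2 * k)) ℂ :=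
  Matrix.of fun i j =>
    if Even (i : ℕ) then (if Even (j : ℕ) then nodeCoeff κ ε i ((j : ℕ) / 2) else 0)
    else (if Even (j : ℕ) then 0 else star (nodeCoeff κ ε i ((j : ℕ) / 2)))

theorem sum_even_positions (g : ℕ → ℂ) :
    (∑ j : Fin (2 * k), if Even (j : ℕ) then g ((j : ℕ) / 2) else 0) = ∑ b ∈ Finset.range k, g b := by
  rw [Fin.sum_univ_eq_sum_range (fun j => if Even j then g (j / 2) else 0) (2 * k)]
  induction k with
  | zero => simp
  | succ k ih =>
    rw [mul_add, mul_one, Finset.sum_range_succ, Finset.sum_range_succ, ih, Finset.sum_range_succ]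
    simp

theorem sum_odd_positions (g : ℕ → ℂ) :
    (∑ j : Fin (2 * k), if Even (j : ℕ) then 0 else g ((j : ℕ) / 2)) = ∑ b ∈ Finset.range k, g b := by
  rw [Fin.sum_univ_eq_sum_range (fun j => if Even j then 0 else g (j / 2)) (2 * k)]
  induction k with
  | zero => simp
  | succ k ih =>
    rw [mul_add, mul_one, Finset.sum_range_succ, Finset.sum_range_succ, ih, Finset.sum_range_succ]
    have : (2 * k + 1) / 2 = k := by omega
    simp [this]

theorem tendsto_degeneration_apply (j : Fin k) :
    Tendsto (fun ε : Fin k → ℂ => ε j) (DNLSII.degeneration k) (𝓝 0) :=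
  ((continuous_apply j).tendsto 0).mono_left nhdsWithin_le_nhds

theorem tendsto_nodes (m : ℕ) :
    Tendsto (fun ε : Fin k → ℂ => nodes ε m) (DNLSII.degeneration k) (𝓝 0) := by
  by_cases h : m < k
  · have := (tendsto_degeneration_apply (⟨m, h⟩ : Fin k)).pow 2
    simpa [nodes, h] using this
  -- Beyond the k parameters the nodes have the default value 0, so all of them tend to 0, as
  -- `tendsto_newton` requires.
  · simpa [nodes, h] using tendsto_const_nhds

theorem eventually_degeneration_forall {P : ℂ → Prop} (h : ∀ᶠ ε in 𝓝 (0 : ℂ), P ε) :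
    ∀ᶠ ε in DNLSII.degeneration k, ∀ j, P (ε j) :=
  eventually_all.mpr fun j => (tendsto_degeneration_apply j).eventually h

/-- The product of node differences vanishes above the diagonal. On the diagonal it is nonzero
because the ε_j² are distinct, and the prefactor is nonzero because ε_j ≠ 0. -/
theorem eventually_det_nodeMat_ne_zero {κ : ℂ → ℂ} (hκ : Tendsto κ (𝓝 0) (𝓝 (-1))) :
    ∀ᶠ ε in DNLSII.degeneration k, (nodeMat κ ε).det ≠ 0 := by
  have h1 : ∀ᶠ ε in 𝓝 (0 : ℂ), κ ε ≠ 1 := hκ.eventually_ne (by norm_num)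
  filter_upwards [eventually_degeneration_forall h1, self_mem_nhdsWithin] with ε hε hmem
  have hnode : ∀ (i : Fin (2 * k)) (m : ℕ), m < (i : ℕ) / 2 →
      nodes ε ((i : ℕ) / 2) - nodes ε m ≠ 0 := by
    intro i m hm h
    have hlt : m < k := by omega
    rw [nodes_pair, nodes, dif_pos hlt, sub_eq_zero] at h
    have h2 := congrArg Fin.val (hmem.2 h)
    simp only [DNLSII.pair] at h2
    omega
  have hD : ∀ i : Fin (2 * k), nodeCoeff κ ε i ((i : ℕ) / 2) ≠ 0 := fun i =>
    mul_ne_zero (div_ne_zero (mul_ne_zero two_ne_zero (hmem.1 _))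
      (sub_ne_zero.mpr (hε _).symm))
      (Finset.prod_ne_zero_iff.mpr fun m hm => hnode i m (Finset.mem_range.mp hm))
  rw [Matrix.det_of_isLowerTriangular]
  · refine Finset.prod_ne_zero_iff.mpr fun i _ => ?_
    rw [nodeMat, Matrix.of_apply]
    split_ifs
    · exact hD i
    · exact star_ne_zero.mpr (hD i)
  · intro i j hij
    have hij : (i : ℕ) < j := hij
    have hz : (Even (i : ℕ) ↔ Even (j : ℕ)) → nodeCoeff κ ε i ((j : ℕ) / 2) = 0 := by
      intro hp
      have hlt : (i : ℕ) / 2 < (j : ℕ) / 2 := by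
        rw [Nat.even_iff, Nat.even_iff] at hp
        omega
      rw [nodeCoeff, Finset.prod_eq_zero (Finset.mem_range.mpr hlt) (sub_self _), mul_zero]
    rw [nodeMat, Matrix.of_apply]
    split_ifs with h2 h3 h3
    · exact hz (by simp [h2, h3])
    · rfl
    · rfl
    · rw [hz (by simp [h2, h3]), star_zero]

/-- A matrix of paired rows is, near the degeneration, the product of the matrix of Newton
coefficients, which depends only on `κ`, and a matrix converging to the odd Taylor coefficients. -/
theorem exists_pairMat_eq_nodeMat_mul {κ : ℂ → ℂ} (hκ : Tendsto κ (𝓝 0) (𝓝 (-1)))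
    {φ χ : Fin (2 * k) → ℂ → ℂ} (hφ : ∀ j, AnalyticAt ℂ (φ j) 0)
    (hφκ : ∀ j, ∀ᶠ ε in 𝓝 (0 : ℂ), φ j (-ε) = κ ε * φ j ε) (hχ : ∀ j, AnalyticAt ℂ (χ j) 0)
    (hχκ : ∀ j, ∀ᶠ ε in 𝓝 (0 : ℂ), χ j (-ε) = κ ε * χ j ε) :
    ∃ Y : (Fin k → ℂ) → Matrix (Fin (2 * k)) (Fin (2 * k)) ℂ,
      (∀ᶠ ε in DNLSII.degeneration k, pairMat φ χ ε = nodeMat κ ε * Y ε) ∧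
      Tendsto Y (DNLSII.degeneration k) (𝓝 (oddCoeffMat φ χ)) := by
  have h1 : ∀ᶠ ε in 𝓝 (0 : ℂ), κ ε ≠ 1 := hκ.eventually_ne (by norm_num)
  -- The odd part of f is (1 - κ)f/2, so f is recovered from it by a factor that does not depend on
  -- f.
  have key : ∀ f : ℂ → ℂ, AnalyticAt ℂ f 0 → (∀ᶠ ε in 𝓝 (0 : ℂ), f (-ε) = κ ε * f ε) →
      ∃ H : ℂ → ℂ, AnalyticAt ℂ H 0 ∧
        (∀ᶠ ε in 𝓝 (0 : ℂ), f ε = 2 * ε / (1 - κ ε) * H (ε ^ 2)) ∧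
        ∀ m, iteratedDeriv m H 0 / m.factorial
          = iteratedDeriv (2 * m + 1) f 0 / (2 * m + 1).factorial := by
    intro f hf hfκ
    have hfn : AnalyticAt ℂ (fun ε => f (-ε)) 0 := by
      refine AnalyticAt.fun_comp (g := f) ?_ (analyticAt_id.neg)
      simpa using hf
    obtain ⟨H, hH, hH1, hH2⟩ := exists_eq_mul_sq (φ := fun ε => (f ε - f (-ε)) / 2)
      ((hf.sub hfn).div_const) (Eventually.of_forall fun ε => by simp only [neg_neg]; ring)
    refine ⟨H, hH, ?_, fun m => ?_⟩
    · filter_upwards [hH1, hfκ, h1] with ε e1 e2 e3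
      rw [e2] at e1
      have : 1 - κ ε ≠ 0 := sub_ne_zero.mpr e3.symm
      rw [div_mul_eq_mul_div, eq_div_iff this]
      linear_combination 2 * e1
    · rw [hH2]
      congr 1
      have e1 : (fun ε => (f ε - f (-ε)) / 2) = fun ε => (1 / 2 : ℂ) * (f ε - f (-ε)) := by
        funext ε; ring
      rw [e1, iteratedDeriv_const_mul_field, iteratedDeriv_fun_sub hf.contDiffAt hfn.contDiffAt,
        iteratedDeriv_comp_neg]
      rw [pow_succ, pow_mul]
      simp
      ring
  choose Hφ hHφ hφ1 hφ2 using fun j => key (φ j) (hφ j) (hφκ j)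
  choose Hχ hHχ hχ1 hχ2 using fun j => key (χ j) (hχ j) (hχκ j)
  refine ⟨fun ε => Matrix.of fun i j =>
    if Even (i : ℕ) then newton (Hφ j) (nodes ε) ((i : ℕ) / 2) (nodes ε ((i : ℕ) / 2))
    else star (newton (Hχ j) (nodes ε) ((i : ℕ) / 2) (nodes ε ((i : ℕ) / 2))), ?_, ?_⟩
  · filter_upwards [eventually_degeneration_forall (eventually_all.mpr hφ1),
      eventually_degeneration_forall (eventually_all.mpr hχ1)] with ε e1 e2
    ext i j
    have hexp : ∀ H : ℂ → ℂ, 2 * ε (DNLSII.pair i) / (1 - κ (ε (DNLSII.pair i)))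
        * H (ε (DNLSII.pair i) ^ 2)
        = ∑ b ∈ Finset.range k, nodeCoeff κ ε i b * newton H (nodes ε) b (nodes ε b) := by
      intro H
      rw [← nodes_pair, newton_expansion_node H (nodes ε) (m := k) (a := (i : ℕ) / 2) (by omega),
        Finset.mul_sum]
      exact Finset.sum_congr rfl fun b _ => by rw [nodeCoeff]; ring
    rw [Matrix.mul_apply, pairMat, Matrix.of_apply]
    by_cases h : Even (i : ℕ)
    · rw [if_pos h, e1, hexp, ← sum_even_positions]
      refine Finset.sum_congr rfl fun b _ => ?_
      simp only [nodeMat, Matrix.of_apply, if_pos h]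
      split_ifs <;> simp
    · rw [if_neg h, e2, hexp, star_sum, ← sum_odd_positions]
      refine Finset.sum_congr rfl fun b _ => ?_
      simp only [nodeMat, Matrix.of_apply, if_neg h]
      split_ifs
      · simp
      · rw [star_mul']
  · refine tendsto_pi_nhds.mpr fun i => tendsto_pi_nhds.mpr fun j => ?_
    simp only [oddCoeffMat, Matrix.of_apply]
    split_ifs
    · rw [← hφ2]
      exact tendsto_newton (hHφ j) tendsto_nodes _
    · rw [← hχ2]
      exact (continuous_star.tendsto _).comp (tendsto_newton (hHχ j) tendsto_nodes _)

end

end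

/-! ### Taylor series in ε with smooth coefficients, and their odd parts. -/

section
open scoped ContDiff

/-- The Taylor series at the origin of a function of a real variable. -/
noncomputable def taylorSeries (g : ℝ → ℂ) : PowerSeries ℂ :=
  PowerSeries.mk fun m => iteratedDeriv m g 0 / m.factorial

theorem coeff_taylorSeries (g : ℝ → ℂ) (m : ℕ) :
    PowerSeries.coeff m (taylorSeries g) = iteratedDeriv m g 0 / m.factorial := by
  simp [taylorSeries]

theorem taylorSeries_congr {f g : ℝ → ℂ} (h : f =ᶠ[𝓝 0] g) : taylorSeries f = taylorSeries g := by
  ext m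
  rw [coeff_taylorSeries, coeff_taylorSeries, h.iteratedDeriv_eq]

theorem taylorSeries_add {f g : ℝ → ℂ} (hf : AnalyticAt ℝ f 0) (hg : AnalyticAt ℝ g 0) :
    taylorSeries (fun x => f x + g x) = taylorSeries f + taylorSeries g := by
  ext m
  rw [map_add, coeff_taylorSeries, coeff_taylorSeries, coeff_taylorSeries,
    iteratedDeriv_fun_add hf.contDiffAt hg.contDiffAt, add_div]

theorem taylorSeries_mul {f g : ℝ → ℂ} (hf : AnalyticAt ℝ f 0) (hg : AnalyticAt ℝ g 0) :
    taylorSeries (fun x => f x * g x) = taylorSeries f * taylorSeries g := by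
  ext m
  rw [PowerSeries.coeff_mul, coeff_taylorSeries,
    iteratedDeriv_fun_mul hf.contDiffAt hg.contDiffAt,
    Finset.Nat.sum_antidiagonal_eq_sum_range_succ_mk, Finset.sum_div]
  refine Finset.sum_congr rfl fun i hi => ?_
  have hi : i ≤ m := Nat.lt_succ_iff.mp (Finset.mem_range.mp hi)
  rw [coeff_taylorSeries, coeff_taylorSeries, Nat.cast_choose ℂ hi]
  have h1 : (m.factorial : ℂ) ≠ 0 := Nat.cast_ne_zero.mpr (Nat.factorial_ne_zero _)
  have h2 : (i.factorial : ℂ) ≠ 0 := Nat.cast_ne_zero.mpr (Nat.factorial_ne_zero _)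
  have h3 : ((m - i).factorial : ℂ) ≠ 0 := Nat.cast_ne_zero.mpr (Nat.factorial_ne_zero _)
  field_simp

theorem taylorSeries_const (c : ℂ) : taylorSeries (fun _ => c) = PowerSeries.C c := by
  ext m
  rw [coeff_taylorSeries, iteratedDeriv_const, PowerSeries.coeff_C]
  split_ifs with h
  · simp [h]
  · simp

theorem taylorSeries_ofReal : taylorSeries (fun x => (x : ℂ)) = PowerSeries.X := by
  ext m
  rw [coeff_taylorSeries, PowerSeries.coeff_X]
  rcases m with _ | m
  · simp
  · rw [iteratedDeriv_succ']
    have : deriv (fun x : ℝ => (x : ℂ)) = fun _ => 1 := by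
      funext x
      exact Complex.ofRealCLM.hasDerivAt.deriv
    rw [this, iteratedDeriv_const]
    rcases m with _ | m <;> simp

/-- Joint analyticity at `ε = 0` of a function of `ε` and a point of the plane. -/
def JointAn (G : ℝ → ℝ × ℝ → ℂ) : Prop :=
  ∀ p, AnalyticAt ℝ (fun z : ℝ × ℝ × ℝ => G z.1 z.2) (0, p)

/-- The derivative of a function of `ε` and a point in a fixed joint direction. -/
noncomputable def jointDeriv (w : ℝ × ℝ × ℝ) (G : ℝ → ℝ × ℝ → ℂ) (ε : ℝ) (p : ℝ × ℝ) : ℂ :=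
  fderiv ℝ (fun z : ℝ × ℝ × ℝ => G z.1 z.2) (ε, p) w

namespace JointAn

variable {G : ℝ → ℝ × ℝ → ℂ}

theorem jointDeriv (hG : JointAn G) (w : ℝ × ℝ × ℝ) : JointAn (jointDeriv w G) := fun p =>
  ((ContinuousLinearMap.apply ℝ ℂ w).analyticAt _).comp (hG p).fderiv

theorem analyticAt_fst (hG : JointAn G) (p : ℝ × ℝ) : AnalyticAt ℝ (fun ε => G ε p) 0 := by
  have h : AnalyticAt ℝ (fun ε : ℝ => (ε, p)) 0 := analyticAt_id.prod analyticAt_const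
  exact AnalyticAt.fun_comp (g := fun z : ℝ × ℝ × ℝ => G z.1 z.2)
    (f := fun ε : ℝ => (ε, p)) (x := 0) (hG p) h

theorem analyticAt_snd (hG : JointAn G) (p : ℝ × ℝ) : AnalyticAt ℝ (fun p => G 0 p) p := by
  have h : AnalyticAt ℝ (fun p : ℝ × ℝ => ((0 : ℝ), p)) p := analyticAt_const.prod analyticAt_id
  exact AnalyticAt.fun_comp (g := fun z : ℝ × ℝ × ℝ => G z.1 z.2)
    (f := fun p : ℝ × ℝ => ((0 : ℝ), p)) (x := p) (hG p) h

theorem eventually_differentiableAt (hG : JointAn G) (p : ℝ × ℝ) :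
    ∀ᶠ ε in 𝓝 (0 : ℝ), DifferentiableAt ℝ (fun z : ℝ × ℝ × ℝ => G z.1 z.2) (ε, p) := by
  have h : Tendsto (fun ε : ℝ => (ε, p)) (𝓝 0) (𝓝 (0, p)) :=
    (Continuous.prodMk_left p).tendsto 0
  filter_upwards [h.eventually (hG p).eventually_analyticAt] with ε hε
  exact hε.differentiableAt

theorem deriv_eventuallyEq (hG : JointAn G) (p : ℝ × ℝ) :
    deriv (fun ε => G ε p) =ᶠ[𝓝 0] fun ε => _root_.jointDeriv (1, 0) G ε p := by
  filter_upwards [hG.eventually_differentiableAt p] with ε hε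
  have h : HasDerivAt (fun ε : ℝ => (ε, p)) (1, 0) ε :=
    (hasDerivAt_id ε).prodMk (hasDerivAt_const ε p)
  exact (hε.hasFDerivAt.comp_hasDerivAt ε h).deriv

theorem iteratedDeriv_succ_eq (hG : JointAn G) (m : ℕ) (p : ℝ × ℝ) :
    iteratedDeriv (m + 1) (fun ε => G ε p) 0
      = iteratedDeriv m (fun ε => _root_.jointDeriv (1, 0) G ε p) 0 := by
  rw [iteratedDeriv_succ']
  exact (hG.deriv_eventuallyEq p).iteratedDeriv_eq m

theorem analyticAt_iteratedDeriv (hG : JointAn G) (m : ℕ) (p : ℝ × ℝ) :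
    AnalyticAt ℝ (fun p => iteratedDeriv m (fun ε => G ε p) 0) p := by
  induction m generalizing G with
  | zero => simpa using hG.analyticAt_snd p
  | succ m ih =>
    simp only [hG.iteratedDeriv_succ_eq]
    exact ih (hG.jointDeriv _)

/-- Each ε-derivative is moved past the spatial derivative by symmetry of the second derivative, and
joint analyticity is preserved at each step. -/
theorem fderiv_iteratedDeriv (hG : JointAn G) (m : ℕ) (p v : ℝ × ℝ) :
    fderiv ℝ (fun p => iteratedDeriv m (fun ε => G ε p) 0) p v
      = iteratedDeriv m (fun ε => _root_.jointDeriv (0, v) G ε p) 0 := by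
  induction m generalizing G with
  | zero =>
    simp only [iteratedDeriv_zero]
    have h : HasFDerivAt (fun p : ℝ × ℝ => ((0 : ℝ), p)) (ContinuousLinearMap.inr ℝ ℝ (ℝ × ℝ)) p :=
      (ContinuousLinearMap.inr ℝ ℝ (ℝ × ℝ)).hasFDerivAt
    have h2 := ((hG p).differentiableAt.hasFDerivAt (x := ((0 : ℝ), p))).comp p h
    have h3 : (fun p => G 0 p) = (fun z : ℝ × ℝ × ℝ => G z.1 z.2) ∘ fun p => ((0 : ℝ), p) := rfl
    rw [h3, h2.fderiv]
    rfl
  | succ m ih =>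
    simp only [hG.iteratedDeriv_succ_eq, (hG.jointDeriv (0, v)).iteratedDeriv_succ_eq]
    rw [ih (hG.jointDeriv _)]
    refine Filter.EventuallyEq.iteratedDeriv_eq m ?_
    have h : Tendsto (fun ε : ℝ => (ε, p)) (𝓝 0) (𝓝 (0, p)) :=
      (Continuous.prodMk_left p).tendsto 0
    filter_upwards [h.eventually (hG p).eventually_analyticAt] with ε hε
    have hsymm : IsSymmSndFDerivAt ℝ (fun z : ℝ × ℝ × ℝ => G z.1 z.2) (ε, p) :=
      (hε.contDiffAt (n := ω)).isSymmSndFDerivAt (by simp)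
    have key : ∀ w w' : ℝ × ℝ × ℝ, _root_.jointDeriv w (_root_.jointDeriv w' G) ε p
        = fderiv ℝ (fderiv ℝ (fun z : ℝ × ℝ × ℝ => G z.1 z.2)) (ε, p) w w' := by
      intro w w'
      change fderiv ℝ (fun z : ℝ × ℝ × ℝ => fderiv ℝ (fun z : ℝ × ℝ × ℝ => G z.1 z.2) z w') (ε, p) w
        = _
      rw [fderiv_clm_apply hε.fderiv.differentiableAt (differentiableAt_const w')]
      simp
    rw [key, key, hsymm.eq]

/-- The Taylor series in `ε`, with smooth functions on the plane as coefficients. -/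
noncomputable def series (hG : JointAn G) : PowerSeries SmoothFun :=
  PowerSeries.mk fun m =>
    ⟨fun p => iteratedDeriv m (fun ε => G ε p) 0 / m.factorial,
      show ContDiff ℝ ∞ fun p => iteratedDeriv m (fun ε => G ε p) 0 / (m.factorial : ℂ) from
        (contDiff_iff_contDiffAt.mpr fun p =>
          (hG.analyticAt_iteratedDeriv m p).contDiffAt).div_const _⟩

theorem map_eval_series (hG : JointAn G) (p : ℝ × ℝ) :
    PowerSeries.map (SmoothFun.eval p) hG.series = taylorSeries fun ε => G ε p := by
  ext m
  rw [PowerSeries.coeff_map, coeff_taylorSeries, series, PowerSeries.coeff_mk]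
  rfl

/-- Differential equations in (x, t) pass to Taylor coefficients. Validity for ε near 0 suffices,
which is all that a local branch of the square root provides. -/
theorem map_eval_seriesDeriv_series (hG : JointAn G) {G' : ℝ → ℝ × ℝ → ℂ} {v : ℝ × ℝ} {p : ℝ × ℝ}
    (h : ∀ᶠ ε in 𝓝 (0 : ℝ), HasDerivAt (fun r : ℝ => G ε (p + r • v)) (G' ε p) 0) :
    PowerSeries.map (SmoothFun.eval p) (seriesDeriv (SmoothFun.dir v) hG.series)
      = taylorSeries fun ε => G' ε p := by
  have e : (fun ε => _root_.jointDeriv (0, v) G ε p) =ᶠ[𝓝 0] fun ε => G' ε p := by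
    filter_upwards [h, hG.eventually_differentiableAt p] with ε h1 h2
    have h3 : HasDerivAt (fun r : ℝ => (ε, p + r • v)) (0, v) 0 := by
      refine (hasDerivAt_const _ _).prodMk ?_
      simpa using ((hasDerivAt_id (0 : ℝ)).smul_const v).const_add p
    have h2' : HasFDerivAt (fun z : ℝ × ℝ × ℝ => G z.1 z.2)
        (fderiv ℝ (fun z : ℝ × ℝ × ℝ => G z.1 z.2) (ε, p)) (ε, p + (0 : ℝ) • v) := by
      simpa using h2.hasFDerivAt
    have h4 := h2'.comp_hasDerivAt (0 : ℝ) h3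
    exact h4.unique h1
  rw [← taylorSeries_congr e]
  ext m
  rw [PowerSeries.coeff_map, coeff_taylorSeries, coeff_seriesDeriv, ← hG.fderiv_iteratedDeriv,
    series, PowerSeries.coeff_mk]
  change fderiv ℝ (fun p => iteratedDeriv m (fun ε => G ε p) 0 / m.factorial) p v = _
  simp only [div_eq_mul_inv]
  rw [fderiv_mul_const (hG.analyticAt_iteratedDeriv m p).differentiableAt]
  simp [mul_comm]

end JointAn

theorem iteratedDeriv_comp_ofReal {f : ℂ → ℂ} (hf : AnalyticAt ℂ f 0) (m : ℕ) :
    iteratedDeriv m (fun x : ℝ => f x) 0 = iteratedDeriv m f 0 := by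
  induction m generalizing f with
  | zero => simp
  | succ m ih =>
    rw [iteratedDeriv_succ', iteratedDeriv_succ', ← ih hf.deriv]
    refine Filter.EventuallyEq.iteratedDeriv_eq m ?_
    have h : Tendsto (fun x : ℝ => (x : ℂ)) (𝓝 0) (𝓝 0) := by
      simpa using Complex.continuous_ofReal.tendsto 0
    filter_upwards [h.eventually hf.eventually_analyticAt] with x hx
    exact hx.differentiableAt.hasDerivAt.comp_ofReal.deriv

section
variable {R : Type*} [CommRing R]

/-- The odd part of a power series in `ε`, divided by `ε`, as a series in `ε ^ 2`. -/
noncomputable def oddPart (f : PowerSeries R) : PowerSeries R :=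
  PowerSeries.mk fun m => PowerSeries.coeff (2 * m + 1) f

theorem coeff_oddPart (f : PowerSeries R) (m : ℕ) :
    PowerSeries.coeff m (oddPart f) = PowerSeries.coeff (2 * m + 1) f := by
  simp [oddPart]

theorem oddPart_add (f g : PowerSeries R) : oddPart (f + g) = oddPart f + oddPart g := by
  ext; simp [coeff_oddPart]

theorem oddPart_C_mul (a : R) (f : PowerSeries R) :
    oddPart (PowerSeries.C a * f) = PowerSeries.C a * oddPart f := by
  ext; simp [coeff_oddPart]

theorem oddPart_X_sq_mul (f : PowerSeries R) :
    oddPart (PowerSeries.X ^ 2 * f) = PowerSeries.X * oddPart f := by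
  ext m
  rw [coeff_oddPart]
  rcases m with _ | m
  · rw [PowerSeries.coeff_X_pow_mul', if_neg (by omega)]
    simp
  · rw [PowerSeries.coeff_X_pow_mul', if_pos (by omega), PowerSeries.coeff_succ_X_mul, coeff_oddPart]
    congr 1

/-- The eigenvalue l + ε² is even in ε, so multiplication by it acts on the odd part as
multiplication by l + μ with μ = ε². -/
theorem oddPart_pow_mul (l : R) (e : ℕ) (f : PowerSeries R) :
    oddPart ((PowerSeries.C l + PowerSeries.X ^ 2) ^ e * f)
      = (PowerSeries.C l + PowerSeries.X) ^ e * oddPart f := by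
  induction e generalizing f with
  | zero => simp
  | succ e ih =>
    rw [pow_succ, mul_assoc, ih, add_mul, oddPart_add, oddPart_C_mul, oddPart_X_sq_mul]
    ring

theorem map_oddPart {T : Type*} [CommRing T] (ϕ : R →+* T) (f : PowerSeries R) :
    PowerSeries.map ϕ (oddPart f) = oddPart (PowerSeries.map ϕ f) := by
  ext; simp [coeff_oddPart]

theorem seriesDeriv_oddPart (d : Derivation ℤ R R) (f : PowerSeries R) :
    seriesDeriv d (oddPart f) = oddPart (seriesDeriv d f) := by
  ext; simp [coeff_oddPart, coeff_seriesDeriv]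

end

end

/-! ### The branch, the amplitude and the parity of the eigenfunctions. -/

section

namespace DNLSII

section
variable {a c : ℝ} {k : ℕ} {l : Fin k → ℂ} {s : ℂ → ℂ}

/-- The coefficient of the exponential in `psi11` at the eigenvalue `λ_0 + ε ^ 2`. -/
noncomputable def amplitude (a c : ℝ) (s : ℂ → ℂ) (ε : ℂ) : ℂ :=
  (2 * Complex.I * a + 4 * Complex.I * lamEps a c ε ^ 2 - Complex.I * (c : ℂ) ^ 2
    + Complex.I * s ε) / (4 * lamEps a c ε)

/-- The total phase, including the contribution of the free parameters. -/
noncomputable def phase (a c : ℝ) (l : Fin k → ℂ) (s : ℂ → ℂ) (x t : ℝ) (ε : ℂ) : ℂ :=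
  theta a c (lamEps a c ε) (s ε) x t + s ε * ∑ m : Fin k, ε ^ (2 * (m : ℕ)) * l m

/-- Conjugating at -λ* with root s* returns to λ and s, so f is analytic in ε. The free parameters
only add to the phase. -/
theorem eigF_eq (x t : ℝ) (ε : ℂ) : eigF a c l s x t ε
    = amplitude a c s ε * Complex.exp (Complex.I * (rho a c x t / 2 + phase a c l s x t ε))
      + c * Complex.exp (Complex.I * (rho a c x t / 2 - phase a c l s x t ε)) := by
  have h : star (psi12 a c (-star (lamEps a c ε)) (star (s ε)) x t)
      = c * Complex.exp (Complex.I * (rho a c x t / 2 - theta a c (lamEps a c ε) (s ε) x t)) := by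
    simp only [psi12, theta, Complex.star_def, map_mul, map_add, map_sub, map_neg, map_div₀,
      ← Complex.exp_conj, Complex.conj_ofReal, Complex.conj_I, Complex.conj_conj, map_pow,
      map_ofNat, neg_sq]
    congr 2
    ring
  rw [eigF, h, psi11, C1, C2, phase, mul_left_comm, mul_left_comm (Complex.exp _) (c : ℂ),
    ← Complex.exp_add, ← Complex.exp_add, amplitude]
  congr 3 <;> ring

theorem eigG_eq (x t : ℝ) (ε : ℂ) : eigG a c l s x t ε
    = c * Complex.exp (Complex.I * (-(rho a c x t / 2) + phase a c l s x t ε))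
      + amplitude a c s ε
        * Complex.exp (Complex.I * (-(rho a c x t / 2) - phase a c l s x t ε)) := by
  have h : star (psi11 a c (-star (lamEps a c ε)) (star (s ε)) x t)
      = amplitude a c s ε
        * Complex.exp (Complex.I * (-(rho a c x t / 2) - theta a c (lamEps a c ε) (s ε) x t)) := by
    simp only [psi11, theta, amplitude, Complex.star_def, map_mul, map_add, map_sub, map_neg,
      map_div₀, ← Complex.exp_conj, Complex.conj_ofReal, Complex.conj_I, Complex.conj_conj, map_pow,
      map_ofNat, neg_sq]
    congr 1
    · rw [mul_neg (4 : ℂ) (lamEps a c ε), div_neg, ← neg_div]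
      congr 1
      ring
    · congr 1
      ring
  rw [eigG, h, psi12, C1, C2, phase, mul_left_comm,
    mul_left_comm (Complex.exp _) (amplitude a c s ε), ← Complex.exp_add, ← Complex.exp_add]
  congr 3 <;> ring

/-! ### Properties of the branch -/

theorem lam0_re_pos (ha : a < 0) : 0 < (lam0 a c).re := by
  have : 0 < Real.sqrt (-a / 2) := Real.sqrt_pos.mpr (by linarith)
  simpa [lam0] using this

theorem lam0_im_ne_zero (hc : c ≠ 0) : (lam0 a c).im ≠ 0 := by
  simpa [lam0] using hc

theorem lam0_ne_zero (ha : a < 0) : lam0 a c ≠ 0 := by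
  intro h
  have := lam0_re_pos (c := c) ha
  simp [h] at this

theorem lamEps_zero : lamEps a c 0 = lam0 a c := by simp [lamEps]

theorem lamEps_neg (ε : ℂ) : lamEps a c (-ε) = lamEps a c ε := by simp [lamEps]

theorem analyticAt_lamEps (ε : ℂ) : AnalyticAt ℂ (lamEps a c) ε := by
  unfold lamEps
  fun_prop

theorem eventually_lamEps_ne_zero (ha : a < 0) : ∀ᶠ ε in 𝓝 (0 : ℂ), lamEps a c ε ≠ 0 :=
  (analyticAt_lamEps 0).continuousAt.eventually_ne (by rw [lamEps_zero]; exact lam0_ne_zero ha)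

theorem four_mul_lam0_sq (ha : a < 0) :
    2 * a + 4 * lam0 a c ^ 2 - (c : ℂ) ^ 2 = 4 * Complex.I * c * lam0 a c := by
  have hr2 : ((Real.sqrt (-a / 2) : ℝ) : ℂ) ^ 2 = -a / 2 := by
    exact_mod_cast congrArg (fun x : ℝ => (x : ℂ)) (Real.sq_sqrt (by linarith : 0 ≤ -a / 2))
  rw [lam0]
  linear_combination 4 * hr2 - (c : ℂ) ^ 2 * Complex.I_sq

/-- The radicand, even in λ, vanishes at λ_0; the factor ε² is split off so that the cofactor at ε =
0 can be read off. -/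
theorem radicand_lamEps (ha : a < 0) (ε : ℂ) : radicand a c (lamEps a c ε)
    = 16 * ε ^ 2 * ((2 * lam0 a c + ε ^ 2) * (Complex.I * c + ε ^ 2)
      * (2 * (lam0 a c - Complex.I * c / 2) + ε ^ 2)) := by
  have h := four_mul_lam0_sq (c := c) ha
  have h' : (a : ℂ) = (4 * Complex.I * c * lam0 a c - 4 * lam0 a c ^ 2 + (c : ℂ) ^ 2) / 2 := by
    linear_combination h / 2
  rw [radicand, lamEps]
  generalize lam0 a c = L at *
  rw [h']
  have hI := Complex.I_sq
  grind

theorem IsBranch.zero (hs : IsBranch a c s) (ha : a < 0) : s 0 = 0 := by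
  have := hs.2.self_of_nhds
  rw [radicand_lamEps ha] at this
  simpa using this

/-- The square of s/ε tends to 16 · 2λ_0 · ic · 2√(-a/2), which is nonzero. -/
theorem IsBranch.deriv_ne_zero (hs : IsBranch a c s) (ha : a < 0) (hc : c ≠ 0) :
    deriv s 0 ≠ 0 := by
  intro h0
  have hd := hs.1.differentiableAt.hasDerivAt
  rw [hasDerivAt_iff_tendsto_slope, h0] at hd
  have h1 := hd.pow 2
  have h2 : Tendsto (fun ε : ℂ => 16 * ((2 * lam0 a c + ε ^ 2) * (Complex.I * c + ε ^ 2)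
      * (2 * (lam0 a c - Complex.I * c / 2) + ε ^ 2))) (𝓝[≠] 0)
      (𝓝 (16 * ((2 * lam0 a c + 0 ^ 2) * (Complex.I * c + 0 ^ 2)
      * (2 * (lam0 a c - Complex.I * c / 2) + 0 ^ 2)))) := by
    refine Tendsto.mono_left ?_ nhdsWithin_le_nhds
    refine Continuous.tendsto (f := fun ε : ℂ => 16 * ((2 * lam0 a c + ε ^ 2)
      * (Complex.I * c + ε ^ 2) * (2 * (lam0 a c - Complex.I * c / 2) + ε ^ 2))) ?_ 0
    fun_prop
  have h3 : (fun ε => slope s 0 ε ^ 2) =ᶠ[𝓝[≠] 0] fun ε : ℂ => 16 * ((2 * lam0 a c + ε ^ 2)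
      * (Complex.I * c + ε ^ 2) * (2 * (lam0 a c - Complex.I * c / 2) + ε ^ 2)) := by
    filter_upwards [hs.2.filter_mono nhdsWithin_le_nhds, self_mem_nhdsWithin] with ε h4 h5
    have h5 : ε ≠ 0 := h5
    rw [slope_def_field, hs.zero ha, div_pow, sub_zero, sub_zero, h4, radicand_lamEps ha]
    field_simp
  have h6 := tendsto_nhds_unique (h1.congr' h3) h2
  have h7 : lam0 a c - Complex.I * c / 2 ≠ 0 := by
    intro h
    have h8 := congrArg Complex.re h
    have h9 := lam0_re_pos (c := c) ha
    simp at h8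
    linarith
  have h8 : (c : ℂ) ≠ 0 := Complex.ofReal_ne_zero.mpr hc
  have h9 := lam0_ne_zero (c := c) ha
  simp [h7, h8, h9] at h6

/-- The radicand is even in ε, so s(-ε) = ±s(ε) pointwise. By isolation of zeros the sign is
constant near 0, and the plus sign would force s'(0) = 0. -/
theorem IsBranch.odd (hs : IsBranch a c s) (ha : a < 0) (hc : c ≠ 0) :
    ∀ᶠ ε in 𝓝 (0 : ℂ), s (-ε) = -s ε := by
  have hneg : Tendsto (fun ε : ℂ => -ε) (𝓝 0) (𝓝 0) := by
    simpa using (continuous_neg (G := ℂ)).tendsto 0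
  have hsn : AnalyticAt ℂ (fun ε => s (-ε)) 0 :=
    AnalyticAt.fun_comp (g := s) (by simpa using hs.1) analyticAt_id.neg
  have hsq : ∀ᶠ ε in 𝓝 (0 : ℂ), (s ε - s (-ε)) * (s (-ε) + s ε) = 0 := by
    filter_upwards [hs.2, hneg.eventually hs.2] with ε h1 h2
    rw [lamEps_neg, ← h1] at h2
    linear_combination -h2
  rcases (hs.1.sub hsn).eventually_eq_zero_or_eventually_ne_zero with h | h
  · exfalso
    have h1 : s =ᶠ[𝓝 0] fun ε => s (-ε) := h.mono fun ε hε => sub_eq_zero.mp hε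
    have h2 := h1.deriv_eq
    rw [deriv_comp_neg, neg_zero] at h2
    exact hs.deriv_ne_zero ha hc (by linear_combination h2 / 2)
  · have h1 : ∀ᶠ ε in 𝓝[≠] (0 : ℂ), s (-ε) = -s ε := by
      filter_upwards [h, hsq.filter_mono nhdsWithin_le_nhds] with ε h2 h3
      exact eq_neg_of_add_eq_zero_left ((mul_eq_zero.mp h3).resolve_left h2)
    rw [eventually_nhdsWithin_iff] at h1
    filter_upwards [h1] with ε h2
    by_cases h3 : ε = 0
    · simp [h3, hs.zero ha]
    · exact h2 h3

/-! ### Properties of the amplitude -/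

theorem four_mul_amplitude {ε : ℂ} (h : lamEps a c ε ≠ 0) :
    4 * lamEps a c ε * amplitude a c s ε
      = Complex.I * (2 * a + 4 * lamEps a c ε ^ 2 - (c : ℂ) ^ 2 + s ε) := by
  rw [amplitude, mul_div_cancel₀ _ (mul_ne_zero (by norm_num : (4 : ℂ) ≠ 0) h)]
  ring

/-- It rests on s² - (2a + 4λ² - c²)² = 16λ²c². Replacing s by -s in the amplitude thus gives c²
divided by it. -/
theorem amplitude_mul {ε : ℂ} (h : lamEps a c ε ≠ 0)
    (hs : s ε ^ 2 = radicand a c (lamEps a c ε)) :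
    Complex.I * (2 * a + 4 * lamEps a c ε ^ 2 - (c : ℂ) ^ 2 - s ε) * amplitude a c s ε
      = 4 * lamEps a c ε * (c : ℂ) ^ 2 := by
  have h1 := four_mul_amplitude (s := s) h
  refine mul_left_cancel₀ (mul_ne_zero (by norm_num : (4 : ℂ) ≠ 0) h) ?_
  rw [radicand] at hs
  linear_combination Complex.I * (2 * a + 4 * lamEps a c ε ^ 2 - (c : ℂ) ^ 2 - s ε) * h1
    + hs + (2 * a + 4 * lamEps a c ε ^ 2 - (c : ℂ) ^ 2 - s ε)
      * (2 * a + 4 * lamEps a c ε ^ 2 - (c : ℂ) ^ 2 + s ε) * Complex.I_sq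

theorem IsBranch.amplitude_zero (hs : IsBranch a c s) (ha : a < 0) : amplitude a c s 0 = -c := by
  have h1 := lam0_ne_zero (c := c) ha
  have h2 := four_mul_amplitude (s := s) (a := a) (c := c) (ε := 0) (by rwa [lamEps_zero])
  rw [lamEps_zero, hs.zero ha, add_zero, four_mul_lam0_sq ha] at h2
  refine mul_left_cancel₀ (mul_ne_zero (by norm_num : (4 : ℂ) ≠ 0) h1) ?_
  linear_combination h2 + 4 * c * lam0 a c * Complex.I_sq

theorem IsBranch.analyticAt_amplitude (hs : IsBranch a c s) (ha : a < 0) :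
    AnalyticAt ℂ (amplitude a c s) 0 := by
  have h := analyticAt_lamEps (a := a) (c := c) 0
  have h2 := hs.1
  unfold amplitude
  refine AnalyticAt.div (by fun_prop) (by fun_prop) ?_
  rw [lamEps_zero]
  exact mul_ne_zero (by norm_num : (4 : ℂ) ≠ 0) (lam0_ne_zero ha)

theorem IsBranch.deriv_amplitude (hs : IsBranch a c s) (ha : a < 0) :
    deriv (amplitude a c s) 0 = Complex.I * deriv s 0 / (4 * lam0 a c) := by
  have h1 := lam0_ne_zero (c := c) ha
  have h2 := (hs.analyticAt_amplitude ha).differentiableAt.hasDerivAt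
  have h3 : HasDerivAt (lamEps a c) 0 0 := by
    unfold lamEps
    simpa using (hasDerivAt_pow 2 (0 : ℂ)).const_add (lam0 a c)
  have h4 := hs.1.differentiableAt.hasDerivAt
  have h5 : (fun ε => 4 * lamEps a c ε * amplitude a c s ε) =ᶠ[𝓝 0]
      fun ε => Complex.I * (2 * a + 4 * lamEps a c ε ^ 2 - (c : ℂ) ^ 2 + s ε) :=
    (eventually_lamEps_ne_zero ha).mono fun ε h => four_mul_amplitude h
  have h6 := ((h3.const_mul 4).mul h2).congr_of_eventuallyEq h5.symm
  have h7 := (((((h3.pow 2).const_mul 4).const_add (2 * (a : ℂ))).sub_const ((c : ℂ) ^ 2)).add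
    h4).const_mul Complex.I
  have h8 := h6.unique h7
  rw [eq_div_iff (mul_ne_zero (by norm_num : (4 : ℂ) ≠ 0) h1)]
  simp only [lamEps_zero] at h8
  linear_combination h8

theorem IsBranch.tendsto_div_amplitude (hs : IsBranch a c s) (ha : a < 0) (hc : c ≠ 0) :
    Tendsto (fun ε => (c : ℂ) / amplitude a c s ε) (𝓝 0) (𝓝 (-1)) := by
  have h := (hs.analyticAt_amplitude ha).continuousAt.tendsto
  rw [hs.amplitude_zero ha] at h
  have hc : (c : ℂ) ≠ 0 := Complex.ofReal_ne_zero.mpr hc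
  have := (tendsto_const_nhds (x := (c : ℂ))).div h (neg_ne_zero.mpr hc)
  rwa [div_neg, div_self hc] at this

theorem IsBranch.eventually_amplitude_mul (hs : IsBranch a c s) (ha : a < 0) (hc : c ≠ 0) :
    ∀ᶠ ε in 𝓝 (0 : ℂ), amplitude a c s (-ε) * amplitude a c s ε = (c : ℂ) ^ 2 := by
  filter_upwards [hs.odd ha hc, eventually_lamEps_ne_zero (c := c) ha, hs.2] with ε h1 h2 h3
  have h4 := amplitude_mul h2 h3
  have h5 := four_mul_amplitude (s := s) (a := a) (c := c) (ε := -ε) (by rwa [lamEps_neg])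
  rw [lamEps_neg, h1] at h5
  refine mul_left_cancel₀ (mul_ne_zero (by norm_num : (4 : ℂ) ≠ 0) h2) ?_
  linear_combination h4 + amplitude a c s ε * h5

theorem IsBranch.phase_neg (hs : IsBranch a c s) (ha : a < 0) (hc : c ≠ 0) (x t : ℝ) :
    ∀ᶠ ε in 𝓝 (0 : ℂ), phase a c l s x t (-ε) = -phase a c l s x t ε := by
  filter_upwards [hs.odd ha hc] with ε h
  have : ∀ m : Fin k, (-ε) ^ (2 * (m : ℕ)) * l m = ε ^ (2 * (m : ℕ)) * l m := fun m => by
    rw [pow_mul, neg_sq, ← pow_mul]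
  simp only [phase, theta, lamEps_neg, h, this]
  ring

/-- The phase is odd and A(-ε) = c²/A(ε), so ε ↦ -ε exchanges the two exponentials up to the factor
c/A, which depends neither on the component nor on (x, t). -/
theorem IsBranch.eigF_neg (hs : IsBranch a c s) (ha : a < 0) (hc : c ≠ 0) (x t : ℝ) :
    ∀ᶠ ε in 𝓝 (0 : ℂ), eigF a c l s x t (-ε) = c / amplitude a c s ε * eigF a c l s x t ε := by
  have h0 : ∀ᶠ ε in 𝓝 (0 : ℂ), amplitude a c s ε ≠ 0 :=
    (hs.analyticAt_amplitude ha).continuousAt.eventually_ne (by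
      rw [hs.amplitude_zero ha]; simpa using hc)
  filter_upwards [hs.phase_neg (l := l) ha hc x t, hs.eventually_amplitude_mul ha hc, h0]
    with ε h1 h2 h3
  have h4 : amplitude a c s (-ε) = (c : ℂ) ^ 2 / amplitude a c s ε := by
    rw [eq_div_iff h3, h2]
  rw [eigF_eq, eigF_eq, h1, h4, sub_neg_eq_add, ← sub_eq_add_neg]
  field_simp
  ring

theorem IsBranch.eigG_neg (hs : IsBranch a c s) (ha : a < 0) (hc : c ≠ 0) (x t : ℝ) :
    ∀ᶠ ε in 𝓝 (0 : ℂ), eigG a c l s x t (-ε) = c / amplitude a c s ε * eigG a c l s x t ε := by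
  have h0 : ∀ᶠ ε in 𝓝 (0 : ℂ), amplitude a c s ε ≠ 0 :=
    (hs.analyticAt_amplitude ha).continuousAt.eventually_ne (by
      rw [hs.amplitude_zero ha]; simpa using hc)
  filter_upwards [hs.phase_neg (l := l) ha hc x t, hs.eventually_amplitude_mul ha hc, h0]
    with ε h1 h2 h3
  have h4 : amplitude a c s (-ε) = (c : ℂ) ^ 2 / amplitude a c s ε := by
    rw [eq_div_iff h3, h2]
  rw [eigG_eq, eigG_eq, h1, h4, sub_neg_eq_add, ← sub_eq_add_neg]
  field_simp
  ring

theorem IsBranch.analyticAt_phase (hs : IsBranch a c s) (x t : ℝ) :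
    AnalyticAt ℂ (phase a c l s x t) 0 := by
  have h := analyticAt_lamEps (a := a) (c := c) 0
  have h2 := hs.1
  unfold phase theta
  fun_prop

theorem IsBranch.analyticAt_eigF (hs : IsBranch a c s) (ha : a < 0) (x t : ℝ) :
    AnalyticAt ℂ (eigF a c l s x t) 0 := by
  have h1 := hs.analyticAt_amplitude ha
  have h2 := hs.analyticAt_phase (l := l) x t
  rw [show eigF a c l s x t = _ from funext fun ε => eigF_eq x t ε]
  fun_prop

theorem IsBranch.analyticAt_eigG (hs : IsBranch a c s) (ha : a < 0) (x t : ℝ) :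
    AnalyticAt ℂ (eigG a c l s x t) 0 := by
  have h1 := hs.analyticAt_amplitude ha
  have h2 := hs.analyticAt_phase (l := l) x t
  rw [show eigG a c l s x t = _ from funext fun ε => eigG_eq x t ε]
  fun_prop

/-- Here f e^(-iρ/2) + g e^(iρ/2) = (A + c)(e^(iφ) + e^(-iφ)) with φ the phase. Since A(0) = -c and
φ(0) = 0, its derivative at 0 is 2A'(0), a nonzero multiple of s'(0). -/
theorem IsBranch.deriv_eig_ne_zero (hs : IsBranch a c s) (ha : a < 0) (hc : c ≠ 0) (x t : ℝ) :
    deriv (eigF a c l s x t) 0 ≠ 0 ∨ deriv (eigG a c l s x t) 0 ≠ 0 := by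
  by_contra! h
  have hF := (hs.analyticAt_eigF (l := l) ha x t).differentiableAt.hasDerivAt
  have hG := (hs.analyticAt_eigG (l := l) ha x t).differentiableAt.hasDerivAt
  rw [h.1] at hF
  rw [h.2] at hG
  have h1 := (hF.mul_const (Complex.exp (-(Complex.I * (rho a c x t / 2))))).add
    (hG.mul_const (Complex.exp (Complex.I * (rho a c x t / 2))))
  have h2 := ((hs.analyticAt_amplitude ha).differentiableAt.hasDerivAt.add_const (c : ℂ)).mul
    (((hs.analyticAt_phase (l := l) x t).differentiableAt.hasDerivAt.const_mul Complex.I).cexp.add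
      ((hs.analyticAt_phase (l := l) x t).differentiableAt.hasDerivAt.const_mul (-Complex.I)).cexp)
  have h3 : phase a c l s x t 0 = 0 := by simp [phase, theta, hs.zero ha]
  have h4 := h1.unique (h2.congr_of_eventuallyEq (Eventually.of_forall fun ε => by
    simp only [Pi.add_apply, Pi.mul_apply, eigF_eq, eigG_eq, mul_add, mul_sub, mul_neg, neg_mul,
      Complex.exp_add, Complex.exp_sub, Complex.exp_neg]
    have e1 := Complex.exp_ne_zero (Complex.I * (rho a c x t / 2))
    have e2 := Complex.exp_ne_zero (Complex.I * phase a c l s x t ε)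
    field_simp
    ring))
  simp only [h3, hs.amplitude_zero ha, hs.deriv_amplitude ha] at h4
  have h5 := hs.deriv_ne_zero ha hc
  have h6 := lam0_ne_zero (c := c) ha
  simp [h3, h5, h6] at h4

end

end DNLSII

end

/-! ### The Lax system for the eigenfunctions and for their odd Taylor series. -/

section

/-- The odd part of the Taylor series at the origin of a function of a real variable. -/
noncomputable def oddTaylor (g : ℝ → ℂ) : PowerSeries ℂ := oddPart (taylorSeries g)

theorem oddTaylor_add {f g : ℝ → ℂ} (hf : AnalyticAt ℝ f 0) (hg : AnalyticAt ℝ g 0) :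
    oddTaylor (fun x => f x + g x) = oddTaylor f + oddTaylor g := by
  rw [oddTaylor, taylorSeries_add hf hg, oddPart_add]
  rfl

theorem oddTaylor_const_mul (b : ℂ) {f : ℝ → ℂ} (hf : AnalyticAt ℝ f 0) :
    oddTaylor (fun x => b * f x) = PowerSeries.C b * oddTaylor f := by
  rw [oddTaylor, taylorSeries_mul analyticAt_const hf, taylorSeries_const, oddPart_C_mul]
  rfl

theorem analyticAt_comp_ofReal {f : ℂ → ℂ} (hf : AnalyticAt ℂ f 0) :
    AnalyticAt ℝ (fun x : ℝ => f x) 0 := by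
  have h : AnalyticAt ℝ (fun x : ℝ => (x : ℂ)) 0 := Complex.ofRealCLM.analyticAt 0
  refine AnalyticAt.fun_comp (g := f) ?_ h
  rw [Complex.ofReal_zero]
  exact hf.restrictScalars

theorem coeff_oddTaylor_comp_ofReal {f : ℂ → ℂ} (hf : AnalyticAt ℂ f 0) (m : ℕ) :
    PowerSeries.coeff m (oddTaylor fun x => f x)
      = iteratedDeriv (2 * m + 1) f 0 / (2 * m + 1).factorial := by
  rw [oddTaylor, coeff_oddPart, coeff_taylorSeries, iteratedDeriv_comp_ofReal hf]

theorem oddCoeffMat_eq_taylorMat {k : ℕ} {φ χ : Fin (2 * k) → ℂ → ℂ}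
    (hφ : ∀ j, AnalyticAt ℂ (φ j) 0) (hχ : ∀ j, AnalyticAt ℂ (χ j) 0) :
    oddCoeffMat φ χ = taylorMat (fun j => oddTaylor fun x => φ j x)
      (fun j => oddTaylor fun x => χ j x) := by
  ext i j
  simp only [oddCoeffMat, taylorMat, Matrix.of_apply, coeff_oddTaylor_comp_ofReal (hφ j),
    coeff_oddTaylor_comp_ofReal (hχ j)]

theorem SmoothFun.series_ext {f g : PowerSeries SmoothFun}
    (h : ∀ p, PowerSeries.map (SmoothFun.eval p) f = PowerSeries.map (SmoothFun.eval p) g) :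
    f = g := by
  ext1 m
  refine SmoothFun.ext_eval fun p => ?_
  rw [← PowerSeries.coeff_map, h, PowerSeries.coeff_map]

namespace DNLSII

variable {a c : ℝ} {k : ℕ} {l : Fin k → ℂ} {s : ℂ → ℂ}

theorem analyticAt_lamEps_ofReal : AnalyticAt ℝ (fun x : ℝ => lamEps a c x) 0 :=
  analyticAt_comp_ofReal (analyticAt_lamEps 0)

theorem taylorSeries_lamEps_pow (e : ℕ) : taylorSeries (fun x => lamEps a c x ^ e)
    = (PowerSeries.C (lam0 a c) + PowerSeries.X ^ 2) ^ e := by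
  have hx : AnalyticAt ℝ (fun x : ℝ => (x : ℂ)) 0 := Complex.ofRealCLM.analyticAt 0
  induction e with
  | zero => simpa using taylorSeries_const 1
  | succ e ih =>
    simp only [pow_succ _ e]
    rw [taylorSeries_mul (analyticAt_lamEps_ofReal.fun_pow e) analyticAt_lamEps_ofReal, ih]
    congr 1
    simp only [lamEps, pow_two]
    rw [taylorSeries_add analyticAt_const (hx.fun_mul hx), taylorSeries_const, taylorSeries_mul hx hx,
      taylorSeries_ofReal]

theorem oddTaylor_lamEps_pow_mul (e : ℕ) {f : ℝ → ℂ} (hf : AnalyticAt ℝ f 0) :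
    oddTaylor (fun x => lamEps a c x ^ e * f x)
      = (PowerSeries.C (lam0 a c) + PowerSeries.X) ^ e * oddTaylor f := by
  rw [oddTaylor, taylorSeries_mul (analyticAt_lamEps_ofReal.fun_pow e) hf, taylorSeries_lamEps_pow,
    oddPart_pow_mul]
  rfl

theorem oddTaylor_eval_mul (P : Polynomial ℂ) {f : ℝ → ℂ} (hf : AnalyticAt ℝ f 0) :
    oddTaylor (fun x => P.eval (lamEps a c x ^ 2) * f x) = evSq (lam0 a c) P * oddTaylor f := by
  have hP : ∀ P : Polynomial ℂ, AnalyticAt ℝ (fun x : ℝ => P.eval (lamEps a c x ^ 2) * f x) 0 := by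
    intro P
    refine AnalyticAt.mul ?_ hf
    simp only [Polynomial.eval_eq_sum_range]
    exact Finset.analyticAt_fun_sum _ fun i _ =>
      analyticAt_const.mul ((analyticAt_lamEps_ofReal.fun_pow 2).fun_pow i)
  induction P using Polynomial.induction_on' with
  | add P Q h1 h2 =>
    simp only [Polynomial.eval_add, add_mul]
    rw [oddTaylor_add (hP P) (hP Q), h1, h2, map_add, add_mul]
  | monomial n b =>
    simp only [Polynomial.eval_monomial, mul_assoc, ← pow_mul]
    rw [oddTaylor_const_mul b ((analyticAt_lamEps_ofReal.fun_pow _).fun_mul hf),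
      oddTaylor_lamEps_pow_mul _ hf, ← Polynomial.C_mul_X_pow_eq_monomial, map_mul, map_pow, evSq_C,
      evSq_X, pow_mul]
    ring

/-- A linear differential system with coefficients polynomial in `λ ^ 2` passes to the odd Taylor
series. -/
theorem seriesDeriv_oddPart_series {D F H : ℝ → ℝ × ℝ → ℂ} (hD : JointAn D) (hF : JointAn F)
    (hH : JointAn H) {v : ℝ × ℝ} {P Q : Polynomial SmoothFun}
    (h : ∀ p, ∀ᶠ ε in 𝓝 (0 : ℝ), HasDerivAt (fun r : ℝ => D ε (p + r • v))
      ((P.map (SmoothFun.eval p)).eval (lamEps a c ε ^ 2) * F ε p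
        + (Q.map (SmoothFun.eval p)).eval (lamEps a c ε ^ 2) * H ε p) 0) :
    seriesDeriv (SmoothFun.dir v) (oddPart hD.series)
      = evSq (SmoothFun.cst (lam0 a c)) P * oddPart hF.series
        + evSq (SmoothFun.cst (lam0 a c)) Q * oddPart hH.series := by
  refine SmoothFun.series_ext fun p => ?_
  have hP : ∀ {f : ℝ → ℂ} (P : Polynomial ℂ), AnalyticAt ℝ f 0 →
      AnalyticAt ℝ (fun x : ℝ => P.eval (lamEps a c x ^ 2) * f x) 0 := by
    intro f P hf
    refine AnalyticAt.mul ?_ hf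
    simp only [Polynomial.eval_eq_sum_range]
    exact Finset.analyticAt_fun_sum _ fun i _ =>
      analyticAt_const.mul ((analyticAt_lamEps_ofReal.fun_pow 2).fun_pow i)
  rw [seriesDeriv_oddPart, map_oddPart,
    hD.map_eval_seriesDeriv_series (G' := fun ε p =>
      (P.map (SmoothFun.eval p)).eval (lamEps a c ε ^ 2) * F ε p
        + (Q.map (SmoothFun.eval p)).eval (lamEps a c ε ^ 2) * H ε p) (h p)]
  have h2 := oddTaylor_add (hP (P.map (SmoothFun.eval p)) (hF.analyticAt_fst p))
    (hP (Q.map (SmoothFun.eval p)) (hH.analyticAt_fst p))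
  rw [oddTaylor_eval_mul _ (hF.analyticAt_fst p), oddTaylor_eval_mul _ (hH.analyticAt_fst p)] at h2
  rw [map_add, map_mul, map_mul, map_evSq, map_evSq, map_oddPart, map_oddPart, hF.map_eval_series,
    hH.map_eval_series, SmoothFun.eval_algebraMap]
  exact h2

theorem analyticAt_cexp_real {E : Type*} [NormedAddCommGroup E] [NormedSpace ℝ E] {f : E → ℂ}
    {z : E} (hf : AnalyticAt ℝ f z) : AnalyticAt ℝ (fun z => Complex.exp (f z)) z :=
  AnalyticAt.fun_comp (g := Complex.exp) analyticAt_cexp.restrictScalars hf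

theorem analyticAt_comp_ofReal_fst {f : ℂ → ℂ} (hf : AnalyticAt ℂ f 0) (p : ℝ × ℝ) :
    AnalyticAt ℝ (fun z : ℝ × ℝ × ℝ => f z.1) (0, p) :=
  AnalyticAt.fun_comp (g := fun x : ℝ => f x) (f := fun z : ℝ × ℝ × ℝ => z.1) (x := (0, p))
    (analyticAt_comp_ofReal hf) analyticAt_fst

theorem analyticAt_ofReal_comp {E : Type*} [NormedAddCommGroup E] [NormedSpace ℝ E] {f : E → ℝ}
    {z : E} (hf : AnalyticAt ℝ f z) : AnalyticAt ℝ (fun z => (f z : ℂ)) z :=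
  AnalyticAt.fun_comp (g := fun x : ℝ => (x : ℂ)) (Complex.ofRealCLM.analyticAt _) hf

theorem analyticAt_x (z : ℝ × ℝ × ℝ) : AnalyticAt ℝ (fun z : ℝ × ℝ × ℝ => z.2.1) z :=
  ((ContinuousLinearMap.fst ℝ ℝ ℝ).comp (ContinuousLinearMap.snd ℝ ℝ (ℝ × ℝ))).analyticAt z

theorem analyticAt_t (z : ℝ × ℝ × ℝ) : AnalyticAt ℝ (fun z : ℝ × ℝ × ℝ => z.2.2) z :=
  ((ContinuousLinearMap.snd ℝ ℝ ℝ).comp (ContinuousLinearMap.snd ℝ ℝ (ℝ × ℝ))).analyticAt z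

theorem IsBranch.jointAn_phase (hs : IsBranch a c s) :
    JointAn fun ε p => phase a c l s p.1 p.2 ε := by
  intro p
  have h1 := analyticAt_comp_ofReal_fst hs.1 p
  have h2 := analyticAt_comp_ofReal_fst (analyticAt_lamEps (a := a) (c := c) 0) p
  have h3 := analyticAt_ofReal_comp (analyticAt_x (0, p))
  have h4 := analyticAt_ofReal_comp (analyticAt_t (0, p))
  have h5 : AnalyticAt ℂ (fun ε : ℂ => ∑ m : Fin k, ε ^ (2 * (m : ℕ)) * l m) 0 := by fun_prop
  have h6 := analyticAt_comp_ofReal_fst h5 p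
  exact ((h1.fun_div analyticAt_const (by norm_num)).fun_neg.fun_mul h3).fun_add
    (((((analyticAt_const.fun_add analyticAt_const).fun_sub
      (analyticAt_const.fun_mul (h2.fun_pow 2))).fun_mul h1).fun_div analyticAt_const
        (by norm_num)).fun_mul h4) |>.fun_add (h1.fun_mul h6)

theorem analyticAt_rho (p : ℝ × ℝ) :
    AnalyticAt ℝ (fun z : ℝ × ℝ × ℝ => (rho a c z.2.1 z.2.2 : ℂ)) (0, p) := by
  unfold rho
  have h1 := analyticAt_x (0, p)
  have h2 := analyticAt_t (0, p)
  exact analyticAt_ofReal_comp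
    ((analyticAt_const.fun_mul h1).fun_add (analyticAt_const.fun_mul h2))

theorem IsBranch.jointAn_eigF (hs : IsBranch a c s) (ha : a < 0) :
    JointAn fun ε p => eigF a c l s p.1 p.2 ε := by
  intro p
  have h1 := hs.jointAn_phase (l := l) p
  have h2 := analyticAt_comp_ofReal_fst (hs.analyticAt_amplitude ha) p
  have h3 := analyticAt_rho (a := a) (c := c) p
  simp only [eigF_eq]
  exact (h2.mul (analyticAt_cexp_real (by fun_prop))).add
    (analyticAt_const.mul (analyticAt_cexp_real (by fun_prop)))

theorem IsBranch.jointAn_lamEps_mul_eigG (hs : IsBranch a c s) (ha : a < 0) :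
    JointAn fun ε p => lamEps a c ε * eigG a c l s p.1 p.2 ε := by
  intro p
  have h1 := hs.jointAn_phase (l := l) p
  have h2 := analyticAt_comp_ofReal_fst (hs.analyticAt_amplitude ha) p
  have h3 := analyticAt_rho (a := a) (c := c) p
  simp only [eigG_eq]
  exact (analyticAt_comp_ofReal_fst (analyticAt_lamEps 0) p).mul
    ((analyticAt_const.mul (analyticAt_cexp_real (by fun_prop))).add
      (h2.mul (analyticAt_cexp_real (by fun_prop))))

theorem IsBranch.jointAn_eigG (hs : IsBranch a c s) (ha : a < 0) :
    JointAn fun ε p => eigG a c l s p.1 p.2 ε := by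
  intro p
  have h1 := hs.jointAn_phase (l := l) p
  have h2 := analyticAt_comp_ofReal_fst (hs.analyticAt_amplitude ha) p
  have h3 := analyticAt_rho (a := a) (c := c) p
  simp only [eigG_eq]
  exact (analyticAt_const.mul (analyticAt_cexp_real (by fun_prop))).add
    (h2.mul (analyticAt_cexp_real (by fun_prop)))

/-! ### The Lax system -/

theorem rho_add_smul (p v : ℝ × ℝ) (r : ℝ) : rho a c (p + r • v).1 (p + r • v).2
    = rho a c p.1 p.2 + r * rho a c v.1 v.2 := by
  simp only [rho, Prod.fst_add, Prod.snd_add, Prod.smul_fst, Prod.smul_snd, smul_eq_mul]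
  ring

theorem phase_add_smul (p v : ℝ × ℝ) (r : ℝ) (ε : ℂ) : phase a c l s (p + r • v).1 (p + r • v).2 ε
    = phase a c l s p.1 p.2 ε + r * theta a c (lamEps a c ε) (s ε) v.1 v.2 := by
  simp only [phase, theta, Prod.fst_add, Prod.snd_add, Prod.smul_fst, Prod.smul_snd, smul_eq_mul]
  push_cast
  ring

theorem hasDerivAt_cexp_affine (A B : ℂ) :
    HasDerivAt (fun r : ℝ => Complex.exp (Complex.I * (A + r * B)))
      (Complex.I * B * Complex.exp (Complex.I * A)) 0 := by
  have h := (((Complex.ofRealCLM.hasDerivAt (x := (0 : ℝ))).mul_const B).const_add A).const_mul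
    Complex.I |>.cexp
  simp only [Complex.ofRealCLM_apply, Complex.ofReal_zero, Complex.ofReal_one, zero_mul, add_zero,
    one_mul] at h
  exact h.congr_deriv (by ring)

theorem hasDerivAt_eigF (p v : ℝ × ℝ) (ε : ℂ) :
    HasDerivAt (fun r : ℝ => eigF a c l s (p + r • v).1 (p + r • v).2 ε)
      (amplitude a c s ε * (Complex.I * (rho a c v.1 v.2 / 2 + theta a c (lamEps a c ε) (s ε) v.1 v.2)
          * Complex.exp (Complex.I * (rho a c p.1 p.2 / 2 + phase a c l s p.1 p.2 ε)))
        + c * (Complex.I * (rho a c v.1 v.2 / 2 - theta a c (lamEps a c ε) (s ε) v.1 v.2)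
          * Complex.exp (Complex.I * (rho a c p.1 p.2 / 2 - phase a c l s p.1 p.2 ε)))) 0 := by
  refine (((hasDerivAt_cexp_affine _ _).const_mul (amplitude a c s ε)).add
    ((hasDerivAt_cexp_affine _ _).const_mul (c : ℂ))).congr_of_eventuallyEq
    (Eventually.of_forall fun r => ?_)
  simp only [eigF_eq, rho_add_smul, phase_add_smul, Pi.add_apply]
  push_cast
  congr 4 <;> ring

theorem hasDerivAt_eigG (p v : ℝ × ℝ) (ε : ℂ) :
    HasDerivAt (fun r : ℝ => eigG a c l s (p + r • v).1 (p + r • v).2 ε)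
      (c * (Complex.I * (-(rho a c v.1 v.2 / 2) + theta a c (lamEps a c ε) (s ε) v.1 v.2)
          * Complex.exp (Complex.I * (-(rho a c p.1 p.2 / 2) + phase a c l s p.1 p.2 ε)))
        + amplitude a c s ε
          * (Complex.I * (-(rho a c v.1 v.2 / 2) - theta a c (lamEps a c ε) (s ε) v.1 v.2)
          * Complex.exp (Complex.I * (-(rho a c p.1 p.2 / 2) - phase a c l s p.1 p.2 ε)))) 0 := by
  refine (((hasDerivAt_cexp_affine _ _).const_mul (c : ℂ)).add
    ((hasDerivAt_cexp_affine _ _).const_mul (amplitude a c s ε))).congr_of_eventuallyEq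
    (Eventually.of_forall fun r => ?_)
  simp only [eigG_eq, rho_add_smul, phase_add_smul, Pi.add_apply]
  push_cast
  congr 4 <;> ring

theorem seed_mul_eigG (x t : ℝ) (ε : ℂ) : seed a c x t * eigG a c l s x t ε
    = (c : ℂ) ^ 2 * Complex.exp (Complex.I * (rho a c x t / 2 + phase a c l s x t ε))
      + c * amplitude a c s ε
        * Complex.exp (Complex.I * (rho a c x t / 2 - phase a c l s x t ε)) := by
  have e1 : Complex.exp (Complex.I * (rho a c x t / 2 + phase a c l s x t ε))
      = Complex.exp (Complex.I * rho a c x t)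
        * Complex.exp (Complex.I * (-(rho a c x t / 2) + phase a c l s x t ε)) := by
    rw [← Complex.exp_add]; congr 1; ring
  have e2 : Complex.exp (Complex.I * (rho a c x t / 2 - phase a c l s x t ε))
      = Complex.exp (Complex.I * rho a c x t)
        * Complex.exp (Complex.I * (-(rho a c x t / 2) - phase a c l s x t ε)) := by
    rw [← Complex.exp_add]; congr 1; ring
  rw [eigG_eq, seed, e1, e2]
  ring

theorem star_seed (x t : ℝ) :
    star (seed a c x t) = c * Complex.exp (-(Complex.I * rho a c x t)) := by
  simp [seed, ← Complex.exp_conj]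

theorem star_seed_mul_eigF (x t : ℝ) (ε : ℂ) : star (seed a c x t) * eigF a c l s x t ε
    = c * amplitude a c s ε
        * Complex.exp (Complex.I * (-(rho a c x t / 2) + phase a c l s x t ε))
      + (c : ℂ) ^ 2 * Complex.exp (Complex.I * (-(rho a c x t / 2) - phase a c l s x t ε)) := by
  have e1 : Complex.exp (Complex.I * (-(rho a c x t / 2) + phase a c l s x t ε))
      = Complex.exp (-(Complex.I * rho a c x t))
        * Complex.exp (Complex.I * (rho a c x t / 2 + phase a c l s x t ε)) := by
    rw [← Complex.exp_add]; congr 1; ring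
  have e2 : Complex.exp (Complex.I * (-(rho a c x t / 2) - phase a c l s x t ε))
      = Complex.exp (-(Complex.I * rho a c x t))
        * Complex.exp (Complex.I * (rho a c x t / 2 - phase a c l s x t ε)) := by
    rw [← Complex.exp_add]; congr 1; ring
  rw [eigF_eq, star_seed, e1, e2]
  ring

/-- Comparing coefficients of the two exponentials leaves exactly the two relations
`four_mul_amplitude` and `amplitude_mul`. -/
theorem hasDerivAt_eigF_x {ε : ℂ} (h : lamEps a c ε ≠ 0)
    (hs : s ε ^ 2 = radicand a c (lamEps a c ε)) (p : ℝ × ℝ) :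
    HasDerivAt (fun r : ℝ => eigF a c l s (p + r • ((1, 0) : ℝ × ℝ)).1 (p + r • ((1, 0) : ℝ × ℝ)).2 ε)
      ((-Complex.I * lamEps a c ε ^ 2 + Complex.I * (c / 2) ^ 2) * eigF a c l s p.1 p.2 ε
        + seed a c p.1 p.2 * (lamEps a c ε * eigG a c l s p.1 p.2 ε)) 0 := by
  refine (hasDerivAt_eigF p (1, 0) ε).congr_deriv ?_
  have h1 := four_mul_amplitude (s := s) h
  have h2 := amplitude_mul h hs
  rw [mul_left_comm (seed a c _ _), seed_mul_eigG, eigF_eq]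
  simp only [rho, theta]
  push_cast
  generalize Complex.exp _ = E
  generalize Complex.exp _ = E'
  linear_combination (E / 4) * h2 - (E' * c / 4) * h1

theorem hasDerivAt_eigF_t {ε : ℂ} (h : lamEps a c ε ≠ 0)
    (hs : s ε ^ 2 = radicand a c (lamEps a c ε)) (p : ℝ × ℝ) :
    HasDerivAt (fun r : ℝ => eigF a c l s (p + r • ((0, 1) : ℝ × ℝ)).1 (p + r • ((0, 1) : ℝ × ℝ)).2 ε)
      ((-(2 * Complex.I) * (lamEps a c ε ^ 2) ^ 2 + 4 * Complex.I * (c / 2) ^ 2 * lamEps a c ε ^ 2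
          - Complex.I * (2 * (c / 2) ^ 4 + 2 * a * (c / 2) ^ 2)) * eigF a c l s p.1 p.2 ε
        + (2 * lamEps a c ε ^ 2 - (a + 2 * (c / 2) ^ 2)) * seed a c p.1 p.2
          * (lamEps a c ε * eigG a c l s p.1 p.2 ε)) 0 := by
  refine (hasDerivAt_eigF p (0, 1) ε).congr_deriv ?_
  have h1 := four_mul_amplitude (s := s) h
  have h2 := amplitude_mul h hs
  rw [mul_assoc _ (seed a c _ _), mul_left_comm (seed a c _ _), seed_mul_eigG, eigF_eq]
  simp only [rho, theta]
  push_cast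
  generalize Complex.exp _ = E
  generalize Complex.exp _ = E'
  -- The rate of θ in t is its rate in x times this factor, which also multiplies the off-diagonal
  -- entry. The verification is therefore the spatial one, rescaled.
  linear_combination (2 * lamEps a c ε ^ 2 - (a + 2 * (c / 2) ^ 2)) * ((E / 4) * h2 - (E' * c / 4) * h1)

theorem hasDerivAt_eigG_x {ε : ℂ} (h : lamEps a c ε ≠ 0)
    (hs : s ε ^ 2 = radicand a c (lamEps a c ε)) (p : ℝ × ℝ) :
    HasDerivAt (fun r : ℝ => lamEps a c ε
        * eigG a c l s (p + r • ((1, 0) : ℝ × ℝ)).1 (p + r • ((1, 0) : ℝ × ℝ)).2 ε)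
      (-(lamEps a c ε ^ 2 * star (seed a c p.1 p.2)) * eigF a c l s p.1 p.2 ε
        + (Complex.I * lamEps a c ε ^ 2 - Complex.I * (c / 2) ^ 2)
          * (lamEps a c ε * eigG a c l s p.1 p.2 ε)) 0 := by
  refine ((hasDerivAt_eigG p (1, 0) ε).const_mul (lamEps a c ε)).congr_deriv ?_
  have h1 := four_mul_amplitude (s := s) h
  have h2 := amplitude_mul h hs
  rw [neg_mul, mul_assoc _ (star _), star_seed_mul_eigF, eigG_eq]
  simp only [rho, theta]
  push_cast
  generalize Complex.exp _ = E
  generalize Complex.exp _ = E'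
  linear_combination lamEps a c ε * ((E * c / 4) * h1 - (E' / 4) * h2)

theorem hasDerivAt_eigG_t {ε : ℂ} (h : lamEps a c ε ≠ 0)
    (hs : s ε ^ 2 = radicand a c (lamEps a c ε)) (p : ℝ × ℝ) :
    HasDerivAt (fun r : ℝ => lamEps a c ε
        * eigG a c l s (p + r • ((0, 1) : ℝ × ℝ)).1 (p + r • ((0, 1) : ℝ × ℝ)).2 ε)
      (-(lamEps a c ε ^ 2 * (2 * lamEps a c ε ^ 2 - (a + 2 * (c / 2) ^ 2))
          * star (seed a c p.1 p.2)) * eigF a c l s p.1 p.2 ε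
        + (2 * Complex.I * (lamEps a c ε ^ 2) ^ 2 - 4 * Complex.I * (c / 2) ^ 2 * lamEps a c ε ^ 2
          + Complex.I * (2 * (c / 2) ^ 4 + 2 * a * (c / 2) ^ 2))
          * (lamEps a c ε * eigG a c l s p.1 p.2 ε)) 0 := by
  refine ((hasDerivAt_eigG p (0, 1) ε).const_mul (lamEps a c ε)).congr_deriv ?_
  have h1 := four_mul_amplitude (s := s) h
  have h2 := amplitude_mul h hs
  rw [neg_mul, mul_assoc _ (star _), star_seed_mul_eigF, eigG_eq]
  simp only [rho, theta]
  push_cast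
  generalize Complex.exp _ = E
  generalize Complex.exp _ = E'
  linear_combination (2 * lamEps a c ε ^ 2 - (a + 2 * (c / 2) ^ 2)) * lamEps a c ε
    * ((E * c / 4) * h1 - (E' / 4) * h2)

end DNLSII

end

/-! ### From the matrices of the statement to odd Taylor coefficients. -/

section
open scoped ContDiff

namespace SmoothFun

theorem dir_apply_eq_of_hasDerivAt {f : SmoothFun} {v p : ℝ × ℝ} {y : ℂ}
    (h : HasDerivAt (fun r : ℝ => (f : ℝ × ℝ → ℂ) (p + r • v)) y 0) :
    eval p (dir v f) = y := by
  have h1 := ((f.differentiable p).hasFDerivAt.hasLineDerivAt v)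
  exact h1.unique h

theorem deriv_fst (f : SmoothFun) (x t : ℝ) :
    deriv (fun x' => eval (x', t) f) x = eval (x, t) (dir (1, 0) f) := by
  have h1 : HasDerivAt (fun x' : ℝ => (x', t)) (1, 0) x :=
    (hasDerivAt_id x).prodMk (hasDerivAt_const x t)
  exact ((f.differentiable (x, t)).hasFDerivAt.comp_hasDerivAt x h1).deriv

theorem deriv_snd (f : SmoothFun) (x t : ℝ) :
    deriv (fun t' => eval (x, t') f) t = eval (x, t) (dir (0, 1) f) := by
  have h1 : HasDerivAt (fun t' : ℝ => (x, t')) (0, 1) t :=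
    (hasDerivAt_const t x).prodMk (hasDerivAt_id t)
  exact ((f.differentiable (x, t)).hasFDerivAt.comp_hasDerivAt t h1).deriv

theorem isSolution {Q : SmoothFun} (h : cst Complex.I * dir (0, 1) Q + dir (1, 0) (dir (1, 0) Q)
    + cst Complex.I * (Q * star Q) * dir (1, 0) Q = 0) :
    DNLSII.IsSolution fun x t => eval (x, t) Q := by
  refine ⟨Q.contDiff.of_le (WithTop.coe_le_coe.mpr (le_top : (2 : ℕ∞) ≤ ⊤)), fun x t => ?_⟩
  have h1 := congrArg (eval (x, t)) h
  simp only [map_add, map_mul, eval_star, eval_algebraMap, map_zero] at h1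
  rw [iteratedDeriv_succ, iteratedDeriv_one]
  have h2 : deriv (fun x' => eval (x', t) Q) = fun x' => eval (x', t) (dir (1, 0) Q) :=
    funext fun x' => deriv_fst Q x' t
  rw [h2, deriv_fst, deriv_snd, ← h1, Complex.star_def, Complex.mul_conj']
  push_cast
  rfl

end SmoothFun

section
variable {k : ℕ}

theorem map_altRow {R T : Type*} [CommRing R] [CommRing T] (ϕ : R →+* T) (lam F G : R)
    (j : Fin (2 * k)) : ϕ (altRow lam F G j) = altRow (ϕ lam) (ϕ F) (ϕ G) j := by
  rw [altRow, altRow, map_mul, map_pow, apply_ite ϕ]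

theorem map_altRow' {R T : Type*} [CommRing R] [CommRing T] (ϕ : R →+* T) (lam F G : R)
    (j : Fin (2 * k)) : ϕ (altRow' lam F G j) = altRow' (ϕ lam) (ϕ F) (ϕ G) j := by
  rw [altRow', altRow', apply_ite ϕ, map_mul, map_pow, map_altRow]

theorem analyticAt_altRow {lam f g : ℂ → ℂ} {z : ℂ} (hlam : AnalyticAt ℂ lam z)
    (hf : AnalyticAt ℂ f z) (hg : AnalyticAt ℂ g z) (j : Fin (2 * k)) :
    AnalyticAt ℂ (fun ε => altRow (lam ε) (f ε) (g ε) j) z := by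
  unfold altRow
  split_ifs
  · exact (hlam.fun_pow _).fun_mul hf
  · exact (hlam.fun_pow _).fun_mul hg

theorem analyticAt_altRow' {lam f g : ℂ → ℂ} {z : ℂ} (hlam : AnalyticAt ℂ lam z)
    (hf : AnalyticAt ℂ f z) (hg : AnalyticAt ℂ g z) (j : Fin (2 * k)) :
    AnalyticAt ℂ (fun ε => altRow' (lam ε) (f ε) (g ε) j) z := by
  unfold altRow'
  split_ifs
  · exact (hlam.fun_pow _).fun_mul hf
  · exact analyticAt_altRow hlam hg hf j

theorem altRow_mul (lam b F G : ℂ) (j : Fin (2 * k)) :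
    altRow lam (b * F) (b * G) j = b * altRow lam F G j := by
  unfold altRow
  split_ifs <;> ring

theorem altRow'_mul (lam b F G : ℂ) (j : Fin (2 * k)) :
    altRow' lam (b * F) (b * G) j = b * altRow' lam F G j := by
  unfold altRow'
  split_ifs
  · ring
  · exact altRow_mul _ _ _ _ _

end

namespace DNLSII

section
variable {k : ℕ} {a c : ℝ}

theorem oddTaylor_neg_lamEps_pow_mul (e : ℕ) {f : ℝ → ℂ} (hf : AnalyticAt ℝ f 0) :
    oddTaylor (fun x => (-lamEps a c x) ^ e * f x)
      = (-(PowerSeries.C (lam0 a c) + PowerSeries.X)) ^ e * oddTaylor f := by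
  simp only [neg_pow (lamEps a c _), mul_assoc]
  rw [oddTaylor_const_mul _ ((analyticAt_lamEps_ofReal.fun_pow e).fun_mul hf),
    oddTaylor_lamEps_pow_mul e hf, neg_pow (PowerSeries.C (lam0 a c) + PowerSeries.X), mul_assoc]
  simp

theorem oddTaylor_altRow {f g : ℝ → ℂ} (hf : AnalyticAt ℝ f 0) (hg : AnalyticAt ℝ g 0)
    (j : Fin (2 * k)) : oddTaylor (fun x => altRow (lamEps a c x) (f x) (g x) j)
      = altRow (PowerSeries.C (lam0 a c) + PowerSeries.X) (oddTaylor f) (oddTaylor g) j := by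
  unfold altRow
  split_ifs
  · exact oddTaylor_lamEps_pow_mul _ hf
  · exact oddTaylor_lamEps_pow_mul _ hg

theorem oddTaylor_altRow_neg {f g : ℝ → ℂ} (hf : AnalyticAt ℝ f 0) (hg : AnalyticAt ℝ g 0)
    (j : Fin (2 * k)) : oddTaylor (fun x => altRow (-lamEps a c x) (f x) (g x) j)
      = altRow (-(PowerSeries.C (lam0 a c) + PowerSeries.X)) (oddTaylor f) (oddTaylor g) j := by
  unfold altRow
  split_ifs
  · exact oddTaylor_neg_lamEps_pow_mul _ hf
  · exact oddTaylor_neg_lamEps_pow_mul _ hg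

theorem oddTaylor_altRow' {f g : ℝ → ℂ} (hf : AnalyticAt ℝ f 0) (hg : AnalyticAt ℝ g 0)
    (j : Fin (2 * k)) : oddTaylor (fun x => altRow' (lamEps a c x) (f x) (g x) j)
      = altRow' (PowerSeries.C (lam0 a c) + PowerSeries.X) (oddTaylor f) (oddTaylor g) j := by
  unfold altRow'
  split_ifs
  · exact oddTaylor_lamEps_pow_mul _ hf
  · exact oddTaylor_altRow hg hf j

theorem oddTaylor_altRow'_neg {f g : ℝ → ℂ} (hf : AnalyticAt ℝ f 0) (hg : AnalyticAt ℝ g 0)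
    (j : Fin (2 * k)) : oddTaylor (fun x => altRow' (-lamEps a c x) (f x) (g x) j)
      = altRow' (-(PowerSeries.C (lam0 a c) + PowerSeries.X)) (oddTaylor f) (oddTaylor g) j := by
  unfold altRow'
  split_ifs
  · exact oddTaylor_neg_lamEps_pow_mul _ hf
  · exact oddTaylor_altRow_neg hg hf j

/-- The product of the factorials of the orders of differentiation. -/
noncomputable def orderFactor (k : ℕ) : ℂ :=
  ∏ i : Fin (2 * k), ((2 * ((i : ℕ) / 2) + 1).factorial : ℂ)

theorem orderFactor_ne_zero : orderFactor k ≠ 0 :=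
  Finset.prod_ne_zero_iff.mpr fun _ _ => Nat.cast_ne_zero.mpr (Nat.factorial_ne_zero _)

/-- In 0-based numbering both rows of the pair m are differentiated 2m + 1 times. -/
theorem order_succ (i : ℕ) : order (i + 1) = 2 * (i / 2) + 1 := by
  unfold order
  split_ifs with h
  · obtain ⟨r, hr⟩ := h
    omega
  · obtain ⟨r, hr⟩ := Nat.not_odd_iff_even.mp h
    omega

theorem iteratedDeriv_star (m : ℕ) (f : ℝ → ℂ) (x : ℝ) :
    iteratedDeriv m (fun x => star (f x)) x = star (iteratedDeriv m f x) := by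
  induction m generalizing x with
  | zero => simp
  | succ m ih =>
    rw [iteratedDeriv_succ, iteratedDeriv_succ, funext ih]
    exact deriv.star

/-- Because ε is real, differentiation commutes with conjugation in the partner rows. Derivatives
and Taylor coefficients differ by a factorial in each row, which is the same for all three matrices
and cancels in the quotients. -/
theorem det_primed_pairMat {φ χ : Fin (2 * k) → ℂ → ℂ} (hφ : ∀ j, AnalyticAt ℂ (φ j) 0)
    (hχ : ∀ j, AnalyticAt ℂ (χ j) 0) :
    (primed (pairMat φ χ)).det = orderFactor k * (oddCoeffMat φ χ).det := by
  rw [orderFactor, ← Matrix.det_mul_column]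
  congr 1
  ext i j
  have h : ((2 * ((i : ℕ) / 2) + 1).factorial : ℂ) ≠ 0 :=
    Nat.cast_ne_zero.mpr (Nat.factorial_ne_zero _)
  simp only [primed, pairMat, oddCoeffMat, Matrix.of_apply, order_succ]
  split_ifs
  · rw [iteratedDeriv_comp_ofReal (hφ j), mul_div_cancel₀ _ h]
  · rw [iteratedDeriv_star, iteratedDeriv_comp_ofReal (hχ j), star_div₀, star_natCast,
      mul_div_cancel₀ _ h]

/-- The potential built from matrices of paired rows converges to the one built from the odd Taylor
coefficients. -/
theorem tendsto_potential {κ : ℂ → ℂ} (hκ : Tendsto κ (𝓝 0) (𝓝 (-1)))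
    {φ χ φ₁ χ₁ φ₂ χ₂ : Fin (2 * k) → ℂ → ℂ}
    (hφ : ∀ j, AnalyticAt ℂ (φ j) 0) (hφκ : ∀ j, ∀ᶠ ε in 𝓝 (0 : ℂ), φ j (-ε) = κ ε * φ j ε)
    (hχ : ∀ j, AnalyticAt ℂ (χ j) 0) (hχκ : ∀ j, ∀ᶠ ε in 𝓝 (0 : ℂ), χ j (-ε) = κ ε * χ j ε)
    (hφ₁ : ∀ j, AnalyticAt ℂ (φ₁ j) 0) (hφκ₁ : ∀ j, ∀ᶠ ε in 𝓝 (0 : ℂ), φ₁ j (-ε) = κ ε * φ₁ j ε)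
    (hχ₁ : ∀ j, AnalyticAt ℂ (χ₁ j) 0) (hχκ₁ : ∀ j, ∀ᶠ ε in 𝓝 (0 : ℂ), χ₁ j (-ε) = κ ε * χ₁ j ε)
    (hφ₂ : ∀ j, AnalyticAt ℂ (φ₂ j) 0) (hφκ₂ : ∀ j, ∀ᶠ ε in 𝓝 (0 : ℂ), φ₂ j (-ε) = κ ε * φ₂ j ε)
    (hχ₂ : ∀ j, AnalyticAt ℂ (χ₂ j) 0) (hχκ₂ : ∀ j, ∀ᶠ ε in 𝓝 (0 : ℂ), χ₂ j (-ε) = κ ε * χ₂ j ε)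
    (hdet : (oddCoeffMat φ χ).det ≠ 0) (q : ℂ) :
    (∀ᶠ ε in degeneration k, (pairMat φ χ ε).det ≠ 0) ∧
    Tendsto (fun ε => potential q (pairMat φ χ ε) (pairMat φ₁ χ₁ ε) (pairMat φ₂ χ₂ ε))
      (degeneration k)
      (𝓝 (potential q (oddCoeffMat φ χ) (oddCoeffMat φ₁ χ₁) (oddCoeffMat φ₂ χ₂))) := by
  obtain ⟨Y, hY, hYt⟩ := exists_pairMat_eq_nodeMat_mul hκ hφ hφκ hχ hχκ
  obtain ⟨Y₁, hY₁, hYt₁⟩ := exists_pairMat_eq_nodeMat_mul hκ hφ₁ hφκ₁ hχ₁ hχκ₁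
  obtain ⟨Y₂, hY₂, hYt₂⟩ := exists_pairMat_eq_nodeMat_mul hκ hφ₂ hφκ₂ hχ₂ hχκ₂
  have hN := eventually_det_nodeMat_ne_zero (k := k) hκ
  have hc : Continuous fun A : Matrix (Fin (2 * k)) (Fin (2 * k)) ℂ => A.det :=
    continuous_id.matrix_det
  have hd := (hc.tendsto _).comp hYt
  have hd₁ := (hc.tendsto _).comp hYt₁
  have hd₂ := (hc.tendsto _).comp hYt₂
  constructor
  · filter_upwards [hY, hN, hd.eventually_ne hdet] with ε h1 h2 h3
    rw [h1, Matrix.det_mul]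
    exact mul_ne_zero h2 h3
  · have hlim := ((hd₁.div hd hdet).mul_const q).sub
      ((hd₂.div hd hdet).const_mul (2 * Complex.I))
    refine hlim.congr' ?_
    filter_upwards [hY, hY₁, hY₂, hN] with ε h1 h2 h3 h4
    simp only [potential, h1, h2, h3, Matrix.det_mul, Function.comp_apply, Pi.div_apply,
      mul_div_mul_left _ _ h4]

end

section
variable {k : ℕ} {a c : ℝ} {l : Fin k → ℂ} {s : ℂ → ℂ}

theorem WAt_eq (x t : ℝ) : WAt a c l s x t = pairMat
    (fun j ε => altRow (lamEps a c ε) (eigF a c l s x t ε) (eigG a c l s x t ε) j)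
    (fun j ε => altRow (-lamEps a c ε) (eigG a c l s x t ε) (eigF a c l s x t ε) j) := by
  ext ε i j
  simp only [WAt, matW, lamSeq, fSeq, gSeq, pairMat, altRow, Matrix.of_apply]
  split_ifs <;> simp [star_mul']

theorem WhatAt_eq (x t : ℝ) : WhatAt a c l s x t = pairMat
    (fun j ε => altRow (lamEps a c ε) (eigG a c l s x t ε) (eigF a c l s x t ε) j)
    (fun j ε => altRow (-lamEps a c ε) (eigF a c l s x t ε) (eigG a c l s x t ε) j) := by
  ext ε i j
  simp only [WhatAt, matWhat, lamSeq, fSeq, gSeq, pairMat, altRow, Matrix.of_apply]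
  split_ifs <;> simp [star_mul']

theorem MAt_eq (x t : ℝ) : MAt a c l s x t = pairMat
    (fun j ε => altRow' (lamEps a c ε) (eigF a c l s x t ε) (eigG a c l s x t ε) j)
    (fun j ε => altRow' (-lamEps a c ε) (eigG a c l s x t ε) (eigF a c l s x t ε) j) := by
  ext ε i j
  simp only [MAt, matM, lamSeq, fSeq, gSeq, pairMat, altRow', altRow, Matrix.of_apply]
  split_ifs <;> simp [star_mul']

/-- The seed as a smooth function on the plane. -/
noncomputable def seedFun (a c : ℝ) : SmoothFun :=
  ⟨fun p => seed a c p.1 p.2, show ContDiff ℝ ∞ fun p : ℝ × ℝ => seed a c p.1 p.2 by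
    unfold seed rho
    have h : ContDiff ℝ ∞ fun p : ℝ × ℝ => ((a * p.1 + (-a ^ 2 - c ^ 2 * a) * p.2 : ℝ) : ℂ) :=
      Complex.ofRealCLM.contDiff.comp
        ((contDiff_const.mul contDiff_fst).add (contDiff_const.mul contDiff_snd))
    exact contDiff_const.mul (contDiff_const.mul h).cexp⟩

theorem eval_seedFun (p : ℝ × ℝ) : SmoothFun.eval p (seedFun a c) = seed a c p.1 p.2 := rfl

theorem eval_dir_seedFun (p v : ℝ × ℝ) : SmoothFun.eval p (SmoothFun.dir v (seedFun a c))
    = Complex.I * rho a c v.1 v.2 * seed a c p.1 p.2 := by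
  refine SmoothFun.dir_apply_eq_of_hasDerivAt ?_
  have h := (hasDerivAt_cexp_affine (rho a c p.1 p.2) (rho a c v.1 v.2)).const_mul (c : ℂ)
  refine (h.congr_of_eventuallyEq (Eventually.of_forall fun r => ?_)).congr_deriv ?_
  · change seed a c (p + r • v).1 (p + r • v).2 = _
    rw [seed, rho_add_smul]
    push_cast
    rfl
  · rw [seed]
    ring

/-- The odd Taylor series of the first component of the eigenfunction. -/
noncomputable def IsBranch.oddF (hs : IsBranch a c s) (ha : a < 0) (l : Fin k → ℂ) :
    PowerSeries SmoothFun :=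
  oddPart (hs.jointAn_eigF (l := l) ha).series

/-- The odd Taylor series of the second component of the eigenfunction. -/
noncomputable def IsBranch.oddG (hs : IsBranch a c s) (ha : a < 0) (l : Fin k → ℂ) :
    PowerSeries SmoothFun :=
  oddPart (hs.jointAn_eigG (l := l) ha).series

theorem IsBranch.map_eval_oddF (hs : IsBranch a c s) (ha : a < 0) (p : ℝ × ℝ) :
    PowerSeries.map (SmoothFun.eval p) (hs.oddF ha l)
      = oddTaylor fun ε => eigF a c l s p.1 p.2 ε := by
  rw [IsBranch.oddF, map_oddPart, JointAn.map_eval_series]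
  rfl

theorem IsBranch.map_eval_oddG (hs : IsBranch a c s) (ha : a < 0) (p : ℝ × ℝ) :
    PowerSeries.map (SmoothFun.eval p) (hs.oddG ha l)
      = oddTaylor fun ε => eigG a c l s p.1 p.2 ε := by
  rw [IsBranch.oddG, map_oddPart, JointAn.map_eval_series]
  rfl

theorem IsBranch.oddPart_lamEps_mul_eigG (hs : IsBranch a c s) (ha : a < 0) :
    oddPart (hs.jointAn_lamEps_mul_eigG (l := l) ha).series
      = (PowerSeries.C (SmoothFun.cst (lam0 a c)) + PowerSeries.X) * hs.oddG ha l := by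
  refine SmoothFun.series_ext fun p => ?_
  rw [map_oddPart, JointAn.map_eval_series, map_mul, hs.map_eval_oddG, map_add, PowerSeries.map_C,
    PowerSeries.map_X, SmoothFun.eval_algebraMap]
  have h := oddTaylor_lamEps_pow_mul (a := a) (c := c) 1
    ((hs.jointAn_eigG (l := l) ha).analyticAt_fst p)
  simp only [pow_one] at h
  exact h

theorem eventually_ofReal {P : ℂ → Prop} (h : ∀ᶠ ε in 𝓝 (0 : ℂ), P ε) :
    ∀ᶠ ε : ℝ in 𝓝 0, P ε := by
  have h1 : Tendsto (fun x : ℝ => (x : ℂ)) (𝓝 0) (𝓝 0) := by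
    simpa using Complex.continuous_ofReal.tendsto 0
  exact h1.eventually h

theorem IsBranch.laxKernel (hs : IsBranch a c s) (ha : a < 0) (hc : c ≠ 0) (m : ℕ) :
    LaxKernel (SmoothFun.dir (1, 0)) (SmoothFun.dir (0, 1)) (SmoothFun.cst Complex.I)
      (SmoothFun.cst a) (SmoothFun.cst ((c / 2 : ℝ) : ℂ)) (seedFun a c) m
      (SeriesKills (SmoothFun.cst (lam0 a c)) m (hs.oddF ha l)
        ((PowerSeries.C (SmoothFun.cst (lam0 a c)) + PowerSeries.X) * hs.oddG ha l)) := by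
  have hev : ∀ᶠ ε : ℝ in 𝓝 0, lamEps a c ε ≠ 0 ∧ s ε ^ 2 = radicand a c (lamEps a c ε) :=
    eventually_ofReal ((eventually_lamEps_ne_zero ha).and hs.2)
  refine SmoothFun.laxKernel rfl rfl rfl (a' := a) (h' := c / 2) rfl rfl ?_ ?_ ?_
    (lam0_re_pos ha).ne' (lam0_im_ne_zero hc) ?_ ?_ ?_ ?_ ?_
  · refine SmoothFun.ext_eval fun p => ?_
    simp only [map_mul, map_pow, SmoothFun.eval_star, eval_seedFun, SmoothFun.eval_algebraMap,
      star_seed, map_ofNat]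
    rw [seed, mul_mul_mul_comm, ← Complex.exp_add, add_neg_cancel, Complex.exp_zero]
    push_cast
    ring
  · refine SmoothFun.ext_eval fun p => ?_
    rw [eval_dir_seedFun]
    simp [eval_seedFun, SmoothFun.eval_algebraMap, rho]
  · refine SmoothFun.ext_eval fun p => ?_
    rw [eval_dir_seedFun]
    simp only [map_mul, map_neg, map_add, map_pow, map_ofNat, eval_seedFun,
      SmoothFun.eval_algebraMap, rho]
    push_cast
    ring
  · intro p
    -- The constant terms of the odd series are the first ε-derivatives of f and of λ_0 g, and
    -- `deriv_eig_ne_zero` excludes that both vanish.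
    have hcoeff : ∀ f : PowerSeries SmoothFun, SmoothFun.eval p (PowerSeries.constantCoeff f)
        = PowerSeries.coeff 0 (PowerSeries.map (SmoothFun.eval p) f) := fun f => by simp
    rw [map_mul PowerSeries.constantCoeff, map_mul, hcoeff (hs.oddF ha l), hcoeff (hs.oddG ha l),
      hs.map_eval_oddF, hs.map_eval_oddG,
      coeff_oddTaylor_comp_ofReal (hs.analyticAt_eigF ha p.1 p.2),
      coeff_oddTaylor_comp_ofReal (hs.analyticAt_eigG ha p.1 p.2)]
    have h := hs.deriv_eig_ne_zero (l := l) ha hc p.1 p.2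
    have h0 := lam0_ne_zero (c := c) ha
    simpa [h0, SmoothFun.eval_algebraMap] using h
  all_goals
    rw [← hs.oddPart_lamEps_mul_eigG ha]
    refine seriesDeriv_oddPart_series _ _ _ fun p => ?_
    filter_upwards [hev] with ε hε
  · refine (hasDerivAt_eigF_x hε.1 hε.2 p).congr_deriv ?_
    simp [eval_seedFun, SmoothFun.eval_algebraMap]
  · refine (hasDerivAt_eigG_x hε.1 hε.2 p).congr_deriv ?_
    simp [eval_seedFun, SmoothFun.eval_algebraMap, SmoothFun.eval_star]
    exact Or.inl (mul_comm _ _)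
  · refine (hasDerivAt_eigF_t hε.1 hε.2 p).congr_deriv ?_
    simp [eval_seedFun, SmoothFun.eval_algebraMap, map_ofNat]
  · refine (hasDerivAt_eigG_t hε.1 hε.2 p).congr_deriv ?_
    simp [eval_seedFun, SmoothFun.eval_algebraMap, SmoothFun.eval_star, map_ofNat]

end

end DNLSII

end

/-! ### Nonvanishing, the limit and the conclusion. -/

section

theorem SmoothFun.eval_det {n : ℕ} (p : ℝ × ℝ) (A : Matrix (Fin n) (Fin n) SmoothFun) :
    SmoothFun.eval p A.det = (A.map (SmoothFun.eval p)).det :=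
  RingHom.map_det _ _

namespace DNLSII

section
variable {k : ℕ} {a c : ℝ} {l : Fin k → ℂ} {s : ℂ → ℂ}

/-- `W` formed from the odd Taylor series, with smooth functions on the plane as entries. -/
noncomputable def IsBranch.smoothW (hs : IsBranch a c s) (ha : a < 0) (l : Fin k → ℂ) :
    Matrix (Fin (2 * k)) (Fin (2 * k)) SmoothFun :=
  taylorMat (altRow (PowerSeries.C (SmoothFun.cst (lam0 a c)) + PowerSeries.X)
      (hs.oddF ha l) (hs.oddG ha l))
    (altRow (-(PowerSeries.C (SmoothFun.cst (lam0 a c)) + PowerSeries.X))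
      (hs.oddG ha l) (hs.oddF ha l))

/-- `Ŵ` formed from the odd Taylor series, with smooth functions on the plane as entries. -/
noncomputable def IsBranch.smoothWhat (hs : IsBranch a c s) (ha : a < 0) (l : Fin k → ℂ) :
    Matrix (Fin (2 * k)) (Fin (2 * k)) SmoothFun :=
  taylorMat (altRow (PowerSeries.C (SmoothFun.cst (lam0 a c)) + PowerSeries.X)
      (hs.oddG ha l) (hs.oddF ha l))
    (altRow (-(PowerSeries.C (SmoothFun.cst (lam0 a c)) + PowerSeries.X))
      (hs.oddF ha l) (hs.oddG ha l))

/-- `M` formed from the odd Taylor series, with smooth functions on the plane as entries. -/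
noncomputable def IsBranch.smoothM (hs : IsBranch a c s) (ha : a < 0) (l : Fin k → ℂ) :
    Matrix (Fin (2 * k)) (Fin (2 * k)) SmoothFun :=
  taylorMat (altRow' (PowerSeries.C (SmoothFun.cst (lam0 a c)) + PowerSeries.X)
      (hs.oddF ha l) (hs.oddG ha l))
    (altRow' (-(PowerSeries.C (SmoothFun.cst (lam0 a c)) + PowerSeries.X))
      (hs.oddG ha l) (hs.oddF ha l))

theorem map_eval_lam0 (p : ℝ × ℝ) : PowerSeries.map (SmoothFun.eval p)
    (PowerSeries.C (SmoothFun.cst (lam0 a c)) + PowerSeries.X)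
      = PowerSeries.C (lam0 a c) + PowerSeries.X := by
  rw [map_add, PowerSeries.map_C, PowerSeries.map_X, SmoothFun.eval_algebraMap]

theorem IsBranch.map_eval_smoothW (hs : IsBranch a c s) (ha : a < 0) (x t : ℝ) :
    (hs.smoothW ha l).map (SmoothFun.eval (x, t)) = oddCoeffMat
      (fun j ε => altRow (lamEps a c ε) (eigF a c l s x t ε) (eigG a c l s x t ε) j)
      (fun j ε => altRow (-lamEps a c ε) (eigG a c l s x t ε) (eigF a c l s x t ε) j) := by
  have hF := hs.analyticAt_eigF (l := l) ha x t
  have hG := hs.analyticAt_eigG (l := l) ha x t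
  have hL := analyticAt_lamEps (a := a) (c := c) 0
  rw [oddCoeffMat_eq_taylorMat (analyticAt_altRow hL hF hG) (analyticAt_altRow hL.fun_neg hG hF),
    IsBranch.smoothW, taylorMat_map _ (SmoothFun.eval_star _)]
  simp only [map_altRow, map_neg, map_eval_lam0, hs.map_eval_oddF, hs.map_eval_oddG,
    oddTaylor_altRow (analyticAt_comp_ofReal hF) (analyticAt_comp_ofReal hG),
    oddTaylor_altRow_neg (analyticAt_comp_ofReal hG) (analyticAt_comp_ofReal hF)]

theorem IsBranch.map_eval_smoothWhat (hs : IsBranch a c s) (ha : a < 0) (x t : ℝ) :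
    (hs.smoothWhat ha l).map (SmoothFun.eval (x, t)) = oddCoeffMat
      (fun j ε => altRow (lamEps a c ε) (eigG a c l s x t ε) (eigF a c l s x t ε) j)
      (fun j ε => altRow (-lamEps a c ε) (eigF a c l s x t ε) (eigG a c l s x t ε) j) := by
  have hF := hs.analyticAt_eigF (l := l) ha x t
  have hG := hs.analyticAt_eigG (l := l) ha x t
  have hL := analyticAt_lamEps (a := a) (c := c) 0
  rw [oddCoeffMat_eq_taylorMat (analyticAt_altRow hL hG hF) (analyticAt_altRow hL.fun_neg hF hG),
    IsBranch.smoothWhat, taylorMat_map _ (SmoothFun.eval_star _)]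
  simp only [map_altRow, map_neg, map_eval_lam0, hs.map_eval_oddF, hs.map_eval_oddG,
    oddTaylor_altRow (analyticAt_comp_ofReal hG) (analyticAt_comp_ofReal hF),
    oddTaylor_altRow_neg (analyticAt_comp_ofReal hF) (analyticAt_comp_ofReal hG)]

theorem IsBranch.map_eval_smoothM (hs : IsBranch a c s) (ha : a < 0) (x t : ℝ) :
    (hs.smoothM ha l).map (SmoothFun.eval (x, t)) = oddCoeffMat
      (fun j ε => altRow' (lamEps a c ε) (eigF a c l s x t ε) (eigG a c l s x t ε) j)
      (fun j ε => altRow' (-lamEps a c ε) (eigG a c l s x t ε) (eigF a c l s x t ε) j) := by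
  have hF := hs.analyticAt_eigF (l := l) ha x t
  have hG := hs.analyticAt_eigG (l := l) ha x t
  have hL := analyticAt_lamEps (a := a) (c := c) 0
  rw [oddCoeffMat_eq_taylorMat (analyticAt_altRow' hL hF hG) (analyticAt_altRow' hL.fun_neg hG hF),
    IsBranch.smoothM, taylorMat_map _ (SmoothFun.eval_star _)]
  simp only [map_altRow', map_neg, map_eval_lam0, hs.map_eval_oddF, hs.map_eval_oddG,
    oddTaylor_altRow' (analyticAt_comp_ofReal hF) (analyticAt_comp_ofReal hG),
    oddTaylor_altRow'_neg (analyticAt_comp_ofReal hG) (analyticAt_comp_ofReal hF)]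

theorem IsBranch.det_primed_WAt (hs : IsBranch a c s) (ha : a < 0) (x t : ℝ) :
    (primed (WAt a c l s x t)).det
      = orderFactor k * SmoothFun.eval (x, t) (hs.smoothW ha l).det := by
  have hF := hs.analyticAt_eigF (l := l) ha x t
  have hG := hs.analyticAt_eigG (l := l) ha x t
  have hL := analyticAt_lamEps (a := a) (c := c) 0
  rw [WAt_eq, det_primed_pairMat (analyticAt_altRow hL hF hG) (analyticAt_altRow hL.fun_neg hG hF),
    SmoothFun.eval_det, hs.map_eval_smoothW]

theorem IsBranch.det_primed_WhatAt (hs : IsBranch a c s) (ha : a < 0) (x t : ℝ) :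
    (primed (WhatAt a c l s x t)).det
      = orderFactor k * SmoothFun.eval (x, t) (hs.smoothWhat ha l).det := by
  have hF := hs.analyticAt_eigF (l := l) ha x t
  have hG := hs.analyticAt_eigG (l := l) ha x t
  have hL := analyticAt_lamEps (a := a) (c := c) 0
  rw [WhatAt_eq,
    det_primed_pairMat (analyticAt_altRow hL hG hF) (analyticAt_altRow hL.fun_neg hF hG),
    SmoothFun.eval_det, hs.map_eval_smoothWhat]

theorem IsBranch.det_primed_MAt (hs : IsBranch a c s) (ha : a < 0) (x t : ℝ) :
    (primed (MAt a c l s x t)).det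
      = orderFactor k * SmoothFun.eval (x, t) (hs.smoothM ha l).det := by
  have hF := hs.analyticAt_eigF (l := l) ha x t
  have hG := hs.analyticAt_eigG (l := l) ha x t
  have hL := analyticAt_lamEps (a := a) (c := c) 0
  rw [MAt_eq,
    det_primed_pairMat (analyticAt_altRow' hL hF hG) (analyticAt_altRow' hL.fun_neg hG hF),
    SmoothFun.eval_det, hs.map_eval_smoothM]

theorem IsBranch.isUnit_det_smoothWhat (hs : IsBranch a c s) (ha : a < 0) (hc : c ≠ 0) :
    IsUnit (hs.smoothWhat ha l).det := by
  refine SmoothFun.isUnit_of_eval_ne_zero fun p => ?_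
  rw [SmoothFun.eval_det, IsBranch.smoothWhat, taylorMat_map _ (SmoothFun.eval_star _)]
  simp only [map_altRow, map_neg, map_eval_lam0]
  refine det_taylorMat_ne_zero (lam0_re_pos ha).ne' (lam0_im_ne_zero hc) ?_
  rw [← PowerSeries.coeff_zero_eq_constantCoeff_apply,
    ← PowerSeries.coeff_zero_eq_constantCoeff_apply, hs.map_eval_oddF, hs.map_eval_oddG,
    coeff_oddTaylor_comp_ofReal (hs.analyticAt_eigF ha p.1 p.2),
    coeff_oddTaylor_comp_ofReal (hs.analyticAt_eigG ha p.1 p.2)]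
  simpa using hs.deriv_eig_ne_zero (l := l) ha hc p.1 p.2

theorem IsBranch.isUnit_det_smoothW (hs : IsBranch a c s) (ha : a < 0) (hc : c ≠ 0) :
    IsUnit (hs.smoothW ha l).det := by
  obtain ⟨σ, hσ, -, h⟩ := star_det_taylorMat (k := k)
    (PowerSeries.C (SmoothFun.cst (lam0 a c)) + PowerSeries.X) (hs.oddF ha l) (hs.oddG ha l)
  have h1 : IsUnit (star (hs.smoothW ha l).det) := by
    rw [IsBranch.smoothW, h]
    exact (IsUnit.of_mul_eq_one _ hσ).mul (hs.isUnit_det_smoothWhat ha hc)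
  simpa using h1.star

/-- The limit of the Darboux potentials. -/
theorem IsBranch.tendsto_qAt (hs : IsBranch a c s) (ha : a < 0) (hc : c ≠ 0) (x t : ℝ) :
    (∀ᶠ ε in degeneration k, (WAt a c l s x t ε).det ≠ 0) ∧
    Tendsto (fun ε => qAt a c l s ε x t) (degeneration k)
      (𝓝 (potential (seed a c x t) ((hs.smoothW ha l).map (SmoothFun.eval (x, t)))
        ((hs.smoothWhat ha l).map (SmoothFun.eval (x, t)))
        ((hs.smoothM ha l).map (SmoothFun.eval (x, t))))) := by
  have hF := hs.analyticAt_eigF (l := l) ha x t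
  have hG := hs.analyticAt_eigG (l := l) ha x t
  have hL := analyticAt_lamEps (a := a) (c := c) 0
  have hF' := hs.eigF_neg (l := l) ha hc x t
  have hG' := hs.eigG_neg (l := l) ha hc x t
  have hdet : ((hs.smoothW ha l).map (SmoothFun.eval (x, t))).det ≠ 0 := by
    rw [← SmoothFun.eval_det]
    exact ((hs.isUnit_det_smoothW ha hc).map (SmoothFun.eval (x, t))).ne_zero
  simp only [qAt, WAt_eq, WhatAt_eq, MAt_eq]
  rw [hs.map_eval_smoothW] at hdet ⊢
  rw [hs.map_eval_smoothWhat, hs.map_eval_smoothM]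
  refine tendsto_potential (hs.tendsto_div_amplitude ha hc)
    (analyticAt_altRow hL hF hG) ?_ (analyticAt_altRow hL.fun_neg hG hF) ?_
    (analyticAt_altRow hL hG hF) ?_ (analyticAt_altRow hL.fun_neg hF hG) ?_
    (analyticAt_altRow' hL hF hG) ?_ (analyticAt_altRow' hL.fun_neg hG hF) ?_ hdet _
  -- Every entry is linear in (f, g) with coefficients even in ε, so it inherits the factor κ = c/A.
  all_goals
    intro j
    filter_upwards [hF', hG'] with ε h1 h2
    simp only [lamEps_neg, h1, h2, altRow_mul, altRow'_mul]

end

end DNLSII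

end

theorem theorem6 (k : ℕ) (hk : 1 ≤ k) (a c : ℝ) (ha : a < 0) (hc : c ≠ 0) (l : Fin k → ℂ)
    (s : ℂ → ℂ) (hs : DNLSII.IsBranch a c s) :
    (∀ x t : ℝ, (DNLSII.primed (DNLSII.WAt a c l s x t)).det ≠ 0) ∧
    DNLSII.IsRogueWave a c l s (fun x t =>
      (DNLSII.primed (DNLSII.WhatAt a c l s x t)).det / (DNLSII.primed (DNLSII.WAt a c l s x t)).det
          * DNLSII.seed a c x t
        - 2 * Complex.I * ((DNLSII.primed (DNLSII.MAt a c l s x t)).det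
            / (DNLSII.primed (DNLSII.WAt a c l s x t)).det)) := by
  obtain ⟨k, rfl⟩ : ∃ m, k = m + 1 := ⟨k - 1, by omega⟩
  have hW := hs.isUnit_det_smoothW (l := l) ha hc
  have hV := hs.isUnit_det_smoothWhat (l := l) ha hc
  have hW0 : ∀ p, SmoothFun.eval p (hs.smoothW ha l).det ≠ 0 := fun p =>
    (hW.map (SmoothFun.eval p)).ne_zero
  obtain ⟨w, hw⟩ := hW.exists_left_inv
  -- The quotient is formed inside the ring of smooth functions, where det W is a unit; smoothness
  -- of the rogue wave is then automatic.
  let Q : SmoothFun := ((hs.smoothWhat ha l).det * DNLSII.seedFun a c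
    - 2 * SmoothFun.cst Complex.I * (hs.smoothM ha l).det) * w
  have hQ : Q * (hs.smoothW ha l).det = (hs.smoothWhat ha l).det * DNLSII.seedFun a c
      - 2 * SmoothFun.cst Complex.I * (hs.smoothM ha l).det := by
    rw [mul_assoc, hw, mul_one]
  have hQe : ∀ x t, SmoothFun.eval (x, t) Q = DNLSII.potential (DNLSII.seed a c x t)
      ((hs.smoothW ha l).map (SmoothFun.eval (x, t)))
      ((hs.smoothWhat ha l).map (SmoothFun.eval (x, t)))
      ((hs.smoothM ha l).map (SmoothFun.eval (x, t))) := by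
    intro x t
    have h := congrArg (SmoothFun.eval (x, t)) hQ
    simp only [map_mul, map_sub, DNLSII.eval_seedFun, SmoothFun.eval_algebraMap, map_ofNat] at h
    rw [DNLSII.potential, ← SmoothFun.eval_det, ← SmoothFun.eval_det,
      ← SmoothFun.eval_det]
    have h0 := hW0 (x, t)
    field_simp
    linear_combination h
  have hQp : (fun x t =>
      (DNLSII.primed (DNLSII.WhatAt a c l s x t)).det / (DNLSII.primed (DNLSII.WAt a c l s x t)).det
          * DNLSII.seed a c x t
        - 2 * Complex.I * ((DNLSII.primed (DNLSII.MAt a c l s x t)).det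
            / (DNLSII.primed (DNLSII.WAt a c l s x t)).det))
      = fun x t => SmoothFun.eval (x, t) Q := by
    funext x t
    rw [hQe, DNLSII.potential, hs.det_primed_WAt ha, hs.det_primed_WhatAt ha,
      hs.det_primed_MAt ha, mul_div_mul_left _ _ DNLSII.orderFactor_ne_zero,
      mul_div_mul_left _ _ DNLSII.orderFactor_ne_zero, SmoothFun.eval_det,
      SmoothFun.eval_det, SmoothFun.eval_det]
  refine ⟨fun x t => ?_, ?_⟩
  · rw [hs.det_primed_WAt ha]
    exact mul_ne_zero DNLSII.orderFactor_ne_zero (hW0 _)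
  · rw [hQp]
    refine ⟨SmoothFun.isSolution ?_, fun x t => ?_⟩
    · exact (hs.laxKernel (l := l) ha hc (k + 1)).isSolution_of_taylorMat
        ((isUnit_iff_ne_zero.mpr (DNLSII.lam0_ne_zero ha)).map (algebraMap ℂ SmoothFun))
        (SmoothFun.dir_algebraMap _ _) (SmoothFun.dir_algebraMap _ _) rfl rfl rfl hV hQ
    · beta_reduce
      rw [hQe]
      exact hs.tendsto_qAt ha hc x t
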